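/- **Theorem 3.2.** Let $X$ be a real Hausdorff locally convex space with dual $X^*$, and let $\gamma$ be a Radon centered Gaussian measure on $X$ (a Borel probability measure, inner regular with respect to compact sets on Borel sets, such that every $l\in X^*$ is a centered, possibly degenerate, Gaussian random variable on $(X,\gamma)$). Let $H$ be the Cameron–Martin space of $\gamma$: the space of all $h\in X$ with $$|h|_H=\sup\Bigl\{l(h):\ l\in X^*,\ \int_X l^2\,d\gamma\le 1\Bigr\}<\infty .$$ For $h\in H$ let $\widehat h$ be the unique element of the closure of $X^*$ in $L^2(\gamma)$ with $l(h)=\int_X l\,\widehat h\,d\gamma$ for all $l\in X^*$; $H$ is a Hilbert space with $\langle h,k\rangle_H=\int_X\widehat h\,\widehat k\,d\gamma$ and norm $|\cdot|_H$. Let $\mathcal{FC}^\infty(X,H)$ (respectively $\mathcal{FC}_0^\infty(X,H)$) be the class of vector fields $$\Phi(x)=\sum_{i=1}^n\Psi_i(g_1(x),\dots,g_n(x))\,h_i,\qquad g_i\in X^*,\ h_i\in H,$$ where every $\Psi_i$ is a smooth function on $\mathbb R^n$ that is bounded together with each of its derivatives (respectively has compact support), and set $$\mathrm{div}_\gamma\Phi=\sum_{i=1}^n\Bigl(\sum_{j=1}^n\partial_{x_j}\Psi_i(g_1,\dots,g_n)\,g_j(h_i)-\Psi_i(g_1,\dots,g_n)\,\widehat{h_i}\Bigr).$$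 Let $p\in(1,\infty)$, $1/p+1/q=1$, $\alpha\in(0,1]$ and $f\in L^p(\gamma)$, and let $\|\cdot\|_r$ denote the norm of $L^r(\gamma)$ or of $L^r(\gamma,H)$. We say that $f\in B^\alpha_p(\gamma)$ if there is a number $C$ such that $$\int_X f\,\mathrm{div}_\gamma\Phi\,d\gamma\le C\,\|\Phi\|_q^{\alpha}\,\|\mathrm{div}_\gamma\Phi\|_q^{1-\alpha}\qquad\forall\,\Phi\in\mathcal{FC}_0^\infty(X,H)$$ (with $0^0=1$), and $V^{p,\alpha}_\gamma(f)\in[0,\infty]$ is the infimum of such numbers $C\ge 0$ ($\infty$ if there are none). Put $$T_tf(x)=\int_X f\bigl(e^{-t}x+\sqrt{1-e^{-2t}}\,y\bigr)\,\gamma(dy),\qquad U^{p,\alpha}_\gamma(f)=\sup_{t>0}t^{\frac{1-\alpha}{2}}\|\nabla T_tf\|_p ,$$ where $u\in W^{p,1}(\gamma)$ with gradient $\nabla u$ means that $u\in L^p(\gamma)$, $\nabla u\in L^p(\gamma,H)$ and $\int_X\langle\Phi,\nabla u\rangle_H\,d\gamma=-\int_X u\,\mathrm{div}_\gamma\Phi\,d\gamma$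 for all $\Phi\in\mathcal{FC}^\infty(X,H)$, and $\|\nabla u\|_p=\infty$ if $u\notin W^{p,1}(\gamma)$. Then $f\in B^\alpha_p(\gamma)$ if and only if $U^{p,\alpha}_\gamma(f)<\infty$. Moreover, $$U^{p,\alpha}_\gamma(f)\le C(q)^{1-\alpha}\,V^{p,\alpha}_\gamma(f),\qquad V^{p,\alpha}_\gamma(f)\le\bigl(4C(p)\alpha^{-1}+1\bigr)\,U^{p,\alpha}_\gamma(f),$$ where $$C(r)=\Bigl((2\pi)^{-1/2}\int_{\mathbb R}|s|^re^{-s^2/2}\,ds\Bigr)^{1/r}.$$ -/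

import Mathlib

open MeasureTheory ProbabilityTheory
open scoped ENNReal NNReal ContDiff

noncomputable section

namespace GaussianNB

section CameronMartinSpace

variable {X : Type*} [AddCommGroup X] [Module ℝ X] [TopologicalSpace X]
  [MeasurableSpace X]

/-- The set of values `l h`, where `l` ranges over the continuous linear functionals with
`∫ l² dγ ≤ 1`; its supremum is the Cameron-Martin norm of `h`. -/
def dualValues (γ : Measure X) (h : X) : Set ℝ :=
  {r | ∃ l : X →L[ℝ] ℝ, ∫ x, (l x) ^ 2 ∂γ ≤ 1 ∧ l h = r}

/-- The Cameron-Martin space of `γ` as a linear subspace of `X`: all `h` for which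
`|h|_H = sup {l h : ∫ l² dγ ≤ 1}` is finite. -/
def cameronMartinSubmodule (γ : Measure X) : Submodule ℝ X where
  carrier := {h | BddAbove (dualValues γ h)}
  zero_mem' := by
    refine ⟨0, ?_⟩
    rintro r ⟨l, -, rfl⟩
    simp
  add_mem' := by
    rintro a b ⟨C, hC⟩ ⟨D, hD⟩
    refine ⟨C + D, ?_⟩
    rintro r ⟨l, hl, rfl⟩
    rw [map_add]
    exact add_le_add (hC ⟨l, hl, rfl⟩) (hD ⟨l, hl, rfl⟩)
  smul_mem' := by
    rintro c a ⟨C, hC⟩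
    refine ⟨|c| * C, ?_⟩
    rintro r ⟨l, hl, rfl⟩
    have h1 : l a ≤ C := hC ⟨l, hl, rfl⟩
    have h2 : -(l a) ≤ C := hC ⟨-l, by simpa using hl, by simp⟩
    rw [map_smul, smul_eq_mul]
    calc c * l a ≤ |c * l a| := le_abs_self _
      _ = |c| * |l a| := abs_mul _ _
      _ ≤ |c| * C := mul_le_mul_of_nonneg_left (abs_le.2 ⟨by linarith, h1⟩) (abs_nonneg _)

/-- The Cameron-Martin space `H` of `γ`, as a type of its own: it carries the Hilbert norm
introduced below and not the topology of `X`. -/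
def CameronMartin (γ : Measure X) : Type _ := ↥(cameronMartinSubmodule γ)

instance (γ : Measure X) : AddCommGroup (CameronMartin γ) :=
  inferInstanceAs (AddCommGroup ↥(cameronMartinSubmodule γ))

instance (γ : Measure X) : Module ℝ (CameronMartin γ) :=
  inferInstanceAs (Module ℝ ↥(cameronMartinSubmodule γ))

/-- The inclusion of `H` in `X`. -/
def incl (γ : Measure X) : CameronMartin γ →ₗ[ℝ] X := (cameronMartinSubmodule γ).subtype

lemma incl_injective (γ : Measure X) : Function.Injective (incl γ) :=
  (cameronMartinSubmodule γ).injective_subtype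

lemma incl_bddAbove (γ : Measure X) (h : CameronMartin γ) : BddAbove (dualValues γ (incl γ h)) :=
  h.2

variable [BorelSpace X]

lemma memLp_dual (γ : Measure X) [IsGaussian γ] (l : X →L[ℝ] ℝ) : MemLp l 2 γ := by
  have hl : Measurable l := l.continuous.measurable
  suffices MemLp (id ∘ l) 2 γ from this
  rw [← memLp_map_measure_iff (by fun_prop) hl.aemeasurable, IsGaussian.map_eq_gaussianReal l]
  exact memLp_id_gaussianReal 2

/-- The map sending a continuous linear functional to its class in `L²(γ)`. -/
def dualL2 (γ : Measure X) [IsGaussian γ] : (X →L[ℝ] ℝ) →ₗ[ℝ] Lp ℝ 2 γ where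
  toFun l := (memLp_dual γ l).toLp l
  map_add' _ _ := rfl
  map_smul' _ _ := rfl

/-- The space `X*_γ`: the closure of `X*` in `L²(γ)`. -/
def dualClosure (γ : Measure X) [IsGaussian γ] : Submodule ℝ (Lp ℝ 2 γ) :=
  (LinearMap.range (dualL2 γ)).topologicalClosure

lemma inner_dualL2 (γ : Measure X) [IsGaussian γ] (l : X →L[ℝ] ℝ) (g : Lp ℝ 2 γ) :
    inner ℝ (dualL2 γ l) g = ∫ x, l x * g x ∂γ := by
  rw [L2.inner_def]
  refine integral_congr_ae ?_
  filter_upwards [(memLp_dual γ l).coeFn_toLp] with x hx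
  change inner ℝ (((memLp_dual γ l).toLp l : Lp ℝ 2 γ) x) (g x) = _
  rw [hx]
  simp [mul_comm]

lemma norm_dualL2_sq (γ : Measure X) [IsGaussian γ] (l : X →L[ℝ] ℝ) :
    ‖dualL2 γ l‖ ^ 2 = ∫ x, (l x) ^ 2 ∂γ := by
  rw [← real_inner_self_eq_norm_sq, inner_dualL2]
  refine integral_congr_ae ?_
  filter_upwards [(memLp_dual γ l).coeFn_toLp] with x hx
  change l x * (((memLp_dual γ l).toLp l : Lp ℝ 2 γ) x) = _
  rw [hx, sq]

lemma le_of_dualValues_le (γ : Measure X) [IsGaussian γ] {h : X} {C : ℝ}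
    (hC : ∀ r ∈ dualValues γ h, r ≤ C) (l : X →L[ℝ] ℝ) : |l h| ≤ C * ‖dualL2 γ l‖ := by
  have key : ∀ l : X →L[ℝ] ℝ, l h ≤ C * ‖dualL2 γ l‖ := by
    intro l
    by_cases h0 : ‖dualL2 γ l‖ = 0
    · rw [h0, mul_zero]
      by_contra! hpos
      have := hC _ ⟨((|C| + 1) / l h) • l, by
        rw [← norm_dualL2_sq, map_smul, norm_smul, h0]; simp, rfl⟩
      rw [smul_apply, smul_eq_mul, div_mul_cancel₀ _ hpos.ne'] at this
      linarith [le_abs_self C]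
    · have hpos : 0 < ‖dualL2 γ l‖ := lt_of_le_of_ne (norm_nonneg _) (Ne.symm h0)
      have := hC _ ⟨(‖dualL2 γ l‖)⁻¹ • l, by
        rw [← norm_dualL2_sq, map_smul, norm_smul, norm_inv, norm_norm, inv_mul_cancel₀ h0]
        simp, rfl⟩
      rw [smul_apply, smul_eq_mul, inv_mul_le_iff₀ hpos] at this
      linarith
  refine abs_le.2 ⟨?_, key l⟩
  have := key (-l)
  rw [map_neg, norm_neg, neg_apply] at this
  linarith

lemma exists_hat (γ : Measure X) [IsGaussian γ] (h : CameronMartin γ) :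
    ∃ g ∈ dualClosure γ, ∀ l : X →L[ℝ] ℝ, inner ℝ (dualL2 γ l) g = l (incl γ h) := by
  obtain ⟨C, hC⟩ := incl_bddAbove γ h
  have hb := le_of_dualValues_le γ (fun r hr => hC hr)
  let ev : (X →L[ℝ] ℝ) →ₗ[ℝ] ℝ :=
    { toFun := fun l => l (incl γ h), map_add' := fun _ _ => rfl, map_smul' := fun _ _ => rfl }
  have hker : LinearMap.ker (dualL2 γ) ≤ LinearMap.ker ev := by
    intro l hl
    rw [LinearMap.mem_ker] at hl ⊢
    have := hb l
    rw [hl, norm_zero, mul_zero] at this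
    exact abs_nonpos_iff.1 this
  let φ : LinearMap.range (dualL2 γ) →ₗ[ℝ] ℝ :=
    (LinearMap.ker (dualL2 γ)).liftQ ev hker ∘ₗ (dualL2 γ).quotKerEquivRange.symm.toLinearMap
  have hφ : ∀ l, φ ⟨dualL2 γ l, l, rfl⟩ = l (incl γ h) := by
    intro l
    have : (dualL2 γ).quotKerEquivRange.symm ⟨dualL2 γ l, l, rfl⟩
        = (LinearMap.ker (dualL2 γ)).mkQ l :=
      (dualL2 γ).quotKerEquivRange_symm_apply_image l _
    change (LinearMap.ker (dualL2 γ)).liftQ ev hker _ = _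
    erw [this]
    rfl
  let φc : StrongDual ℝ (LinearMap.range (dualL2 γ)) := φ.mkContinuous C (by
    rintro ⟨-, l, rfl⟩
    rw [hφ]
    exact hb l)
  obtain ⟨ψ, hψ, -⟩ := exists_extension_norm_eq _ φc
  let g₀ := (InnerProductSpace.toDual ℝ (Lp ℝ 2 γ)).symm ψ
  have : CompleteSpace (dualClosure γ) :=
    (Submodule.isClosed_topologicalClosure _).completeSpace_coe
  refine ⟨(dualClosure γ).starProjection g₀, Submodule.starProjection_apply_mem _ _, fun l => ?_⟩
  have hl : dualL2 γ l ∈ dualClosure γ := Submodule.le_topologicalClosure _ ⟨l, rfl⟩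
  have h1 := Submodule.starProjection_inner_eq_zero (K := dualClosure γ) g₀ _ hl
  rw [inner_sub_left, sub_eq_zero] at h1
  rw [real_inner_comm, ← h1, InnerProductSpace.toDual_symm_apply]
  have := hψ ⟨dualL2 γ l, l, rfl⟩
  rw [this]
  exact hφ l

lemma dualClosure_ext (γ : Measure X) [IsGaussian γ] {g g' : Lp ℝ 2 γ}
    (hg : g ∈ dualClosure γ) (hg' : g' ∈ dualClosure γ)
    (H : ∀ l : X →L[ℝ] ℝ, inner ℝ (dualL2 γ l) g = inner ℝ (dualL2 γ l) g') : g = g' := by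
  have h1 : g - g' ∈ (dualClosure γ)ᗮ := by
    rw [dualClosure, Submodule.orthogonal_closure, Submodule.mem_orthogonal]
    rintro - ⟨l, rfl⟩
    rw [inner_sub_right, H, sub_self]
  have h2 := Submodule.inner_right_of_mem_orthogonal (sub_mem hg hg') h1
  exact sub_eq_zero.1 (inner_self_eq_zero.1 h2)

/-- The linear map `h ↦ ĥ`, where `ĥ` is the unique element of `X*_γ` with
`l h = ∫ l ĥ dγ` for all continuous linear functionals `l`. -/
def hat (γ : Measure X) [IsGaussian γ] : CameronMartin γ →ₗ[ℝ] Lp ℝ 2 γ where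
  toFun h := (exists_hat γ h).choose
  map_add' h k := by
    refine dualClosure_ext γ (exists_hat γ _).choose_spec.1
      (add_mem (exists_hat γ _).choose_spec.1 (exists_hat γ _).choose_spec.1) fun l => ?_
    rw [inner_add_right, (exists_hat γ (h + k)).choose_spec.2, (exists_hat γ h).choose_spec.2,
      (exists_hat γ k).choose_spec.2, map_add, map_add]
  map_smul' c h := by
    refine dualClosure_ext γ (exists_hat γ _).choose_spec.1
      (Submodule.smul_mem _ _ (exists_hat γ _).choose_spec.1) fun l => ?_
    rw [RingHom.id_apply, inner_smul_right, (exists_hat γ (c • h)).choose_spec.2,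
      (exists_hat γ h).choose_spec.2, map_smul, map_smul, smul_eq_mul]

lemma hat_mem (γ : Measure X) [IsGaussian γ] (h : CameronMartin γ) : hat γ h ∈ dualClosure γ :=
  (exists_hat γ h).choose_spec.1

lemma inner_hat (γ : Measure X) [IsGaussian γ] (h : CameronMartin γ) (l : X →L[ℝ] ℝ) :
    inner ℝ (dualL2 γ l) (hat γ h) = l (incl γ h) :=
  (exists_hat γ h).choose_spec.2 l

lemma integral_mul_hat (γ : Measure X) [IsGaussian γ] (h : CameronMartin γ) (l : X →L[ℝ] ℝ) :
    l (incl γ h) = ∫ x, l x * hat γ h x ∂γ := by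
  rw [← inner_hat, inner_dualL2]

variable [IsTopologicalAddGroup X] [ContinuousSMul ℝ X] [LocallyConvexSpace ℝ X] [T2Space X]

lemma hat_injective (γ : Measure X) [IsGaussian γ] : Function.Injective (hat γ) := by
  rw [injective_iff_map_eq_zero]
  intro h hh
  apply incl_injective γ
  rw [map_zero]
  by_contra hne
  obtain ⟨l, hl⟩ := SeparatingDual.exists_ne_zero (R := ℝ) hne
  exact hl (by rw [← inner_hat, hh, inner_zero_right])

/-- The norm of `H`; it is the supremum of `l h` over `∫ l² dγ ≤ 1`, see `norm_eq_sSup`. -/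
instance (γ : Measure X) [IsGaussian γ] : NormedAddCommGroup (CameronMartin γ) :=
  NormedAddCommGroup.induced (CameronMartin γ) (Lp ℝ 2 γ) (hat γ) (hat_injective γ)

/-- The inner product of `H`: the one of `L²(γ)` transported by `h ↦ ĥ`. -/
instance (γ : Measure X) [IsGaussian γ] : InnerProductSpace ℝ (CameronMartin γ) where
  norm_smul_le c h := by
    change ‖hat γ (c • h)‖ ≤ ‖c‖ * ‖hat γ h‖
    rw [map_smul, norm_smul]
  inner h k := inner ℝ (hat γ h) (hat γ k)
  norm_sq_eq_re_inner h := norm_sq_eq_re_inner (𝕜 := ℝ) (hat γ h)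
  conj_inner_symm h k := inner_conj_symm (𝕜 := ℝ) (hat γ h) (hat γ k)
  add_left h k m := by rw [map_add, inner_add_left]
  smul_left h k c := by rw [map_smul, inner_smul_left]

theorem norm_eq_sSup (γ : Measure X) [IsGaussian γ] (h : CameronMartin γ) :
    ‖h‖ = sSup (dualValues γ (incl γ h)) := by
  have hbdd := incl_bddAbove γ h
  have hne : (dualValues γ (incl γ h)).Nonempty := ⟨0, 0, by simp, by simp⟩
  change ‖hat γ h‖ = _
  apply le_antisymm
  · set C := sSup (dualValues γ (incl γ h)) with hCdef
    have hb := le_of_dualValues_le γ (h := incl γ h) (C := C) (fun r hr => le_csSup hbdd hr)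
    have hcl : ∀ g ∈ dualClosure γ, inner ℝ g (hat γ h) ≤ C * ‖g‖ := by
      intro g hg
      have hclosed : IsClosed {g : Lp ℝ 2 γ | inner ℝ g (hat γ h) ≤ C * ‖g‖} :=
        isClosed_le (by fun_prop) (by fun_prop)
      refine closure_minimal ?_ hclosed hg
      rintro - ⟨l, rfl⟩
      change inner ℝ (dualL2 γ l) (hat γ h) ≤ C * ‖dualL2 γ l‖
      rw [inner_hat]
      exact (le_abs_self _).trans (hb l)
    have h1 := hcl _ (hat_mem γ h)
    rw [real_inner_self_eq_norm_sq, sq] at h1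
    by_cases h0 : ‖hat γ h‖ = 0
    · rw [h0]
      exact le_csSup hbdd ⟨0, by simp, by simp⟩
    · exact le_of_mul_le_mul_right h1 (lt_of_le_of_ne (norm_nonneg _) (Ne.symm h0))
  · refine csSup_le hne ?_
    rintro r ⟨l, hl, rfl⟩
    rw [← norm_dualL2_sq] at hl
    have hl1 : ‖dualL2 γ l‖ ≤ 1 := by
      by_contra! hlt
      nlinarith
    rw [← inner_hat]
    calc inner ℝ (dualL2 γ l) (hat γ h) ≤ ‖dualL2 γ l‖ * ‖hat γ h‖ := real_inner_le_norm _ _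
      _ ≤ 1 * ‖hat γ h‖ := mul_le_mul_of_nonneg_right hl1 (norm_nonneg _)
      _ = ‖hat γ h‖ := one_mul _

end CameronMartinSpace

section Classes

variable {X : Type*} [AddCommGroup X] [Module ℝ X] [TopologicalSpace X]
  [MeasurableSpace X]

/-- The data of a smooth cylindrical vector field
`Φ(x) = ∑ i, Ψ_i(g_1(x), …, g_n(x)) h_i` with `Ψ_i` smooth, `g_i ∈ X*` and `h_i ∈ H`. -/
structure CylField (γ : Measure X) where
  /-- The number of terms and of functionals. -/
  n : ℕ
  /-- The coefficient functions. -/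
  Ψ : Fin n → (Fin n → ℝ) → ℝ
  /-- The functionals. -/
  g : Fin n → X →L[ℝ] ℝ
  /-- The directions. -/
  h : Fin n → CameronMartin γ
  smooth : ∀ i, ContDiff ℝ ∞ (Ψ i)

namespace CylField

variable {γ : Measure X}

/-- The vector `(g_1(x), …, g_n(x))`. -/
def coords (Φ : CylField γ) (x : X) : Fin Φ.n → ℝ := fun j => Φ.g j x

/-- The vector field itself. -/
def field (Φ : CylField γ) (x : X) : CameronMartin γ := ∑ i, Φ.Ψ i (Φ.coords x) • Φ.h i

/-- The class `FC^∞(X, H)`: every coefficient is bounded with bounded derivatives of all orders. -/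
def IsBounded (Φ : CylField γ) : Prop :=
  ∀ i, ∀ k : ℕ, ∃ C : ℝ, ∀ y, ‖iteratedFDeriv ℝ k (Φ.Ψ i) y‖ ≤ C

/-- The class `FC_0^∞(X, H)`: every coefficient has compact support. -/
def IsCompactlySupported (Φ : CylField γ) : Prop := ∀ i, HasCompactSupport (Φ.Ψ i)

/-- The Gaussian divergence `∑ i, (∂_{h_i} (Ψ_i ∘ g) - (Ψ_i ∘ g) ĥ_i)`. The derivative of
`Ψ_i ∘ g` along `h_i` is written by the chain rule. -/
def divergence [BorelSpace X] [IsGaussian γ] (Φ : CylField γ) (x : X) : ℝ :=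
  ∑ i, (fderiv ℝ (Φ.Ψ i) (Φ.coords x) (Φ.coords (incl γ (Φ.h i)))
    - Φ.Ψ i (Φ.coords x) * hat γ (Φ.h i) x)

end CylField

/-- The Ornstein-Uhlenbeck semigroup
`T_t f(x) = ∫ f(e^{-t} x + √(1 - e^{-2t}) y) γ(dy)`. -/
def ouSemigroup (γ : Measure X) (t : ℝ) (f : X → ℝ) (x : X) : ℝ :=
  ∫ y, f (Real.exp (-t) • x + √(1 - Real.exp (-2 * t)) • y) ∂γ

variable [BorelSpace X] [IsTopologicalAddGroup X] [ContinuousSMul ℝ X] [LocallyConvexSpace ℝ X]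
  [T2Space X]

/-- `u` belongs to the Sobolev class `W^{p,1}(γ)` and `F` is its gradient: `u ∈ L^p(γ)`,
`F ∈ L^p(γ, H)` and `∫ ⟨Φ, F⟩_H dγ = -∫ u div_γ Φ dγ` for all `Φ` of class `FC^∞(X, H)`. -/
def IsSobolevGradient (γ : Measure X) [IsGaussian γ] (p : ℝ≥0∞) (u : X → ℝ)
    (F : X → CameronMartin γ) : Prop :=
  MemLp u p γ ∧ MemLp F p γ ∧
    ∀ Φ : CylField γ, Φ.IsBounded →
      ∫ x, inner ℝ (Φ.field x) (F x) ∂γ = -∫ x, u x * Φ.divergence x ∂γ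

/-- `‖∇u‖_p`, with the value `∞` if `u` is not in `W^{p,1}(γ)`. The infimum is over all versions
of the gradient, which all have the same norm. -/
def gradNorm (γ : Measure X) [IsGaussian γ] (p : ℝ≥0∞) (u : X → ℝ) : ℝ≥0∞ :=
  ⨅ (F : X → CameronMartin γ) (_ : IsSobolevGradient γ p u F), eLpNorm F p γ

/-- `U^{p,α}_γ(f) = sup_{t > 0} t^{(1 - α)/2} ‖∇ T_t f‖_p`. -/
def semigroupVariation (γ : Measure X) [IsGaussian γ] (p α : ℝ) (f : X → ℝ) : ℝ≥0∞ :=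
  ⨆ (t : ℝ) (_ : 0 < t),
    ENNReal.ofReal (t ^ ((1 - α) / 2)) * gradNorm γ (ENNReal.ofReal p) (ouSemigroup γ t f)

/-- The inequality `∫ f div_γ Φ dγ ≤ C ‖Φ‖_q^α ‖div_γ Φ‖_q^{1-α}` for all `Φ` of class
`FC_0^∞(X, H)`. -/
def DivergenceBound (γ : Measure X) [IsGaussian γ] (q α : ℝ) (f : X → ℝ) (C : ℝ) : Prop :=
  ∀ Φ : CylField γ, Φ.IsCompactlySupported →
    ∫ x, f x * Φ.divergence x ∂γ
      ≤ C * lpNorm Φ.field (ENNReal.ofReal q) γ ^ α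
        * lpNorm Φ.divergence (ENNReal.ofReal q) γ ^ (1 - α)

/-- Membership of `f` in the Gaussian Nikolskii-Besov class `B^α_p(γ)`, where `q` is the exponent
conjugate to `p`. -/
def MemNikolskiiBesov (γ : Measure X) [IsGaussian γ] (p q α : ℝ) (f : X → ℝ) : Prop :=
  MemLp f (ENNReal.ofReal p) γ ∧ ∃ C : ℝ, DivergenceBound γ q α f C

/-- `V^{p,α}_γ(f)`: the infimum of the constants `C ≥ 0` in the divergence inequality, with the
value `∞` if there are none; `q` is the exponent conjugate to `p`. -/
def divergenceVariation (γ : Measure X) [IsGaussian γ] (q α : ℝ) (f : X → ℝ) : ℝ≥0∞ :=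
  ⨅ (C : ℝ≥0) (_ : DivergenceBound γ q α f C), (C : ℝ≥0∞)

/-- `C(r) = ((2π)^{-1/2} ∫ |s|^r e^{-s²/2} ds)^{1/r}`. -/
def gaussianMomentConst (r : ℝ) : ℝ :=
  ((2 * Real.pi) ^ (-(1 / 2) : ℝ) * ∫ s : ℝ, |s| ^ r * Real.exp (-s ^ 2 / 2)) ^ (1 / r)

end Classes

end GaussianNB

end

/-! Write c = e^{-t} and s = √(1 - e^{-2t}), so that c² + s² = 1 and T_t is the operator `mehler γ c
s`. If x and y are independent with law γ, then (cx + sy, sx - cy) has the law of (x, y); this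
reflection invariance (`map_reflection`) yields integration by parts, symmetry, contractivity and
the semigroup law.

Integrating by parts in y gives s⟨h, ∇T_tφ(x)⟩ = c ∫ φ(cx + sy) ĥ(y) γ(dy) for cylindrical φ. Since
‖ĥ‖_r ≤ C(r)|h|, Hölder's inequality yields ‖∇T_tφ‖_p ≤ (c/s) C(q) ‖φ‖_p
(`MixRegular.eLpNorm_le_of_inner_eq`). Moreover ∫ T_t f div Φ = c ∫ f div(T_tΦ)
(`integral_mehler_mul_divergence`), and duality turns the gradient bound into ‖div T_tΦ‖_q ≤ s⁻¹
C(q) ‖Φ‖_q (`lpNorm_divergence_mehlerField_le`).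

Bound of U by V: ∫⟨Φ, ∇T_t f⟩ = -c ∫ f div(T_tΦ). The divergence inequality, extended by cutoffs to
bounded fields and applied to T_tΦ, gives ‖∇T_t f‖_p ≤ c V (C(q)/s)^{1-α}. The elementary inequality
√t e^{-t} ≤ s absorbs the weight t^{(1-α)/2}.

Bound of V by U: split ∫ f div Φ into ∫ (f - T_t f) div Φ and ∫ T_t f div Φ. The second term is at
most U t^{-(1-α)/2} ‖Φ‖_q. For the first, test f - T_t f on cylindrical φ. With L = div ∇, the
derivative of ∫ f T_rφ in r is ∫ f L T_rφ = ∫ T_{r/2}f L T_{r/2}φ, which is bounded by ‖∇T_{r/2}f‖_p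
‖∇T_{r/2}φ‖_q ≤ 2 C(p) U r^{α/2-1} ‖φ‖_q. Integration gives ‖f - T_t f‖_p ≤ 4 C(p) α⁻¹ U t^{α/2},
and t = (‖Φ‖_q/‖div Φ‖_q)² balances the two terms.

On a general locally convex X the map (x, y) ↦ cx + sy is not known to be measurable from the
product σ-algebra to the Borel one, so Fubini's theorem is available only for functions of the
values l(x), l ∈ X*. The Radon property bridges the gap: null sets are preserved
(`ae_ae_mix_notMem`), every L^p function has such a version (`exists_measurable_comp_evalDual`), and
`hat` maps H onto the closure of X* (`exists_hat_eq`), so H is complete and cylindrical functions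
have H-valued gradients. -/

open Filter Topology

set_option linter.unusedSectionVars false

noncomputable section

namespace GaussianNB

/-! ### Rotation invariance of a centered Gaussian law. -/

section Law

variable {X : Type*} [AddCommGroup X] [Module ℝ X] [TopologicalSpace X]
  [MeasurableSpace X] [BorelSpace X]
  {V : Type*} [NormedAddCommGroup V] [NormedSpace ℝ V] [FiniteDimensional ℝ V]
  [MeasurableSpace V] [BorelSpace V]

/-- All continuous linear functionals have mean zero. -/
class IsCenteredMeasure (γ : Measure X) : Prop where
  integral_dual : ∀ l : X →L[ℝ] ℝ, ∫ x, l x ∂γ = 0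

instance (γ : Measure X) [IsGaussian γ] (G : X →L[ℝ] V) : IsGaussian (γ.map G) :=
  isGaussian_map_of_measurable G.continuous.measurable

lemma charFunDual_map_eq (γ : Measure X) [IsGaussian γ] [IsCenteredMeasure γ] (G : X →L[ℝ] V)
    (L : StrongDual ℝ V) :
    charFunDual (γ.map G) L = Complex.exp (-((∫ x, (L (G x)) ^ 2 ∂γ : ℝ) : ℂ) / 2) := by
  have hG : Measurable G := G.continuous.measurable
  have h0 : ∫ v, L v ∂(γ.map G) = 0 := by
    rw [integral_map hG.aemeasurable (by fun_prop)]
    exact IsCenteredMeasure.integral_dual (L.comp G)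
  have hv : Var[L; γ.map G] = ∫ x, (L (G x)) ^ 2 ∂γ := by
    rw [variance_of_integral_eq_zero (by fun_prop) h0,
      integral_map hG.aemeasurable (by fun_prop)]
  rw [IsGaussian.charFunDual_eq, hv, integral_complex_ofReal, h0]
  simp [neg_div]

/-- Invariance of the product of two copies of a centered Gaussian measure under reflections. -/
lemma map_reflection (γ : Measure X) [IsGaussian γ] [IsCenteredMeasure γ] (G : X →L[ℝ] V)
    {c s : ℝ} (h : c ^ 2 + s ^ 2 = 1) :
    (γ.prod γ).map (fun z => (c • G z.1 + s • G z.2, s • G z.1 - c • G z.2))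
      = (γ.prod γ).map (fun z => (G z.1, G z.2)) := by
  have hG : Measurable G := G.continuous.measurable
  have hpr : (γ.prod γ).map (fun z => (G z.1, G z.2)) = (γ.map G).prod (γ.map G) :=
    (Measure.map_prod_map γ γ hG hG).symm
  let T : V × V →L[ℝ] V × V :=
    (c • ContinuousLinearMap.fst ℝ V V + s • ContinuousLinearMap.snd ℝ V V).prod
      (s • ContinuousLinearMap.fst ℝ V V - c • ContinuousLinearMap.snd ℝ V V)
  have hT : (γ.prod γ).map (fun z => (c • G z.1 + s • G z.2, s • G z.1 - c • G z.2))
      = ((γ.map G).prod (γ.map G)).map T := by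
    rw [← hpr, Measure.map_map (by fun_prop) (by fun_prop)]
    rfl
  rw [hT, hpr]
  -- Both laws are centered Gaussian, so only the variances of L have to be compared; they agree
  -- because the block matrix with rows (c, s) and (s, -c) is orthogonal.
  apply Measure.ext_of_charFunDual
  ext L
  rw [charFunDual_map, charFunDual_prod, charFunDual_prod, charFunDual_map_eq, charFunDual_map_eq,
    charFunDual_map_eq, charFunDual_map_eq, ← Complex.exp_add, ← Complex.exp_add]
  congr 1
  rw [← add_div, ← add_div, ← neg_add, ← neg_add, ← Complex.ofReal_add, ← Complex.ofReal_add]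
  congr 3
  have hi : ∀ L' : StrongDual ℝ V, Integrable (fun x => (L' (G x)) ^ 2) γ := fun L' =>
    (memLp_dual γ (L'.comp G)).integrable_sq
  rw [← integral_add (hi _) (hi _), ← integral_add (hi _) (hi _)]
  congr 1
  ext x
  have e1 : L (c • G x, s • G x) = c * L (G x, 0) + s * L (0, G x) := by
    rw [← smul_eq_mul, ← smul_eq_mul, ← L.map_smul, ← L.map_smul, ← L.map_add]
    simp
  have e2 : L (s • G x, -(c • G x)) = s * L (G x, 0) - c * L (0, G x) := by
    rw [← smul_eq_mul, ← smul_eq_mul, ← L.map_smul, ← L.map_smul, ← L.map_sub]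
    simp
  simp only [T, ContinuousLinearMap.comp_apply, ContinuousLinearMap.inl_apply,
    ContinuousLinearMap.inr_apply, ContinuousLinearMap.prod_apply, add_apply,
    sub_apply, smul_apply, ContinuousLinearMap.coe_fst',
    ContinuousLinearMap.coe_snd', smul_zero, add_zero, zero_add, sub_zero, zero_sub, e1, e2]
  linear_combination ((L (G x, 0)) ^ 2 + (L (0, G x)) ^ 2) * h

lemma map_mix (γ : Measure X) [IsGaussian γ] [IsCenteredMeasure γ] (G : X →L[ℝ] V)
    {c s : ℝ} (h : c ^ 2 + s ^ 2 = 1) :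
    (γ.prod γ).map (fun z => G (c • z.1 + s • z.2)) = γ.map G := by
  have hG : Measurable G := G.continuous.measurable
  have := congrArg (Measure.map Prod.fst) (map_reflection γ G h)
  rw [Measure.map_map (by fun_prop) (by fun_prop), Measure.map_map (by fun_prop) (by fun_prop)]
    at this
  simp only [map_add, map_smul]
  refine this.trans ?_
  change Measure.map (G ∘ Prod.fst) (γ.prod γ) = _
  rw [← Measure.map_map hG measurable_fst]
  simp

/-- The canonical map to the space of all functions on the dual. -/
def evalDual (x : X) (l : X →L[ℝ] ℝ) : ℝ := l x

lemma measurable_evalDual : Measurable (evalDual (X := X)) :=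
  measurable_pi_lambda _ fun l => l.continuous.measurable

lemma measurable_evalDual_mix (c s : ℝ) :
    Measurable (fun z : X × X => evalDual (c • z.1 + s • z.2)) := by
  refine measurable_pi_lambda _ fun l => ?_
  have : Measurable l := l.continuous.measurable
  simp only [evalDual, map_add, map_smul]
  fun_prop

/-- A law on the product space is determined by its finite-dimensional marginals, and these are
covered by `map_mix`. Working in the space of all functions on the dual avoids Borel measurability
of (x, y) ↦ cx + sy on X × X. -/
lemma map_evalDual_mix (γ : Measure X) [IsGaussian γ] [IsCenteredMeasure γ]
    {c s : ℝ} (h : c ^ 2 + s ^ 2 = 1) :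
    (γ.prod γ).map (fun z => evalDual (c • z.1 + s • z.2)) = γ.map evalDual := by
  have hp : IsProjectiveLimit (γ.map evalDual)
      (fun I : Finset (X →L[ℝ] ℝ) => (γ.map evalDual).map I.restrict) := fun I => rfl
  have hf : IsFiniteMeasure (γ.map (evalDual (X := X))) :=
    Measure.isFiniteMeasure_map _ _
  refine IsProjectiveLimit.unique (P := fun I : Finset (X →L[ℝ] ℝ) =>
    (γ.map evalDual).map I.restrict) (fun I => ?_) hp
  dsimp only
  rw [Measure.map_map (by fun_prop) (measurable_evalDual_mix c s),
    Measure.map_map (by fun_prop) measurable_evalDual]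
  exact map_mix γ (ContinuousLinearMap.pi fun l : I => (l : X →L[ℝ] ℝ)) h

end Law

/-! ### Separation of compact sets by finitely many functionals. -/

section Separation

variable {X : Type*} [AddCommGroup X] [Module ℝ X] [TopologicalSpace X]
  [IsTopologicalAddGroup X] [ContinuousSMul ℝ X] [LocallyConvexSpace ℝ X] [T2Space X]

/-- Disjoint compact sets are separated by finitely many continuous linear functionals. -/
lemma exists_disjoint_image {K L : Set X} (hK : IsCompact K) (hL : IsCompact L)
    (hKL : Disjoint K L) :
    ∃ (n : ℕ) (G : X →L[ℝ] (Fin (n + 1) → ℝ)), Disjoint (G '' K) (G '' L) := by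
  have hopen : ∀ l : X →L[ℝ] ℝ, IsOpen {z : X × X | l z.1 ≠ l z.2} := fun l =>
    isOpen_ne_fun (by fun_prop) (by fun_prop)
  have hcover : K ×ˢ L ⊆ ⋃ l : X →L[ℝ] ℝ, {z : X × X | l z.1 ≠ l z.2} := by
    rintro ⟨x, y⟩ ⟨hx, hy⟩
    have hne : x - y ≠ 0 := sub_ne_zero.2 (hKL.ne_of_mem hx hy)
    obtain ⟨l, hl⟩ := SeparatingDual.exists_ne_zero (R := ℝ) hne
    rw [map_sub, sub_ne_zero] at hl
    exact Set.mem_iUnion.2 ⟨l, hl⟩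
  obtain ⟨S, hS⟩ := (hK.prod hL).elim_finite_subcover _ hopen hcover
  -- The dummy zero functional makes the number of coordinates positive. A cylindrical field has as
  -- many terms as functionals, and the approximation of a vector-valued indicator needs one term.
  refine ⟨S.card, ContinuousLinearMap.pi (Fin.cons 0 fun i => (S.equivFin.symm i : X →L[ℝ] ℝ)), ?_⟩
  rw [Set.disjoint_left]
  rintro - ⟨x, hx, rfl⟩ ⟨y, hy, hxy⟩
  obtain ⟨l, hlS, hl⟩ := Set.mem_iUnion₂.1 (hS (Set.mk_mem_prod hx hy))
  refine hl ?_
  have := congrFun hxy (Fin.succ (S.equivFin ⟨l, hlS⟩))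
  simpa using this.symm

end Separation

/-! ### Null sets are preserved by the Mehler mixing. -/

section NullSets

variable {X : Type*} [AddCommGroup X] [Module ℝ X] [TopologicalSpace X]
  [IsTopologicalAddGroup X] [ContinuousSMul ℝ X] [LocallyConvexSpace ℝ X] [T2Space X]
  [MeasurableSpace X] [BorelSpace X]

lemma exists_isCompact_measure_compl_lt (γ : Measure X) [IsProbabilityMeasure γ] [γ.InnerRegular]
    {B : Set X} (hB : MeasurableSet B) (hB1 : γ Bᶜ = 0) {ε : ℝ≥0∞} (hε : ε ≠ 0) :
    ∃ K ⊆ B, IsCompact K ∧ γ Kᶜ < ε := by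
  obtain ⟨K, hKB, hK, hlt⟩ := hB.exists_isCompact_sdiff_lt (μ := γ) (measure_ne_top _ _) hε
  refine ⟨K, hKB, hK, ?_⟩
  calc γ Kᶜ ≤ γ (Bᶜ ∪ (B \ K)) := measure_mono fun x hx => by
        by_cases hxB : x ∈ B
        · exact Or.inr ⟨hxB, hx⟩
        · exact Or.inl hxB
    _ ≤ γ Bᶜ + γ (B \ K) := measure_union_le _ _
    _ < ε := by rwa [hB1, zero_add]

/-- This is Markov's inequality for x ↦ γ{y : cx + sy ∉ K}, in a situation where Fubini does not
apply directly. At a point x₀ where the value exceeds a, a compact set C of bad y still has measure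
above a; finitely many functionals separate cx₀ + sC from K, and the tube lemma extends this to a
neighbourhood of x₀. The event is thus locally replaced by a cylindrical one, for which Fubini
holds. -/
lemma measure_mix_compl_isCompact_le (γ : Measure X) [IsGaussian γ] [IsCenteredMeasure γ]
    [γ.InnerRegular] {c s : ℝ} (h : c ^ 2 + s ^ 2 = 1) {K : Set X} (hK : IsCompact K)
    {a : ℝ≥0∞} (ha : a ≠ 0) (ha' : a ≠ ⊤) :
    ∃ U, {x | a < γ {y | c • x + s • y ∉ K}} ⊆ U ∧ γ U ≤ γ Kᶜ / a := by
  have hcont : Continuous fun z : X × X => c • z.1 + s • z.2 := by fun_prop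
  have hpt : ∀ x₀, a < γ {y | c • x₀ + s • y ∉ K} → ∃ (n : ℕ) (G : X →L[ℝ] (Fin (n + 1) → ℝ)),
      ∃ O : Set X, IsOpen O ∧ x₀ ∈ O ∧ ∀ x ∈ O, a < γ {y | G (c • x + s • y) ∉ G '' K} := by
    intro x₀ hx₀
    have hopen : IsOpen {y | c • x₀ + s • y ∉ K} :=
      hK.isClosed.isOpen_compl.preimage (by fun_prop : Continuous fun y => c • x₀ + s • y)
    obtain ⟨C, hCs, hC, hCa⟩ := hopen.measurableSet.exists_lt_isCompact hx₀
    have hC' : IsCompact ((fun y => c • x₀ + s • y) '' C) := hC.image (by fun_prop)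
    obtain ⟨n, G, hG⟩ := exists_disjoint_image hC' hK (by
      rw [Set.disjoint_left]
      rintro - ⟨y, hy, rfl⟩
      exact hCs hy)
    have hW : IsOpen {z : X × X | G (c • z.1 + s • z.2) ∉ G '' K} :=
      (hK.image G.continuous).isClosed.isOpen_compl.preimage (G.continuous.comp hcont)
    obtain ⟨O, O', hO, hO', hx₀O, hCO', hsub⟩ := generalized_tube_lemma (isCompact_singleton (x := x₀))
      hC hW (by
        rintro ⟨x, y⟩ ⟨hx, hy⟩
        rw [Set.mem_singleton_iff] at hx
        simp only at hx hy
        subst hx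
        exact Set.disjoint_left.1 hG ⟨_, ⟨y, hy, rfl⟩, rfl⟩)
    refine ⟨n, G, O, hO, hx₀O rfl, fun x hx => hCa.trans_le (measure_mono fun y hy => ?_)⟩
    exact hsub (Set.mk_mem_prod hx (hCO' hy))
  choose! n G O hO hxO hOG using hpt
  refine ⟨⋃ x ∈ {x | a < γ {y | c • x + s • y ∉ K}}, O x, fun x hx =>
    Set.mem_biUnion hx (hxO x hx), ?_⟩
  have hopen : IsOpen (⋃ x ∈ {x | a < γ {y | c • x + s • y ∉ K}}, O x) :=
    isOpen_biUnion fun x hx => hO x hx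
  -- The union may be uncountable; inner regularity reduces it to compact subsets L, each covered by
  -- finitely many of the neighbourhoods.
  rw [hopen.measurableSet.measure_eq_iSup_isCompact]
  refine iSup_le fun L => iSup_le fun hLU => iSup_le fun hL => ?_
  obtain ⟨S, hS⟩ := hL.elim_finite_subcover
    (fun x : {x | a < γ {y | c • x + s • y ∉ K}} => O x) (fun x => hO x x.2)
    (by rwa [Set.biUnion_eq_iUnion] at hLU)
  let W : Set X := ⋃ x ∈ S, {w | G x w ∉ G x '' K}
  have hGK : ∀ x, IsOpen (G x '' K)ᶜ := fun x => (hK.image (G x).continuous).isClosed.isOpen_compl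
  have hW : MeasurableSet W := Finset.measurableSet_biUnion _ fun x _ =>
    (G x).continuous.measurable (hGK x).measurableSet
  -- The same event seen in the function space, where the law of the mixture is known.
  let T : Set ((X →L[ℝ] ℝ) → ℝ) := ⋃ x ∈ S, {w | (fun i => w ((ContinuousLinearMap.proj i).comp (G x))) ∉ G x '' K}
  have hT : MeasurableSet T := Finset.measurableSet_biUnion _ fun x _ => by
    have hm : Measurable fun w : (X →L[ℝ] ℝ) → ℝ =>
      (fun i => w ((ContinuousLinearMap.proj (R := ℝ) i).comp (G x))) := by fun_prop
    exact hm (hGK x).measurableSet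
  have hWT : W = evalDual ⁻¹' T := by
    simp only [W, T, Set.preimage_iUnion]
    rfl
  have hWK : W ⊆ Kᶜ := by
    intro w hw hwK
    obtain ⟨x, -, hx⟩ := Set.mem_iUnion₂.1 hw
    exact hx ⟨w, hwK, rfl⟩
  have hmeas : MeasurableSet ((fun z : X × X => c • z.1 + s • z.2) ⁻¹' W) := by
    rw [hWT, ← Set.preimage_comp]
    exact measurable_evalDual_mix c s hT
  have hprod : ∫⁻ x, γ {y | c • x + s • y ∈ W} ∂γ = γ W := by
    have h1 := Measure.prod_apply (μ := γ) (ν := γ) hmeas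
    have h2 : (γ.prod γ) ((fun z : X × X => c • z.1 + s • z.2) ⁻¹' W) = γ W := by
      rw [hWT, ← Set.preimage_comp, ← Measure.map_apply measurable_evalDual hT,
        ← map_evalDual_mix γ h, Measure.map_apply (measurable_evalDual_mix c s) hT]
      rfl
    rw [← h2, h1]
    rfl
  calc γ L ≤ γ {x | a ≤ γ {y | c • x + s • y ∈ W}} := by
        refine measure_mono fun x hx => ?_
        obtain ⟨x', hx'S, hx'⟩ := Set.mem_iUnion₂.1 (hS hx)
        refine (hOG x' x'.2 x hx').le.trans (measure_mono fun y hy => ?_)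
        exact Set.mem_biUnion hx'S hy
    _ ≤ (∫⁻ x, γ {y | c • x + s • y ∈ W} ∂γ) / a :=
        meas_ge_le_lintegral_div (measurable_measure_prodMk_left hmeas).aemeasurable ha ha'
    _ ≤ γ Kᶜ / a := by
        rw [hprod]
        exact ENNReal.div_le_div_right (measure_mono hWK) _

/-- Choose a compact K in the complement of a measurable null hull with γ(Kᶜ) < εa. The Markov bound
then makes the set of x with section measure above a of measure at most ε. This is what makes
Mehler's formula depend only on the class of the function. -/
lemma ae_ae_mix_notMem (γ : Measure X) [IsGaussian γ] [IsCenteredMeasure γ] [γ.InnerRegular]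
    {c s : ℝ} (h : c ^ 2 + s ^ 2 = 1) {N : Set X} (hN : γ N = 0) :
    ∀ᵐ x ∂γ, ∀ᵐ y ∂γ, c • x + s • y ∉ N := by
  set N' := toMeasurable γ N
  have hN' : γ N' = 0 := by rw [measure_toMeasurable, hN]
  have hNm : MeasurableSet N' := measurableSet_toMeasurable _ _
  have key : ∀ k : ℕ, γ {x | ((k : ℝ≥0∞) + 1)⁻¹ < γ {y | c • x + s • y ∈ N'}} = 0 := by
    intro k
    set a : ℝ≥0∞ := ((k : ℝ≥0∞) + 1)⁻¹
    have ha : a ≠ 0 := by simp [a]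
    have ha' : a ≠ ⊤ := by simp [a]
    refine le_antisymm (ENNReal.le_of_forall_pos_le_add fun ε hε _ => ?_) zero_le
    obtain ⟨K, hKN, hK, hKε⟩ := exists_isCompact_measure_compl_lt γ hNm.compl (by simpa using hN')
      (ε := ε * a) (by simp [ha, hε.ne'])
    obtain ⟨U, hU, hUle⟩ := measure_mix_compl_isCompact_le γ h hK ha ha'
    rw [zero_add]
    calc γ {x | a < γ {y | c • x + s • y ∈ N'}} ≤ γ U := by
          refine measure_mono fun x hx => hU ?_
          exact lt_of_lt_of_le (b := γ {y | c • x + s • y ∈ N'}) hx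
            (measure_mono fun y hy hyK => hKN hyK hy)
      _ ≤ γ Kᶜ / a := hUle
      _ ≤ ε := ENNReal.div_le_of_le_mul hKε.le
  have hall : ∀ᵐ x ∂γ, ∀ k : ℕ, ¬ ((k : ℝ≥0∞) + 1)⁻¹ < γ {y | c • x + s • y ∈ N'} :=
    ae_all_iff.2 fun k => by
      rw [ae_iff]
      simp only [not_not]
      exact key k
  filter_upwards [hall] with x hx
  have h0 : γ {y | c • x + s • y ∈ N'} = 0 := by
    by_contra hne
    obtain ⟨k, hk⟩ := ENNReal.exists_inv_nat_lt hne
    refine hx k (lt_of_le_of_lt ?_ hk)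
    exact ENNReal.inv_le_inv.2 le_self_add
  rw [ae_iff]
  refine measure_mono_null (fun y hy => ?_) h0
  simp only [not_not] at hy
  exact subset_toMeasurable _ _ hy

end NullSets

end GaussianNB

end

open Filter Topology

set_option linter.unusedSectionVars false

noncomputable section

namespace GaussianNB

/-! ### Gaussian moments and the constant C(r). -/

lemma eLpNorm_id_gaussianReal {r : ℝ} (hr : 0 < r) :
    eLpNorm id (ENNReal.ofReal r) (gaussianReal 0 1) = ENNReal.ofReal (gaussianMomentConst r) := by
  have hm : MemLp id (ENNReal.ofReal r) (gaussianReal 0 1) := memLp_id_gaussianReal r.toNNReal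
  rw [hm.eLpNorm_eq_integral_rpow_norm (by simpa using hr) ENNReal.ofReal_ne_top,
    ENNReal.toReal_ofReal hr.le, gaussianMomentConst,
    integral_gaussianReal_eq_integral_smul one_ne_zero, ← integral_const_mul, one_div r]
  congr 3
  ext x
  rw [gaussianPDFReal, smul_eq_mul, Real.rpow_neg (by positivity), ← Real.sqrt_eq_rpow]
  simp
  ring

lemma gaussianMomentConst_nonneg (r : ℝ) : 0 ≤ gaussianMomentConst r := by
  unfold gaussianMomentConst
  have : 0 ≤ ∫ s : ℝ, |s| ^ r * Real.exp (-s ^ 2 / 2) := integral_nonneg fun s => by positivity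
  positivity

lemma gaussianMomentConst_pos {r : ℝ} (hr : 0 < r) : 0 < gaussianMomentConst r := by
  rw [← ENNReal.ofReal_pos, ← eLpNorm_id_gaussianReal hr, pos_iff_ne_zero]
  intro h
  rw [eLpNorm_eq_zero_iff (by fun_prop) (by simpa using hr)] at h
  have h1 : ∫ x, (id x) ^ 2 ∂(gaussianReal 0 1) = 0 := by
    rw [integral_eq_zero_of_ae]
    filter_upwards [h] with x hx
    rw [hx]
    simp
  have h2 : Var[id; gaussianReal 0 1] = 1 := by simp
  rw [variance_of_integral_eq_zero (by fun_prop) (by simp), h1] at h2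
  exact zero_ne_one h2

section

variable {X : Type*} [AddCommGroup X] [Module ℝ X] [TopologicalSpace X]
  [MeasurableSpace X] [BorelSpace X]
  {V : Type*} [NormedAddCommGroup V] [NormedSpace ℝ V] [FiniteDimensional ℝ V]
  [MeasurableSpace V] [BorelSpace V]
  (γ : Measure X) [IsGaussian γ] [IsCenteredMeasure γ]

lemma map_dual_eq (l : X →L[ℝ] ℝ) :
    γ.map l = (gaussianReal 0 1).map (‖dualL2 γ l‖ * ·) := by
  rw [gaussianReal_map_const_mul, IsGaussian.map_eq_gaussianReal l,
    IsCenteredMeasure.integral_dual l,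
    variance_of_integral_eq_zero l.continuous.measurable.aemeasurable
      (IsCenteredMeasure.integral_dual l)]
  congr 1
  · simp
  · ext
    simp only [NNReal.coe_mk, mul_one, norm_dualL2_sq]
    rw [Real.coe_toNNReal _ (integral_nonneg fun x => sq_nonneg _)]

lemma eLpNorm_dual (l : X →L[ℝ] ℝ) {r : ℝ} (hr : 0 < r) :
    eLpNorm l (ENNReal.ofReal r) γ
      = ENNReal.ofReal (gaussianMomentConst r) * ENNReal.ofReal ‖dualL2 γ l‖ := by
  have h1 : eLpNorm l (ENNReal.ofReal r) γ = eLpNorm id (ENNReal.ofReal r) (γ.map l) := by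
    rw [eLpNorm_map_measure (by fun_prop) l.continuous.measurable.aemeasurable]
    rfl
  rw [h1, map_dual_eq, eLpNorm_map_measure (by fun_prop) (by fun_prop)]
  change eLpNorm (‖dualL2 γ l‖ • (id : ℝ → ℝ)) _ _ = _
  rw [eLpNorm_const_smul, eLpNorm_id_gaussianReal hr, mul_comm, ← ofReal_norm, norm_norm]

/-- On the closure of the dual in `L²(γ)` all `L^r` norms are comparable to the `L²` norm. -/
lemma eLpNorm_le_of_mem_dualClosure {g : Lp ℝ 2 γ} (hg : g ∈ dualClosure γ) {r : ℝ} (hr : 0 < r) :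
    eLpNorm g (ENNReal.ofReal r) γ
      ≤ ENNReal.ofReal (gaussianMomentConst r) * ENNReal.ofReal ‖g‖ := by
  obtain ⟨u, hu, hlim⟩ := mem_closure_iff_seq_limit.1 (show g ∈ closure _ from hg)
  choose l hl using hu
  obtain ⟨ns, hns, hae⟩ := (tendstoInMeasure_of_tendsto_Lp hlim).exists_seq_tendsto_ae
  -- Fatou's lemma along an almost everywhere convergent subsequence of functionals, for which the
  -- bound is an equality.
  refine (Lp.eLpNorm_lim_le_liminf_eLpNorm (fun n => Lp.aestronglyMeasurable (u (ns n))) g hae).trans ?_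
  have h1 : ∀ n, eLpNorm (u (ns n)) (ENNReal.ofReal r) γ
      = ENNReal.ofReal (gaussianMomentConst r) * ENNReal.ofReal ‖u (ns n)‖ := by
    intro n
    rw [← hl, ← eLpNorm_dual γ _ hr]
    exact eLpNorm_congr_ae (memLp_dual γ _).coeFn_toLp
  simp_rw [h1]
  refine (Tendsto.liminf_eq ?_).le
  refine ENNReal.Tendsto.const_mul ?_ (Or.inr ENNReal.ofReal_ne_top)
  exact ENNReal.tendsto_ofReal ((hlim.comp hns.tendsto_atTop).norm)

lemma memLp_of_mem_dualClosure {g : Lp ℝ 2 γ} (hg : g ∈ dualClosure γ) {r : ℝ≥0∞} (hr : r ≠ ⊤) :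
    MemLp g r γ := by
  have h1 : MemLp g (ENNReal.ofReal (r.toReal + 1)) γ :=
    ⟨Lp.aestronglyMeasurable g,
      (eLpNorm_le_of_mem_dualClosure γ hg (by positivity)).trans_lt (by finiteness)⟩
  refine h1.mono_exponent ?_
  rw [ENNReal.le_ofReal_iff_toReal_le hr (by positivity)]
  linarith

lemma memLp_hat (h : CameronMartin γ) {r : ℝ≥0∞} (hr : r ≠ ⊤) : MemLp (hat γ h) r γ :=
  memLp_of_mem_dualClosure γ (hat_mem γ h) hr

omit [IsCenteredMeasure γ] in
lemma memLp_continuousLinearMap (G : X →L[ℝ] V) {r : ℝ≥0∞} (hr : r ≠ ⊤) : MemLp G r γ := by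
  have h : MemLp (id ∘ G) r γ := by
    rw [← memLp_map_measure_iff (by fun_prop) G.continuous.measurable.aemeasurable]
    exact IsGaussian.memLp_id _ _ hr
  exact h

lemma integral_reflection {E : Type*} [NormedAddCommGroup E] [NormedSpace ℝ E] (G : X →L[ℝ] V)
    {F : V × V → E} (hF : Continuous F) {c s : ℝ} (h : c ^ 2 + s ^ 2 = 1) :
    ∫ z, F (c • G z.1 + s • G z.2, s • G z.1 - c • G z.2) ∂(γ.prod γ)
      = ∫ z, F (G z.1, G z.2) ∂(γ.prod γ) := by
  have hG : Measurable G := G.continuous.measurable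
  have hFm : StronglyMeasurable F := hF.stronglyMeasurable
  have h1 := congrArg (fun μ => ∫ z, F z ∂μ) (map_reflection γ G h)
  rwa [integral_map (by fun_prop) hFm.aestronglyMeasurable,
    integral_map (by fun_prop) hFm.aestronglyMeasurable] at h1

end

/-- Continuously differentiable functions, bounded together with their derivative. -/
structure BddC1 {V E : Type*} [NormedAddCommGroup V] [NormedSpace ℝ V] [NormedAddCommGroup E]
    [NormedSpace ℝ E] (Ψ : V → E) : Prop where
  contDiff : ContDiff ℝ 1 Ψ
  bdd : ∃ C, ∀ y, ‖Ψ y‖ ≤ C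
  bdd_fderiv : ∃ C, ∀ y, ‖fderiv ℝ Ψ y‖ ≤ C

namespace BddC1

variable {V W E : Type*} [NormedAddCommGroup V] [NormedSpace ℝ V] [NormedAddCommGroup E]
    [NormedSpace ℝ E] [NormedAddCommGroup W] [NormedSpace ℝ W] {Ψ : V → E}

lemma differentiable (h : BddC1 Ψ) : Differentiable ℝ Ψ := h.contDiff.differentiable one_ne_zero

lemma continuous (h : BddC1 Ψ) : Continuous Ψ := h.contDiff.continuous

lemma continuous_fderiv (h : BddC1 Ψ) : Continuous (fderiv ℝ Ψ) :=
  h.contDiff.continuous_fderiv one_ne_zero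

lemma comp_affine (h : BddC1 Ψ) (A : W →L[ℝ] V) (b : V) : BddC1 (fun w => Ψ (b + A w)) := by
  have hd : ∀ w, fderiv ℝ (fun w => Ψ (b + A w)) w = (fderiv ℝ Ψ (b + A w)).comp A := fun w =>
    ((h.differentiable _).hasFDerivAt.comp w (A.hasFDerivAt.const_add b)).fderiv
  obtain ⟨C, hC⟩ := h.bdd
  obtain ⟨D, hD⟩ := h.bdd_fderiv
  refine ⟨h.contDiff.comp (by fun_prop), ⟨C, fun y => hC _⟩, D * ‖A‖, fun y => ?_⟩
  rw [hd]
  exact (ContinuousLinearMap.opNorm_comp_le _ _).trans (by gcongr; exact hD _)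

lemma comp_linear (h : BddC1 Ψ) (A : W →L[ℝ] V) : BddC1 (fun w => Ψ (A w)) := by
  simpa using h.comp_affine A 0

lemma mul {Ψ Θ : V → ℝ} (h : BddC1 Ψ) (h' : BddC1 Θ) : BddC1 (fun y => Ψ y * Θ y) := by
  obtain ⟨C, hC⟩ := h.bdd
  obtain ⟨D, hD⟩ := h.bdd_fderiv
  obtain ⟨C', hC'⟩ := h'.bdd
  obtain ⟨D', hD'⟩ := h'.bdd_fderiv
  have hC0 : 0 ≤ C := (norm_nonneg _).trans (hC 0)
  have hC0' : 0 ≤ C' := (norm_nonneg _).trans (hC' 0)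
  refine ⟨h.contDiff.mul h'.contDiff, ⟨C * C', fun y => ?_⟩, C * D' + C' * D, fun y => ?_⟩
  · rw [norm_mul]
    exact mul_le_mul (hC y) (hC' y) (norm_nonneg _) hC0
  · have hd : HasFDerivAt (fun y => Ψ y * Θ y) _ y :=
      (h.differentiable y).hasFDerivAt.mul (h'.differentiable y).hasFDerivAt
    rw [hd.fderiv]
    refine (norm_add_le _ _).trans ?_
    rw [norm_smul, norm_smul]
    exact add_le_add (mul_le_mul (hC y) (hD' y) (norm_nonneg _) hC0)
      (mul_le_mul (hC' y) (hD y) (norm_nonneg _) hC0')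

end BddC1

/-! ### Gaussian integration by parts. -/

section Stein

variable {X : Type*} [AddCommGroup X] [Module ℝ X] [TopologicalSpace X]
  [MeasurableSpace X] [BorelSpace X]
  {V : Type*} [NormedAddCommGroup V] [NormedSpace ℝ V] [FiniteDimensional ℝ V]
  [MeasurableSpace V] [BorelSpace V]
  (γ : Measure X) [IsGaussian γ] [IsCenteredMeasure γ]

lemma memLp_comp_of_bdd {E : Type*} [NormedAddCommGroup E] {G : X →L[ℝ] V} {Ψ : V → E}
    (hc : Continuous Ψ) (hb : ∃ C, ∀ y, ‖Ψ y‖ ≤ C) (r : ℝ≥0∞) : MemLp (fun x => Ψ (G x)) r γ := by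
  obtain ⟨C, hC⟩ := hb
  refine MemLp.of_bound ?_ C (ae_of_all _ fun x => hC _)
  exact (hc.stronglyMeasurable.comp_measurable G.continuous.measurable).aestronglyMeasurable

/-- The reflection turns the argument of Ψ into G x and the factor l(y) into s l(x) - c l(y); the
second part integrates to zero because l is centered. -/
lemma integral_comp_rotation_mul_dual {Ψ : V → ℝ} (hΨ : BddC1 Ψ) (G : X →L[ℝ] V) (l : X →L[ℝ] ℝ)
    {c s : ℝ} (h : c ^ 2 + s ^ 2 = 1) :
    ∫ z, Ψ (c • G z.1 + s • G z.2) * l z.2 ∂(γ.prod γ) = s * ∫ x, Ψ (G x) * l x ∂γ := by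
  have h1 := integral_reflection γ (G.prod l)
    (F := fun w : (V × ℝ) × (V × ℝ) => Ψ (c • w.1.1 + s • w.2.1) * w.2.2)
    (by have := hΨ.continuous; fun_prop) h
  simp only [ContinuousLinearMap.prod_apply] at h1
  rw [← h1]
  have hi : Integrable (fun x => Ψ (G x) * l x) γ :=
    (memLp_comp_of_bdd γ hΨ.continuous hΨ.bdd 2).integrable_mul (memLp_dual γ l)
  have hi' : Integrable (fun x => Ψ (G x)) γ :=
    (memLp_comp_of_bdd γ hΨ.continuous hΨ.bdd 1).integrable le_rfl
  have hl : Integrable l γ := (memLp_dual γ l).integrable (by norm_num)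
  have e : ∀ z : X × X, Ψ (c • (c • (G z.1, l z.1) + s • (G z.2, l z.2)).1
      + s • (s • (G z.1, l z.1) - c • (G z.2, l z.2)).1)
        * (s • (G z.1, l z.1) - c • (G z.2, l z.2)).2
      = s * (Ψ (G z.1) * l z.1) - c * (Ψ (G z.1) * l z.2) := by
    intro z
    have : c • (c • G z.1 + s • G z.2) + s • (s • G z.1 - c • G z.2) = G z.1 := by
      have : (c ^ 2 + s ^ 2) • G z.1 = G z.1 := by rw [h, one_smul]
      calc _ = (c ^ 2 + s ^ 2) • G z.1 := by module
        _ = G z.1 := this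
    simp only [Prod.fst_add, Prod.fst_sub, Prod.snd_sub, Prod.smul_fst,
      Prod.smul_snd, this, smul_eq_mul]
    ring
  simp_rw [e]
  rw [integral_sub ((hi.comp_fst γ).const_mul s) ((hi'.mul_prod hl).const_mul c),
    integral_const_mul, integral_const_mul, integral_prod_mul (fun x => Ψ (G x)) l,
    IsCenteredMeasure.integral_dual, mul_zero, mul_zero, sub_zero]
  rw [integral_fun_fst (fun x => Ψ (G x) * l x)]
  simp

/-- Gaussian integration by parts against a continuous linear functional. -/
lemma integral_comp_mul_dual {Ψ : V → ℝ} (hΨ : BddC1 Ψ) (G : X →L[ℝ] V) (l : X →L[ℝ] ℝ) :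
    ∫ x, Ψ (G x) * l x ∂γ = ∫ x, (∫ x', fderiv ℝ Ψ (G x') ∂γ) (G x) * l x ∂γ := by
  have hGm : Measurable G := G.continuous.measurable
  have hlm : Measurable l := l.continuous.measurable
  have hΨc := hΨ.continuous
  have hΨc' := hΨ.continuous_fderiv
  obtain ⟨C, hC⟩ := hΨ.bdd_fderiv
  have hC0 : 0 ≤ C := (norm_nonneg _).trans (hC 0)
  obtain ⟨M, hM⟩ := hΨ.bdd
  have hl : Integrable l γ := (memLp_dual γ l).integrable (by norm_num)
  have hG2 : MemLp G 2 γ := memLp_continuousLinearMap γ G (by norm_num)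
  have hG : Integrable G γ := hG2.integrable (by norm_num)
  let F : ℝ → X × X → ℝ := fun θ z => Ψ (Real.cos θ • G z.1 + Real.sin θ • G z.2) * l z.2
  let F' : ℝ → X × X → ℝ := fun θ z =>
    fderiv ℝ Ψ (Real.cos θ • G z.1 + Real.sin θ • G z.2)
      (-Real.sin θ • G z.1 + Real.cos θ • G z.2) * l z.2
  -- Differentiate at θ = 0 the rotation identity with c = cos θ and s = sin θ. One side is sin θ ·
  -- ∫ Ψ(G) l and has derivative ∫ Ψ(G) l; the other gives ∬ DΨ(Gx)(Gy) l(y).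
  have key := hasDerivAt_integral_of_dominated_loc_of_deriv_le (μ := γ.prod γ) (F := F) (F' := F')
    (x₀ := (0 : ℝ)) (s := Set.univ)
    (bound := fun z => C * (‖G z.1‖ * |l z.2| + ‖G z.2‖ * |l z.2|)) univ_mem
    (Eventually.of_forall fun θ => by
      have : Measurable Ψ := hΨc.measurable
      exact Measurable.aestronglyMeasurable (by fun_prop))
    (by
      have : Integrable (fun z : X × X => Ψ (G z.1) * l z.2) (γ.prod γ) :=
        ((memLp_comp_of_bdd γ hΨc hΨ.bdd 1).integrable le_rfl).mul_prod hl
      simpa [F] using this)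
    (by
      have : Measurable fun w : V × V => fderiv ℝ Ψ w.1 w.2 := by
        apply Continuous.measurable; fun_prop
      have h2 : Measurable fun z : X × X => fderiv ℝ Ψ (Real.cos 0 • G z.1 + Real.sin 0 • G z.2)
        (-Real.sin 0 • G z.1 + Real.cos 0 • G z.2) := by
          exact this.comp (f := fun z : X × X => (Real.cos 0 • G z.1 + Real.sin 0 • G z.2,
            -Real.sin 0 • G z.1 + Real.cos 0 • G z.2)) (by fun_prop)
      exact (h2.mul (by fun_prop)).aestronglyMeasurable)
    (ae_of_all _ fun z θ _ => by
      simp only [F']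
      rw [norm_mul, ← add_mul, ← mul_assoc, Real.norm_eq_abs (l z.2)]
      gcongr
      refine (ContinuousLinearMap.le_opNorm _ _).trans ?_
      refine mul_le_mul (hC _) ((norm_add_le _ _).trans ?_) (norm_nonneg _) hC0
      rw [norm_smul, norm_smul, norm_neg]
      exact add_le_add (mul_le_of_le_one_left (norm_nonneg _) (Real.abs_sin_le_one _))
        (mul_le_of_le_one_left (norm_nonneg _) (Real.abs_cos_le_one _)))
    (by
      refine Integrable.const_mul ?_ C
      have h1 : Integrable (fun x => ‖G x‖ * |l x|) γ :=
        hG2.norm.integrable_mul (memLp_dual γ l).norm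
      exact (hG.norm.mul_prod hl.norm).add (h1.comp_snd γ))
    (ae_of_all _ fun z θ _ => by
      have h1 : HasDerivAt (fun θ => Real.cos θ • G z.1 + Real.sin θ • G z.2)
          (-Real.sin θ • G z.1 + Real.cos θ • G z.2) θ :=
        ((Real.hasDerivAt_cos θ).smul_const _).add ((Real.hasDerivAt_sin θ).smul_const _)
      exact ((hΨ.differentiable _).hasFDerivAt.comp_hasDerivAt θ h1).mul_const _)
  have hA : (fun θ => ∫ z, F θ z ∂(γ.prod γ)) = fun θ => Real.sin θ * ∫ x, Ψ (G x) * l x ∂γ := by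
    ext θ
    exact integral_comp_rotation_mul_dual γ hΨ G l (by rw [add_comm]; exact Real.sin_sq_add_cos_sq θ)
  have hd : HasDerivAt (fun θ => ∫ z, F θ z ∂(γ.prod γ)) (∫ x, Ψ (G x) * l x ∂γ) 0 := by
    rw [hA]
    simpa using (Real.hasDerivAt_sin 0).mul_const (∫ x, Ψ (G x) * l x ∂γ)
  rw [hd.unique key.2, integral_prod_symm _ key.1]
  congr 1
  ext y
  have hi : Integrable (fun x => fderiv ℝ Ψ (G x)) γ :=
    (memLp_comp_of_bdd γ hΨc' hΨ.bdd_fderiv 1).integrable le_rfl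
  simp only [F', Real.cos_zero, Real.sin_zero, one_smul, zero_smul, add_zero, neg_zero, zero_add]
  rw [integral_mul_const, ContinuousLinearMap.integral_apply hi]

/-- The Gaussian integration by parts formula for elements of the closure of the dual. -/
lemma integral_comp_mul_of_mem_dualClosure {Ψ : V → ℝ} (hΨ : BddC1 Ψ) (G : X →L[ℝ] V)
    {g : Lp ℝ 2 γ} (hg : g ∈ dualClosure γ) :
    ∫ x, Ψ (G x) * g x ∂γ
      = inner ℝ (dualL2 γ ((∫ x, fderiv ℝ Ψ (G x) ∂γ).comp G)) g := by
  set lam := (∫ x, fderiv ℝ Ψ (G x) ∂γ).comp G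
  have hm := memLp_comp_of_bdd γ (G := G) hΨ.continuous hΨ.bdd 2
  have hin : ∀ g : Lp ℝ 2 γ, ∫ x, Ψ (G x) * g x ∂γ = inner ℝ hm.toLp g := by
    intro g
    rw [L2.inner_def]
    refine integral_congr_ae ?_
    filter_upwards [hm.coeFn_toLp] with x hx
    rw [hx]
    simp [mul_comm]
  rw [hin, ← sub_eq_zero, ← inner_sub_left]
  -- The formula for functionals says that the functional `lam` is the orthogonal projection of Ψ ∘
  -- G onto the closure of the dual; it therefore extends to every g in this closure.
  have horth : hm.toLp - dualL2 γ lam ∈ (dualClosure γ)ᗮ := by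
    rw [dualClosure, Submodule.orthogonal_closure, Submodule.mem_orthogonal']
    rintro - ⟨l, rfl⟩
    rw [inner_sub_left, sub_eq_zero, inner_dualL2, ← hin]
    have h1 : ∀ u : X → ℝ, ∫ x, u x * (dualL2 γ l) x ∂γ = ∫ x, u x * l x ∂γ := fun u => by
      refine integral_congr_ae ?_
      filter_upwards [(memLp_dual γ l).coeFn_toLp] with x hx
      exact congrArg (u x * ·) hx
    rw [h1, h1]
    exact integral_comp_mul_dual γ hΨ G l
  exact Submodule.inner_left_of_mem_orthogonal hg horth

lemma integral_comp_mul_hat {Ψ : V → ℝ} (hΨ : BddC1 Ψ) (G : X →L[ℝ] V) (h : CameronMartin γ) :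
    ∫ x, Ψ (G x) * hat γ h x ∂γ = ∫ x, fderiv ℝ Ψ (G x) (G (incl γ h)) ∂γ := by
  have hi : Integrable (fun x => fderiv ℝ Ψ (G x)) γ :=
    (memLp_comp_of_bdd γ hΨ.continuous_fderiv hΨ.bdd_fderiv 1).integrable le_rfl
  rw [integral_comp_mul_of_mem_dualClosure γ hΨ G (hat_mem γ h), inner_hat,
    ContinuousLinearMap.comp_apply, ContinuousLinearMap.integral_apply hi]

end Stein

end GaussianNB

end

open Filter Topology

set_option linter.unusedSectionVars false

noncomputable section

/-! ### Smooth bounded functions, Cameron-Martin translations and completeness of H. -/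

namespace GaussianNB

/-- Smooth functions that are bounded together with all derivatives. -/
structure BddSmooth {V E : Type*} [NormedAddCommGroup V] [NormedSpace ℝ V] [NormedAddCommGroup E]
    [NormedSpace ℝ E] (Ψ : V → E) : Prop where
  contDiff : ContDiff ℝ ∞ Ψ
  bdd : ∀ k : ℕ, ∃ C, ∀ y, ‖iteratedFDeriv ℝ k Ψ y‖ ≤ C

namespace BddSmooth

variable {V W E F : Type*} [NormedAddCommGroup V] [NormedSpace ℝ V] [NormedAddCommGroup E]
    [NormedSpace ℝ E] [NormedAddCommGroup W] [NormedSpace ℝ W] [NormedAddCommGroup F]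
    [NormedSpace ℝ F] {Ψ : V → E}

lemma bddC1 (h : BddSmooth Ψ) : BddC1 Ψ := by
  obtain ⟨C, hC⟩ := h.bdd 0
  obtain ⟨D, hD⟩ := h.bdd 1
  refine ⟨h.contDiff.of_le (by simp), ⟨C, fun y => ?_⟩, D, fun y => ?_⟩
  · rw [← norm_iteratedFDeriv_zero (𝕜 := ℝ)]
    exact hC y
  · rw [← norm_iteratedFDeriv_one]
    exact hD y

lemma of_hasCompactSupport (hc : ContDiff ℝ ∞ Ψ) (hs : HasCompactSupport Ψ) : BddSmooth Ψ :=
  ⟨hc, fun k => (hc.continuous_iteratedFDeriv (by exact_mod_cast le_top)).bounded_above_of_compact_support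
    (hs.iteratedFDeriv k)⟩

lemma fderiv (h : BddSmooth Ψ) : BddSmooth (fderiv ℝ Ψ) := by
  refine ⟨h.contDiff.fderiv_right (by simp), fun k => ?_⟩
  obtain ⟨C, hC⟩ := h.bdd (k + 1)
  exact ⟨C, fun y => by rw [norm_iteratedFDeriv_fderiv]; exact hC y⟩

lemma clm_comp (h : BddSmooth Ψ) (A : E →L[ℝ] F) : BddSmooth (fun y => A (Ψ y)) := by
  refine ⟨A.contDiff.comp h.contDiff, fun k => ?_⟩
  obtain ⟨C, hC⟩ := h.bdd k
  refine ⟨‖A‖ * C, fun y => ?_⟩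
  have h1 := A.iteratedFDeriv_comp_left (h.contDiff.contDiffAt (x := y)) (i := k)
    (by exact_mod_cast le_top)
  change ‖iteratedFDeriv ℝ k (A ∘ Ψ) y‖ ≤ _
  rw [h1]
  refine (A.norm_compContinuousMultilinearMap_le _).trans ?_
  gcongr
  exact hC y

lemma fderiv_apply (h : BddSmooth Ψ) (v : V) : BddSmooth (fun y => _root_.fderiv ℝ Ψ y v) :=
  h.fderiv.clm_comp (ContinuousLinearMap.apply ℝ E v)

lemma comp_linear (h : BddSmooth Ψ) (A : W →L[ℝ] V) : BddSmooth (fun w => Ψ (A w)) := by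
  refine ⟨h.contDiff.comp A.contDiff, fun k => ?_⟩
  obtain ⟨C, hC⟩ := h.bdd k
  refine ⟨C * ∏ _i : Fin k, ‖A‖, fun y => ?_⟩
  have h1 := A.iteratedFDeriv_comp_right h.contDiff y (i := k) (by exact_mod_cast le_top)
  change ‖iteratedFDeriv ℝ k (Ψ ∘ A) y‖ ≤ _
  rw [h1]
  refine (ContinuousMultilinearMap.norm_compContinuousLinearMap_le _ _).trans ?_
  gcongr
  exact hC _

lemma const_smul (h : BddSmooth Ψ) (c : ℝ) : BddSmooth (fun y => c • Ψ y) :=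
  h.clm_comp (c • ContinuousLinearMap.id ℝ E)

lemma neg (h : BddSmooth Ψ) : BddSmooth (fun y => -Ψ y) := by
  simpa using h.const_smul (-1)

lemma zero : BddSmooth (fun _ : V => (0 : E)) := by
  refine ⟨contDiff_const, fun k => ⟨0, fun y => ?_⟩⟩
  rw [iteratedFDeriv_fun_zero]
  simp

lemma add {Θ : V → E} (h : BddSmooth Ψ) (h' : BddSmooth Θ) :
    BddSmooth (fun y => Ψ y + Θ y) := by
  refine ⟨h.contDiff.add h'.contDiff, fun k => ?_⟩
  obtain ⟨C, hC⟩ := h.bdd k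
  obtain ⟨D, hD⟩ := h'.bdd k
  refine ⟨C + D, fun y => ?_⟩
  have h1 := iteratedFDeriv_add_apply (𝕜 := ℝ) (i := k) (x := y)
    (h.contDiff.contDiffAt.of_le (by exact_mod_cast le_top))
    (h'.contDiff.contDiffAt.of_le (by exact_mod_cast le_top))
  change ‖iteratedFDeriv ℝ k (Ψ + Θ) y‖ ≤ _
  rw [h1]
  exact (norm_add_le _ _).trans (add_le_add (hC y) (hD y))

end BddSmooth

/-- A smooth compactly supported function that separates a compact set from a closed one. -/
lemma exists_bump {V : Type*} [NormedAddCommGroup V] [NormedSpace ℝ V] [FiniteDimensional ℝ V]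
    {K T : Set V} (hK : IsCompact K) (hT : IsClosed T) (hKT : Disjoint K T) :
    ∃ Ψ : V → ℝ, ContDiff ℝ ∞ Ψ ∧ HasCompactSupport Ψ ∧ (∀ y, Ψ y ∈ Set.Icc 0 1) ∧
      (∀ y ∈ K, Ψ y = 1) ∧ ∀ y ∈ T, Ψ y = 0 := by
  obtain ⟨R, hR⟩ := hK.isBounded.subset_ball 0
  have hB : IsClosed (Metric.ball (0 : V) R)ᶜ := Metric.isOpen_ball.isClosed_compl
  obtain ⟨f, hf0, hf1, hf⟩ := exists_contMDiffMap_zero_one_of_isClosed (n := (⊤ : ℕ∞))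
    (modelWithCornersSelf ℝ V) (hT.union hB) hK.isClosed (by
      rw [Set.disjoint_union_left]
      exact ⟨hKT.symm, Set.disjoint_left.2 fun x hx hxK => hx (hR hxK)⟩)
  refine ⟨f, f.contMDiff.contDiff, ?_, hf, fun y hy => hf1 hy, fun y hy => hf0 (Or.inl hy)⟩
  refine HasCompactSupport.intro (isCompact_closedBall (0 : V) R) fun x hx => hf0 (Or.inr ?_)
  exact fun hx' => hx (Metric.ball_subset_closedBall hx')

section

variable {X : Type*} [AddCommGroup X] [Module ℝ X] [TopologicalSpace X]
  [MeasurableSpace X] [BorelSpace X]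
  {V : Type*} [NormedAddCommGroup V] [NormedSpace ℝ V] [FiniteDimensional ℝ V]
  [MeasurableSpace V] [BorelSpace V]
  (γ : Measure X) [IsGaussian γ] [IsCenteredMeasure γ]

omit [IsCenteredMeasure γ] in
lemma integral_abs_le_norm (g : Lp ℝ 2 γ) : ∫ x, |g x| ∂γ ≤ ‖g‖ := by
  have h1 : eLpNorm g 1 γ ≤ eLpNorm g 2 γ :=
    eLpNorm_le_eLpNorm_of_exponent_le (by norm_num) (Lp.aestronglyMeasurable g)
  have h2 : ∫ x, |g x| ∂γ = (eLpNorm g 1 γ).toReal := by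
    rw [eLpNorm_one_eq_lintegral_enorm, ← integral_norm_eq_lintegral_enorm (Lp.aestronglyMeasurable g)]
    rfl
  rw [h2, Lp.norm_def]
  exact ENNReal.toReal_mono (Lp.eLpNorm_ne_top g) h1

/-- A translation by the mean of `g • G` changes Gaussian expectations by at most the norm of `g`. -/
lemma abs_integral_sub_translate_le {Ψ : V → ℝ} (hΨ : BddC1 Ψ) (hΨ1 : ∀ y, |Ψ y| ≤ 1)
    (G : X →L[ℝ] V) {g : Lp ℝ 2 γ} (hg : g ∈ dualClosure γ) {v : V}
    (hv : ∀ lam : V →L[ℝ] ℝ, inner ℝ (dualL2 γ (lam.comp G)) g = lam v) :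
    |∫ x, Ψ (-v + G x) ∂γ - ∫ x, Ψ (G x) ∂γ| ≤ ‖g‖ := by
  obtain ⟨C, hC⟩ := hΨ.bdd_fderiv
  have hGm : Measurable G := G.continuous.measurable
  have hsh : ∀ w : V, BddC1 (fun y => Ψ (w + y)) := fun w => hΨ.comp_affine (.id ℝ V) w
  have hd : ∀ θ : ℝ, HasDerivAt (fun θ => ∫ x, Ψ (-(θ • v) + G x) ∂γ)
      (∫ x, fderiv ℝ Ψ (-(θ • v) + G x) (-v) ∂γ) θ := by
    intro θ
    refine (hasDerivAt_integral_of_dominated_loc_of_deriv_le (s := Set.univ)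
      (F' := fun θ x => fderiv ℝ Ψ (-(θ • v) + G x) (-v)) (bound := fun _ => C * ‖v‖)
      univ_mem (Eventually.of_forall fun θ => ?_) ?_ ?_ ?_ (integrable_const _) ?_).2
    · exact (memLp_comp_of_bdd γ (hsh _).continuous (hsh _).bdd 1).1
    · exact (memLp_comp_of_bdd γ (hsh _).continuous (hsh _).bdd 1).integrable le_rfl
    · have := hΨ.continuous_fderiv
      exact ((by fun_prop : Continuous fun y => fderiv ℝ Ψ (-(θ • v) + y) (-v)).measurable.comp
        hGm).aestronglyMeasurable
    · refine ae_of_all _ fun x θ _ => (ContinuousLinearMap.le_opNorm _ _).trans ?_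
      rw [norm_neg]
      gcongr
      exact hC _
    · refine ae_of_all _ fun x θ _ => ?_
      have h1 : HasDerivAt (fun θ : ℝ => -(θ • v) + G x) (-v) θ := by
        simpa using (((hasDerivAt_id θ).smul_const v).neg).add_const (G x)
      exact (hΨ.differentiable _).hasFDerivAt.comp_hasDerivAt θ h1
  -- Integration by parts replaces the derivative along v by multiplication by g. Since |Ψ| ≤ 1,
  -- what remains is at most the L¹ norm of g, hence at most its L² norm.
  have hb : ∀ θ : ℝ, ‖∫ x, fderiv ℝ Ψ (-(θ • v) + G x) (-v) ∂γ‖ ≤ ‖g‖ := by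
    intro θ
    have h1 := integral_comp_mul_of_mem_dualClosure γ (hsh (-(θ • v))) G hg
    rw [hv] at h1
    have h2 : ∀ x, fderiv ℝ (fun y => Ψ (-(θ • v) + y)) (G x) = fderiv ℝ Ψ (-(θ • v) + G x) :=
      fun x => by rw [fderiv_comp_add_left]
    have hi : Integrable (fun x => fderiv ℝ (fun y => Ψ (-(θ • v) + y)) (G x)) γ :=
      (memLp_comp_of_bdd γ (hsh _).continuous_fderiv (hsh _).bdd_fderiv 1).integrable le_rfl
    rw [ContinuousLinearMap.integral_apply hi] at h1
    simp_rw [h2] at h1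
    simp only [map_neg]
    rw [integral_neg, norm_neg, ← h1]
    refine (norm_integral_le_integral_norm _).trans (le_trans ?_ (integral_abs_le_norm γ g))
    refine integral_mono_of_nonneg (ae_of_all _ fun _ => norm_nonneg _)
      ((Lp.memLp g).integrable (by norm_num)).abs (ae_of_all _ fun x => ?_)
    exact (norm_mul _ _).trans_le (mul_le_of_le_one_left (norm_nonneg _) (hΨ1 _))
  have h3 := norm_image_sub_le_of_norm_deriv_le_segment_01' (fun θ _ => (hd θ).hasDerivWithinAt)
    (fun θ _ => hb θ)
  simpa using h3

/-- If v were not in G(K - K), the compact sets G(K) and G(K) - v would be disjoint, and a bump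
function equal to 1 on the first and 0 on the second would have mean above 3/4, and below 1/4 after
translation. The translation bound allows a change of at most ‖g‖ < 1/2. -/
lemma exists_sub_eq_of_isCompact (G : X →L[ℝ] V) {g : Lp ℝ 2 γ} (hg : g ∈ dualClosure γ)
    (hg1 : ‖g‖ < 1 / 2) {v : V}
    (hv : ∀ lam : V →L[ℝ] ℝ, inner ℝ (dualL2 γ (lam.comp G)) g = lam v)
    {K : Set X} (hK : IsCompact K) (hKm : MeasurableSet K) (hγ : γ Kᶜ < 1 / 4) :
    ∃ x ∈ K, ∃ y ∈ K, G (x - y) = v := by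
  by_contra! hne
  have hA : IsCompact (G '' K) := hK.image G.continuous
  have hA' : IsCompact ((fun y => -v + y) '' (G '' K)) := hA.image (by fun_prop)
  obtain ⟨Ψ, hΨ, hΨs, hΨ01, hΨ1, hΨ0⟩ := exists_bump hA hA'.isClosed (by
    rw [Set.disjoint_left]
    rintro - ⟨y, hy, rfl⟩ ⟨-, ⟨x, hx, rfl⟩, h⟩
    refine hne x hx y hy ?_
    rw [map_sub, ← h]
    simp)
  have hb : BddC1 Ψ := (BddSmooth.of_hasCompactSupport hΨ hΨs).bddC1
  have h1 := abs_integral_sub_translate_le γ hb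
    (fun y => abs_le.2 ⟨by linarith [(hΨ01 y).1], (hΨ01 y).2⟩) G hg hv
  have hKc : γ.real Kᶜ < 1 / 4 := by
    have := (ENNReal.toReal_lt_toReal (measure_ne_top _ _) (by simp)).2 hγ
    simpa [Measure.real] using this
  have hK1 : γ.real K = 1 - γ.real Kᶜ := by
    rw [← probReal_add_probReal_compl hKm (μ := γ)]; ring
  have hi : ∀ w : V, Integrable (fun x => Ψ (w + G x)) γ := fun w =>
    (memLp_comp_of_bdd γ (hb.comp_affine (.id ℝ V) w).continuous
      (hb.comp_affine (.id ℝ V) w).bdd 1).integrable le_rfl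
  have h2 : γ.real K ≤ ∫ x, Ψ (G x) ∂γ := by
    rw [← integral_indicator_one hKm]
    refine integral_mono ((integrable_const (1 : ℝ)).indicator hKm) (by simpa using hi 0) fun x => ?_
    by_cases hx : x ∈ K
    · simp [hx, hΨ1 _ ⟨x, hx, rfl⟩]
    · simp [hx, (hΨ01 (G x)).1]
  have h3 : ∫ x, Ψ (-v + G x) ∂γ ≤ γ.real Kᶜ := by
    rw [← integral_indicator_one hKm.compl]
    refine integral_mono (hi _) ((integrable_const (1 : ℝ)).indicator hKm.compl) fun x => ?_
    by_cases hx : x ∈ K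
    · simp [hx, hΨ0 (-v + G x) ⟨G x, ⟨x, hx, rfl⟩, rfl⟩]
    · simp [hx, (hΨ01 (-v + G x)).2]
  have := (abs_le.1 h1).1
  linarith

end

/-! ### The Cameron-Martin space fills the closure of the dual. -/

section Radon

variable {X : Type*} [AddCommGroup X] [Module ℝ X] [TopologicalSpace X]
  [IsTopologicalAddGroup X] [ContinuousSMul ℝ X] [LocallyConvexSpace ℝ X] [T2Space X]
  [MeasurableSpace X] [BorelSpace X]
  (γ : Measure X) [IsGaussian γ] [IsCenteredMeasure γ] [γ.InnerRegular]

/-- The vector must solve l(x) = ⟨l, g⟩ for all l. Any finitely many of these closed conditions have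
a common solution in the fixed set K - K by `exists_sub_eq_of_isCompact`, so compactness of K - K
gives a common solution of all. The Cauchy-Schwarz inequality then puts it in H. -/
lemma exists_hat_eq_of_norm_lt {g : Lp ℝ 2 γ} (hg : g ∈ dualClosure γ) (hg1 : ‖g‖ < 1 / 2) :
    ∃ h : CameronMartin γ, hat γ h = g := by
  obtain ⟨K, -, hK, hKγ⟩ := exists_isCompact_measure_compl_lt γ MeasurableSet.univ
    (by simp) (ε := 1 / 4) (by simp)
  have hKK : IsCompact ((fun z : X × X => z.1 - z.2) '' (K ×ˢ K)) :=
    (hK.prod hK).image (by fun_prop)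
  obtain ⟨x, -, hx⟩ := hKK.inter_iInter_nonempty
    (fun l : X →L[ℝ] ℝ => {x | l x = inner ℝ (dualL2 γ l) g})
    (fun l => isClosed_eq l.continuous continuous_const) (fun u => by
      let G : X →L[ℝ] (u → ℝ) := ContinuousLinearMap.pi fun l : u => (l : X →L[ℝ] ℝ)
      obtain ⟨a, ha, b, hb, hab⟩ := exists_sub_eq_of_isCompact γ G hg hg1
        (v := fun l : u => inner ℝ (dualL2 γ l) g) (fun lam => by
          classical
          have h0 : ∀ w, lam w = ∑ l : u, w l • lam (fun j => if l = j then 1 else 0) := fun w =>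
            (lam : (u → ℝ) →ₗ[ℝ] ℝ).pi_apply_eq_sum_univ w
          have h1 : lam.comp G
              = ∑ l : u, lam (fun j => if l = j then 1 else 0) • (l : X →L[ℝ] ℝ) := by
            ext x
            rw [ContinuousLinearMap.comp_apply, h0]
            simp [G, mul_comm]
          rw [h1, map_sum, sum_inner, h0]
          refine Finset.sum_congr rfl fun l _ => ?_
          rw [map_smul, inner_smul_left, smul_eq_mul, mul_comm]
          rfl) hK hK.measurableSet hKγ
      refine ⟨a - b, ⟨(a, b), ⟨ha, hb⟩, rfl⟩, ?_⟩
      simp only [Set.mem_iInter]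
      intro l hl
      exact congrFun hab ⟨l, hl⟩)
  simp only [Set.mem_iInter] at hx
  have hxH : x ∈ cameronMartinSubmodule γ := by
    refine ⟨‖g‖, ?_⟩
    rintro - ⟨l, hl, rfl⟩
    rw [← norm_dualL2_sq] at hl
    have hl1 : ‖dualL2 γ l‖ ≤ 1 := by nlinarith [norm_nonneg (dualL2 γ l)]
    rw [hx l]
    exact (real_inner_le_norm _ _).trans (mul_le_of_le_one_left (norm_nonneg _) hl1)
  let h : CameronMartin γ := ⟨x, hxH⟩
  refine ⟨h, dualClosure_ext γ (hat_mem γ _) hg fun l => ?_⟩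
  exact (inner_hat γ h l).trans (hx l)

/-- For a Radon Gaussian measure every element of `X*_γ` comes from a Cameron-Martin vector. -/
lemma exists_hat_eq {g : Lp ℝ 2 γ} (hg : g ∈ dualClosure γ) :
    ∃ h : CameronMartin γ, hat γ h = g := by
  set c : ℝ := (2 * (‖g‖ + 1))⁻¹
  have hc : 0 < c := by positivity
  obtain ⟨h, hh⟩ := exists_hat_eq_of_norm_lt γ (Submodule.smul_mem _ c hg) (by
    rw [norm_smul, Real.norm_of_nonneg hc.le, inv_mul_lt_iff₀ (by positivity)]
    linarith)
  refine ⟨c⁻¹ • h, ?_⟩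
  rw [map_smul, hh, smul_smul, inv_mul_cancel₀ hc.ne', one_smul]

omit [IsCenteredMeasure γ] [γ.InnerRegular] in
lemma isometry_hat : Isometry (hat γ) :=
  Isometry.of_dist_eq fun h k => by
    rw [dist_eq_norm, dist_eq_norm, ← map_sub]
    rfl

/-- By surjectivity, `hat` is an isometry onto a closed subspace of L²(γ). Completeness is needed to
take limits of gradients in L^p(γ, H). -/
instance : CompleteSpace (CameronMartin γ) := by
  rw [completeSpace_iff_isComplete_range (isometry_hat γ).isUniformInducing]
  have : Set.range (hat γ) = dualClosure γ := by
    ext g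
    refine ⟨?_, fun hg => exists_hat_eq γ hg⟩
    rintro ⟨h, rfl⟩
    exact hat_mem γ h
  rw [this]
  exact (Submodule.isClosed_topologicalClosure _).isComplete

/-- The element of the Cameron-Martin space that represents a continuous linear functional. -/
def ofDual (l : X →L[ℝ] ℝ) : CameronMartin γ :=
  (exists_hat_eq γ (Submodule.le_topologicalClosure _ (LinearMap.mem_range_self (dualL2 γ) l))).choose

lemma hat_ofDual (l : X →L[ℝ] ℝ) : hat γ (ofDual γ l) = dualL2 γ l :=
  (exists_hat_eq γ (Submodule.le_topologicalClosure _ (LinearMap.mem_range_self (dualL2 γ) l))).choose_spec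

lemma hat_ofDual_ae (l : X →L[ℝ] ℝ) : hat γ (ofDual γ l) =ᵐ[γ] l := by
  rw [hat_ofDual]
  exact (memLp_dual γ l).coeFn_toLp

lemma inner_ofDual (l : X →L[ℝ] ℝ) (h : CameronMartin γ) :
    inner ℝ h (ofDual γ l) = l (incl γ h) := by
  rw [real_inner_comm, ← inner_hat, ← hat_ofDual]
  rfl

end Radon

end GaussianNB

end

open Filter Topology

set_option linter.unusedSectionVars false

noncomputable section

namespace GaussianNB

/-! ### Density of cylindrical functions and fields. -/

section Density

variable {X : Type*} [AddCommGroup X] [Module ℝ X] [TopologicalSpace X]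
  [IsTopologicalAddGroup X] [ContinuousSMul ℝ X] [LocallyConvexSpace ℝ X] [T2Space X]
  [MeasurableSpace X] [BorelSpace X]
  (γ : Measure X) [IsGaussian γ] [IsCenteredMeasure γ] [γ.InnerRegular]

/-- Approximate B and its complement from inside by compact sets K and L, separate them by finitely
many functionals, and take a bump function that is 1 on the image of K and 0 on that of L. The error
is at most ‖c‖ and lives on the small set outside K ∪ L. -/
lemma exists_cylindrical_indicator {E : Type*} [NormedAddCommGroup E] [NormedSpace ℝ E] (c : E)
    {B : Set X} (hB : MeasurableSet B) {r : ℝ≥0∞} (hr : r ≠ ⊤) {ε : ℝ≥0∞} (hε : ε ≠ 0) :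
    ∃ (n : ℕ) (G : X →L[ℝ] (Fin (n + 1) → ℝ)) (Ψ : (Fin (n + 1) → ℝ) → ℝ), BddSmooth Ψ ∧
      eLpNorm ((fun x => Ψ (G x) • c) - B.indicator fun _ => c) r γ ≤ ε := by
  obtain ⟨η, hη, hηs⟩ := exists_eLpNorm_indicator_le (μ := γ) hr c hε
  have hη2 : ((η / 2 : ℝ≥0) : ℝ≥0∞) ≠ 0 := by
    simpa using hη.ne'
  obtain ⟨K, hKB, hK, hKlt⟩ := hB.exists_isCompact_sdiff_lt (μ := γ) (measure_ne_top _ _) hη2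
  obtain ⟨L, hLB, hL, hLlt⟩ := hB.compl.exists_isCompact_sdiff_lt (μ := γ) (measure_ne_top _ _) hη2
  obtain ⟨n, G, hG⟩ := exists_disjoint_image hK hL
    (Set.disjoint_left.2 fun x hx hx' => hLB hx' (hKB hx))
  obtain ⟨Ψ, hΨ, hΨs, hΨ01, hΨ1, hΨ0⟩ := exists_bump (hK.image G.continuous)
    (hL.image G.continuous).isClosed hG
  refine ⟨n, G, Ψ, BddSmooth.of_hasCompactSupport hΨ hΨs, ?_⟩
  have hle : γ (B \ K ∪ Bᶜ \ L) ≤ η := by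
    refine (measure_union_le _ _).trans ((add_le_add hKlt.le hLlt.le).trans_eq ?_)
    rw [← ENNReal.coe_add, add_halves]
  refine le_trans (eLpNorm_mono fun x => ?_) (hηs _ hle)
  have hb := hΨ01 (G x)
  by_cases hxB : x ∈ B
  · by_cases hxK : x ∈ K
    · simp [hxB, hΨ1 _ ⟨x, hxK, rfl⟩]
    · have : Ψ (G x) • c - c = (Ψ (G x) - 1) • c := by module
      simp only [Pi.sub_apply, hxB, Set.indicator_of_mem, Set.mem_union, Set.mem_sdiff, hxK,
        not_false_eq_true, and_self, true_or, this, norm_smul]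
      refine mul_le_of_le_one_left (norm_nonneg _) ?_
      rw [Real.norm_eq_abs, abs_le]
      constructor <;> linarith [hb.1, hb.2]
  · by_cases hxL : x ∈ L
    · simp [hxB, hΨ0 _ ⟨x, hxL, rfl⟩]
    · simp only [Pi.sub_apply, hxB, not_false_eq_true, Set.indicator_of_notMem, sub_zero,
        Set.mem_union, Set.mem_sdiff, false_and, Set.mem_compl_iff, hxL, and_self, or_true,
        Set.indicator_of_mem, norm_smul]
      refine mul_le_of_le_one_left (norm_nonneg _) ?_
      rw [Real.norm_eq_abs, abs_le]
      constructor <;> linarith [hb.1, hb.2]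

/-- Smooth bounded cylindrical functions. -/
def IsCylindrical (φ : X → ℝ) : Prop :=
  ∃ (n : ℕ) (G : X →L[ℝ] (Fin n → ℝ)) (Ψ : (Fin n → ℝ) → ℝ), BddSmooth Ψ ∧ φ = fun x => Ψ (G x)

/-- Concatenation of two finite systems of functionals. -/
def appendMap {n m : ℕ} (G : X →L[ℝ] (Fin n → ℝ)) (G' : X →L[ℝ] (Fin m → ℝ)) :
    X →L[ℝ] (Fin (n + m) → ℝ) :=
  ContinuousLinearMap.pi (Fin.append (fun i => (ContinuousLinearMap.proj i).comp G)
    fun i => (ContinuousLinearMap.proj i).comp G')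

/-- The first block of coordinates. -/
def leftCoords (n m : ℕ) : (Fin (n + m) → ℝ) →L[ℝ] (Fin n → ℝ) :=
  ContinuousLinearMap.pi fun i => ContinuousLinearMap.proj (Fin.castAdd m i)

/-- The last block of coordinates. -/
def rightCoords (n m : ℕ) : (Fin (n + m) → ℝ) →L[ℝ] (Fin m → ℝ) :=
  ContinuousLinearMap.pi fun i => ContinuousLinearMap.proj (Fin.natAdd n i)

omit [MeasurableSpace X] [BorelSpace X] in
@[simp] lemma leftCoords_appendMap {n m : ℕ} (G : X →L[ℝ] (Fin n → ℝ)) (G' : X →L[ℝ] (Fin m → ℝ))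
    (x : X) : leftCoords n m (appendMap G G' x) = G x := by
  ext i
  simp [leftCoords, appendMap]

omit [MeasurableSpace X] [BorelSpace X] in
@[simp] lemma rightCoords_appendMap {n m : ℕ} (G : X →L[ℝ] (Fin n → ℝ)) (G' : X →L[ℝ] (Fin m → ℝ))
    (x : X) : rightCoords n m (appendMap G G' x) = G' x := by
  ext i
  simp [rightCoords, appendMap]

omit [MeasurableSpace X] [BorelSpace X] in
lemma IsCylindrical.add {φ ψ : X → ℝ} (h : IsCylindrical φ) (h' : IsCylindrical ψ) :
    IsCylindrical (φ + ψ) := by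
  obtain ⟨n, G, Ψ, hΨ, rfl⟩ := h
  obtain ⟨m, G', Θ, hΘ, rfl⟩ := h'
  refine ⟨n + m, appendMap G G', fun z => Ψ (leftCoords n m z) + Θ (rightCoords n m z),
    (hΨ.comp_linear _).add (hΘ.comp_linear _), ?_⟩
  ext x
  simp

omit [γ.InnerRegular] in
lemma IsCylindrical.memLp {φ : X → ℝ} (h : IsCylindrical φ) (r : ℝ≥0∞) : MemLp φ r γ := by
  obtain ⟨n, G, Ψ, hΨ, rfl⟩ := h
  exact memLp_comp_of_bdd γ hΨ.bddC1.continuous hΨ.bddC1.bdd r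

lemma exists_isCylindrical_eLpNorm_sub_le {f : X → ℝ} {r : ℝ≥0∞} (hr : r ≠ ⊤) (hf : MemLp f r γ)
    {ε : ℝ≥0∞} (hε : ε ≠ 0) : ∃ φ, eLpNorm (f - φ) r γ ≤ ε ∧ IsCylindrical φ := by
  refine hf.induction_dense hr IsCylindrical (fun c B hB _ ε hε => ?_) (fun _ _ => IsCylindrical.add)
    (fun φ hφ => (hφ.memLp γ 1).1) hε
  obtain ⟨n, G, Ψ, hΨ, hle⟩ := exists_cylindrical_indicator γ c hB hr hε
  refine ⟨_, hle, n + 1, G, fun z => c * Ψ z, hΨ.const_smul c, ?_⟩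
  ext x
  simp [mul_comm]

namespace CylField

variable {γ}

/-- The functionals of a cylindrical field as a single linear map. -/
def coordsL (Φ : CylField γ) : X →L[ℝ] (Fin Φ.n → ℝ) := ContinuousLinearMap.pi Φ.g

omit [IsGaussian γ] [IsCenteredMeasure γ] [γ.InnerRegular] [BorelSpace X] in
lemma coords_eq (Φ : CylField γ) (x : X) : Φ.coords x = Φ.coordsL x := rfl

omit [IsGaussian γ] [IsCenteredMeasure γ] [γ.InnerRegular] [BorelSpace X] in
lemma IsBounded.bddSmooth {Φ : CylField γ} (h : Φ.IsBounded) (i : Fin Φ.n) : BddSmooth (Φ.Ψ i) :=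
  ⟨Φ.smooth i, h i⟩

omit [IsGaussian γ] [IsCenteredMeasure γ] [γ.InnerRegular] [BorelSpace X] in
lemma IsCompactlySupported.isBounded {Φ : CylField γ} (h : Φ.IsCompactlySupported) :
    Φ.IsBounded :=
  fun i => (BddSmooth.of_hasCompactSupport (Φ.smooth i) (h i)).bdd

omit [γ.InnerRegular] in
lemma IsBounded.memLp_field {Φ : CylField γ} (h : Φ.IsBounded) (r : ℝ≥0∞) :
    MemLp Φ.field r γ := by
  unfold field
  refine memLp_finsetSum _ fun i _ => ?_
  have h1 : MemLp (fun x => Φ.Ψ i (Φ.coordsL x)) r γ :=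
    memLp_comp_of_bdd γ (h.bddSmooth i).bddC1.continuous (h.bddSmooth i).bddC1.bdd r
  exact (ContinuousLinearMap.toSpanSingleton ℝ (Φ.h i)).comp_memLp' h1

/-- The sum of two cylindrical fields. -/
def append (Φ Θ : CylField γ) : CylField γ where
  n := Φ.n + Θ.n
  Ψ := Fin.append (fun i z => Φ.Ψ i (leftCoords _ _ z)) fun i z => Θ.Ψ i (rightCoords _ _ z)
  g := Fin.append Φ.g Θ.g
  h := Fin.append Φ.h Θ.h
  smooth i := by
    refine Fin.addCases (fun i => ?_) (fun i => ?_) i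
    · rw [Fin.append_left]
      exact (Φ.smooth i).comp (leftCoords _ _).contDiff
    · rw [Fin.append_right]
      exact (Θ.smooth i).comp (rightCoords _ _).contDiff

omit [IsGaussian γ] [IsCenteredMeasure γ] [γ.InnerRegular] [BorelSpace X] in
lemma field_append (Φ Θ : CylField γ) : (Φ.append Θ).field = Φ.field + Θ.field := by
  ext x
  have h1 : leftCoords _ _ ((Φ.append Θ).coords x) = Φ.coords x := by
    ext i
    simp [coords, leftCoords, append]
  have h2 : rightCoords _ _ ((Φ.append Θ).coords x) = Θ.coords x := by
    ext i
    simp [coords, rightCoords, append]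
  change ∑ i : Fin (Φ.n + Θ.n), _ = _
  rw [Fin.sum_univ_add]
  simp only [append] at h1 h2
  simp [append, field, h1, h2]

omit [IsGaussian γ] [IsCenteredMeasure γ] [γ.InnerRegular] [BorelSpace X] in
lemma IsBounded.append {Φ Θ : CylField γ} (h : Φ.IsBounded) (h' : Θ.IsBounded) :
    (Φ.append Θ).IsBounded := by
  intro i
  refine Fin.addCases (fun i => ?_) (fun i => ?_) i
  · simp only [CylField.append, Fin.append_left]
    exact ((h.bddSmooth i).comp_linear (leftCoords Φ.n Θ.n)).bdd
  · simp only [CylField.append, Fin.append_right]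
    exact ((h'.bddSmooth i).comp_linear (rightCoords Φ.n Θ.n)).bdd

end CylField

lemma exists_cylField_eLpNorm_sub_le {F : X → CameronMartin γ} {r : ℝ≥0∞} (hr : r ≠ ⊤)
    (hF : MemLp F r γ) {ε : ℝ≥0∞} (hε : ε ≠ 0) :
    ∃ Φ : CylField γ, Φ.IsBounded ∧ eLpNorm (F - Φ.field) r γ ≤ ε := by
  suffices H : ∃ u, eLpNorm (F - u) r γ ≤ ε ∧ ∃ Φ : CylField γ, Φ.IsBounded ∧ u = Φ.field by
    obtain ⟨-, hle, Φ, hΦ, rfl⟩ := H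
    exact ⟨Φ, hΦ, hle⟩
  refine hF.induction_dense hr
    (fun u => ∃ Φ : CylField γ, Φ.IsBounded ∧ u = Φ.field) (fun c B hB _ ε hε => ?_)
    (by
      rintro - - ⟨Φ, hΦ, rfl⟩ ⟨Θ, hΘ, rfl⟩
      exact ⟨Φ.append Θ, hΦ.append hΘ, (CylField.field_append _ _).symm⟩)
    (by
      rintro - ⟨Φ, hΦ, rfl⟩
      exact (hΦ.memLp_field 1).1) hε
  obtain ⟨n, G, Ψ, hΨ, hle⟩ := exists_cylindrical_indicator γ c hB hr hε
  let Φ : CylField γ :=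
    { n := n + 1
      Ψ := Fin.cons Ψ fun _ _ => 0
      g := fun i => (ContinuousLinearMap.proj i).comp G
      h := fun _ => c
      smooth := fun i => by
        refine Fin.cases ?_ (fun i => ?_) i
        · exact hΨ.contDiff
        · exact contDiff_const }
  refine ⟨_, hle, Φ, fun i => ?_, ?_⟩
  · refine Fin.cases ?_ (fun i => ?_) i
    · exact hΨ.bdd
    · exact BddSmooth.zero.bdd
  · ext x
    change _ = ∑ i : Fin (n + 1), _
    rw [Fin.sum_univ_succ]
    simp [Φ]
    rfl

/-- Every function in `L^p(γ)` has a version that depends on the values of the functionals only. -/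
lemma exists_measurable_comp_evalDual {f : X → ℝ} {r : ℝ≥0∞} (hr0 : r ≠ 0) (hr : r ≠ ⊤)
    (hf : MemLp f r γ) :
    ∃ F : ((X →L[ℝ] ℝ) → ℝ) → ℝ, Measurable F ∧ f =ᵐ[γ] fun x => F (evalDual x) := by
  have h1 : ∀ k : ℕ, ∃ φ, eLpNorm (f - φ) r γ ≤ (k : ℝ≥0∞)⁻¹ ∧ IsCylindrical φ := fun k =>
    exists_isCylindrical_eLpNorm_sub_le γ hr hf (by simp)
  choose φ hφ hcyl using h1
  have hlim : Tendsto (fun k => eLpNorm (φ k - f) r γ) atTop (𝓝 0) := by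
    refine tendsto_of_tendsto_of_tendsto_of_le_of_le tendsto_const_nhds
      ENNReal.tendsto_inv_nat_nhds_zero (fun _ => zero_le) fun k => ?_
    rw [eLpNorm_sub_comm]
    exact hφ k
  obtain ⟨ns, -, hae⟩ := (tendstoInMeasure_of_tendsto_eLpNorm hr0
    (fun k => ((hcyl k).memLp γ 1).1) hf.1 hlim).exists_seq_tendsto_ae
  have h2 : ∀ k, ∃ F : ((X →L[ℝ] ℝ) → ℝ) → ℝ, Measurable F ∧ φ k = fun x => F (evalDual x) := by
    intro k
    obtain ⟨n, G, Ψ, hΨ, h⟩ := hcyl k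
    refine ⟨fun w => Ψ fun i => w ((ContinuousLinearMap.proj i).comp G), ?_, h⟩
    exact hΨ.bddC1.continuous.measurable.comp (by fun_prop)
  choose F hF hFφ using h2
  -- The upper limit is measurable on the whole function space, whether or not the sequence
  -- converges, and agrees with the limit almost everywhere.
  refine ⟨fun w => limsup (fun k => F (ns k) w) atTop, Measurable.limsup fun k => hF _, ?_⟩
  filter_upwards [hae] with x hx
  refine (Tendsto.limsup_eq ?_).symm
  simpa [hFφ] using hx

end Density

/-! ### Mehler's formula on Lebesgue spaces. -/

section Mehler

variable {X : Type*} [AddCommGroup X] [Module ℝ X] [TopologicalSpace X]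
  [IsTopologicalAddGroup X] [ContinuousSMul ℝ X] [LocallyConvexSpace ℝ X] [T2Space X]
  [MeasurableSpace X] [BorelSpace X]
  {E : Type*} [NormedAddCommGroup E] [NormedSpace ℝ E]
  (γ : Measure X) [IsGaussian γ] [IsCenteredMeasure γ]

/-- Mehler's formula with coefficients `c` and `s`. -/
def mehler (c s : ℝ) (u : X → E) (x : X) : E := ∫ y, u (c • x + s • y) ∂γ

/-- Functions for which `u (c x + s y)` is measurable on the product and has the law of `u`. -/
structure MixRegular (c s : ℝ) (u : X → E) : Prop where
  aestronglyMeasurable : AEStronglyMeasurable (fun z : X × X => u (c • z.1 + s • z.2)) (γ.prod γ)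
  eLpNorm_eq : ∀ r, eLpNorm (fun z : X × X => u (c • z.1 + s • z.2)) r (γ.prod γ) = eLpNorm u r γ

variable {γ} {c s : ℝ}

omit [IsTopologicalAddGroup X] [ContinuousSMul ℝ X] [LocallyConvexSpace ℝ X] [T2Space X] in
lemma mixRegular_cylindrical (h : c ^ 2 + s ^ 2 = 1) {V : Type*} [NormedAddCommGroup V]
    [NormedSpace ℝ V] [FiniteDimensional ℝ V] [MeasurableSpace V] [BorelSpace V] (G : X →L[ℝ] V)
    {Ψ : V → E} (hΨ : Continuous Ψ) : MixRegular γ c s fun x => Ψ (G x) := by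
  have hG : Measurable G := G.continuous.measurable
  have hm : Measurable fun z : X × X => G (c • z.1 + s • z.2) := by
    simp only [map_add, map_smul]
    fun_prop
  have hΨm := hΨ.stronglyMeasurable
  refine ⟨(hΨm.comp_measurable hm).aestronglyMeasurable, fun r => ?_⟩
  have h1 := eLpNorm_map_measure (p := r) (μ := γ.prod γ) (hΨm.aestronglyMeasurable) hm.aemeasurable
  have h2 := eLpNorm_map_measure (p := r) (μ := γ) (hΨm.aestronglyMeasurable) hG.aemeasurable
  rw [map_mix γ G h] at h1
  exact h1.symm.trans h2

omit [IsTopologicalAddGroup X] [ContinuousSMul ℝ X] [LocallyConvexSpace ℝ X] [T2Space X] in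
lemma mixRegular_comp_evalDual (h : c ^ 2 + s ^ 2 = 1) {F : ((X →L[ℝ] ℝ) → ℝ) → ℝ}
    (hF : Measurable F) : MixRegular γ c s fun x : X => F (evalDual x) := by
  have hm := measurable_evalDual_mix (X := X) c s
  refine ⟨(hF.comp hm).aestronglyMeasurable, fun r => ?_⟩
  have h1 := eLpNorm_map_measure (p := r) (μ := γ.prod γ) (hF.aestronglyMeasurable) hm.aemeasurable
  have h2 := eLpNorm_map_measure (p := r) (μ := γ) (hF.aestronglyMeasurable)
    measurable_evalDual.aemeasurable
  rw [map_evalDual_mix γ h] at h1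
  exact h1.symm.trans h2

/-- The `L^r` norm of the `L^r` norms of the sections. -/
lemma lintegral_eLpNorm_section {u : X × X → E} (hu : AEStronglyMeasurable u (γ.prod γ)) {r : ℝ}
    (hr : 0 < r) :
    ∫⁻ x, eLpNorm (fun y => u (x, y)) (ENNReal.ofReal r) γ ^ r ∂γ
      = eLpNorm u (ENNReal.ofReal r) (γ.prod γ) ^ r := by
  have h0 : ENNReal.ofReal r ≠ 0 := by simpa using hr
  rw [eLpNorm_eq_lintegral_rpow_enorm_toReal h0 ENNReal.ofReal_ne_top,
    ENNReal.toReal_ofReal hr.le, ← ENNReal.rpow_mul, one_div, inv_mul_cancel₀ hr.ne', ENNReal.rpow_one,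
    lintegral_prod _ (hu.enorm.pow_const r)]
  refine lintegral_congr fun x => ?_
  rw [eLpNorm_eq_lintegral_rpow_enorm_toReal h0 ENNReal.ofReal_ne_top,
    ENNReal.toReal_ofReal hr.le, ← ENNReal.rpow_mul, one_div, inv_mul_cancel₀ hr.ne', ENNReal.rpow_one]

namespace MixRegular

variable {u : X → E}

lemma aestronglyMeasurable_mehler (hu : MixRegular γ c s u) :
    AEStronglyMeasurable (mehler γ c s u) γ :=
  hu.aestronglyMeasurable.integral_prod_right'

lemma integrable_prod (hu : MixRegular γ c s u) {r : ℝ≥0∞} (hr : 1 ≤ r) (h : MemLp u r γ) :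
    Integrable (fun z : X × X => u (c • z.1 + s • z.2)) (γ.prod γ) := by
  have : MemLp (fun z : X × X => u (c • z.1 + s • z.2)) r (γ.prod γ) :=
    ⟨hu.aestronglyMeasurable, by rw [hu.eLpNorm_eq]; exact h.2⟩
  exact this.integrable hr

lemma lintegral_eLpNorm_section (hu : MixRegular γ c s u) {r : ℝ} (hr : 0 < r) :
    ∫⁻ x, eLpNorm (fun y => u (c • x + s • y)) (ENNReal.ofReal r) γ ^ r ∂γ
      = eLpNorm u (ENNReal.ofReal r) γ ^ r := by
  rw [← hu.eLpNorm_eq, ← GaussianNB.lintegral_eLpNorm_section hu.aestronglyMeasurable hr]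

/-- Functions bounded by the `L^r` norms of the sections of `u`. -/
lemma eLpNorm_le_of_le_section (hu : MixRegular γ c s u) {r : ℝ} (hr : 0 < r) {F : Type*}
    [NormedAddCommGroup F] {v : X → F} {C : ℝ≥0∞}
    (hv : ∀ᵐ x ∂γ, ‖v x‖ₑ ≤ C * eLpNorm (fun y => u (c • x + s • y)) (ENNReal.ofReal r) γ) :
    eLpNorm v (ENNReal.ofReal r) γ ≤ C * eLpNorm u (ENNReal.ofReal r) γ := by
  have h0 : ENNReal.ofReal r ≠ 0 := by simpa using hr
  rw [eLpNorm_eq_lintegral_rpow_enorm_toReal h0 ENNReal.ofReal_ne_top, ENNReal.toReal_ofReal hr.le,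
    one_div, ENNReal.rpow_inv_le_iff hr, ENNReal.mul_rpow_of_nonneg _ _ hr.le,
    ← hu.lintegral_eLpNorm_section hr]
  have hm : AEMeasurable (fun x => eLpNorm (fun y => u (c • x + s • y)) (ENNReal.ofReal r) γ ^ r) γ := by
    have h1 : ∀ x, eLpNorm (fun y => u (c • x + s • y)) (ENNReal.ofReal r) γ ^ r
        = ∫⁻ y, ‖u (c • x + s • y)‖ₑ ^ r ∂γ := fun x => by
      rw [eLpNorm_eq_lintegral_rpow_enorm_toReal h0 ENNReal.ofReal_ne_top,
        ENNReal.toReal_ofReal hr.le, ← ENNReal.rpow_mul, one_div, inv_mul_cancel₀ hr.ne',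
        ENNReal.rpow_one]
    simp_rw [h1]
    exact (hu.aestronglyMeasurable.enorm.pow_const r).lintegral_prod_right'
  rw [← lintegral_const_mul'' _ hm]
  refine lintegral_mono_ae ?_
  filter_upwards [hv] with x hx
  rw [← ENNReal.mul_rpow_of_nonneg _ _ hr.le]
  exact ENNReal.rpow_le_rpow hx hr.le

lemma eLpNorm_mehler_le (hu : MixRegular γ c s u) {r : ℝ} (hr : 1 ≤ r) :
    eLpNorm (mehler γ c s u) (ENNReal.ofReal r) γ ≤ eLpNorm u (ENNReal.ofReal r) γ := by
  have h1 : ∀ᵐ x ∂γ, AEStronglyMeasurable (fun y => u (c • x + s • y)) γ :=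
    hu.aestronglyMeasurable.prodMk_left
  refine (hu.eLpNorm_le_of_le_section (C := 1) (by linarith) ?_).trans_eq (one_mul _)
  filter_upwards [h1] with x hx
  rw [one_mul]
  refine (enorm_integral_le_lintegral_enorm _).trans ?_
  rw [← eLpNorm_one_eq_lintegral_enorm]
  exact eLpNorm_le_eLpNorm_of_exponent_le (by simpa using hr) hx

end MixRegular

variable [γ.InnerRegular]

lemma ae_section_congr (h : c ^ 2 + s ^ 2 = 1) {u v : X → E} (huv : u =ᵐ[γ] v) :
    ∀ᵐ x ∂γ, (fun y => u (c • x + s • y)) =ᵐ[γ] fun y => v (c • x + s • y) := by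
  filter_upwards [ae_ae_mix_notMem γ h (ae_iff.1 huv)] with x hx
  filter_upwards [hx] with y hy
  simpa using hy

lemma mehler_congr_ae (h : c ^ 2 + s ^ 2 = 1) {u v : X → E} (huv : u =ᵐ[γ] v) :
    mehler γ c s u =ᵐ[γ] mehler γ c s v := by
  filter_upwards [ae_section_congr h huv] with x hx
  exact integral_congr_ae hx

lemma ae_integrable_section (h : c ^ 2 + s ^ 2 = 1) {f : X → ℝ} {r : ℝ≥0∞} (hr1 : 1 ≤ r)
    (hr : r ≠ ⊤) (hf : MemLp f r γ) :
    ∀ᵐ x ∂γ, Integrable (fun y => f (c • x + s • y)) γ := by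
  obtain ⟨F, hF, hfF⟩ := exists_measurable_comp_evalDual γ (by positivity) hr hf
  have h1 := ((mixRegular_comp_evalDual h hF).integrable_prod hr1
    (hf.ae_eq hfF)).prod_right_ae
  filter_upwards [h1, ae_section_congr h hfF] with x hx hx'
  exact hx.congr hx'.symm

/-- The version of f that depends on the functionals only is regular for the mixing, and passing to
it changes the result on a null set only. For that version the contraction is Jensen's inequality on
the sections followed by Fubini. -/
lemma memLp_mehler (h : c ^ 2 + s ^ 2 = 1) {f : X → ℝ} {r : ℝ} (hr1 : 1 ≤ r)
    (hf : MemLp f (ENNReal.ofReal r) γ) : MemLp (mehler γ c s f) (ENNReal.ofReal r) γ ∧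
      eLpNorm (mehler γ c s f) (ENNReal.ofReal r) γ ≤ eLpNorm f (ENNReal.ofReal r) γ := by
  have hr0 : 0 < r := by linarith
  obtain ⟨F, hF, hfF⟩ := exists_measurable_comp_evalDual γ (by simpa using hr0)
    ENNReal.ofReal_ne_top hf
  have hreg := mixRegular_comp_evalDual (γ := γ) h hF
  have h1 := mehler_congr_ae h hfF
  have h2 : eLpNorm (mehler γ c s f) (ENNReal.ofReal r) γ ≤ eLpNorm f (ENNReal.ofReal r) γ := by
    rw [eLpNorm_congr_ae h1, eLpNorm_congr_ae hfF]
    exact hreg.eLpNorm_mehler_le hr1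
  exact ⟨⟨hreg.aestronglyMeasurable_mehler.congr h1.symm, h2.trans_lt hf.2⟩, h2⟩

lemma mehler_sub (h : c ^ 2 + s ^ 2 = 1) {f g : X → ℝ} {r : ℝ≥0∞} (hr1 : 1 ≤ r)
    (hr : r ≠ ⊤) (hf : MemLp f r γ) (hg : MemLp g r γ) :
    mehler γ c s (f - g) =ᵐ[γ] mehler γ c s f - mehler γ c s g := by
  filter_upwards [ae_integrable_section h hr1 hr hf, ae_integrable_section h hr1 hr hg] with x hx hx'
  exact integral_sub hx hx'

end Mehler

end GaussianNB

end

open Filter Topology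

set_option linter.unusedSectionVars false

noncomputable section

namespace GaussianNB

/-! ### Duality of Lebesgue spaces with values in an inner product space. -/

section Duality

variable {Ω : Type*} [MeasurableSpace Ω] {μ : Measure Ω}
  {E : Type*} [NormedAddCommGroup E] [InnerProductSpace ℝ E] {p q : ℝ}

lemma integrable_inner_of_memLp (hpq : p.HolderConjugate q) {F G : Ω → E}
    (hF : MemLp F (ENNReal.ofReal p) μ) (hG : MemLp G (ENNReal.ofReal q) μ) :
    Integrable (fun x => (inner ℝ (F x) (G x) : ℝ)) μ := by
  have := hpq.ennrealOfReal
  rw [← memLp_one_iff_integrable]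
  exact MemLp.of_bilin (fun a b => (inner ℝ a b : ℝ)) 1 hF hG
    (hF.1.inner hG.1) (ae_of_all _ fun x => by simpa using nnnorm_inner_le_nnnorm (𝕜 := ℝ) (F x) (G x))

/-- Hölder's inequality for the inner product. -/
lemma abs_integral_inner_le (hpq : p.HolderConjugate q) {F G : Ω → E}
    (hF : MemLp F (ENNReal.ofReal p) μ) (hG : MemLp G (ENNReal.ofReal q) μ) :
    |∫ x, inner ℝ (F x) (G x) ∂μ|
      ≤ lpNorm F (ENNReal.ofReal p) μ * lpNorm G (ENNReal.ofReal q) μ := by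
  have := hpq.ennrealOfReal
  have h1 := eLpNorm_le_eLpNorm_mul_eLpNorm_of_nnnorm (r := 1) hF.1 hG.1
    (fun a b => (inner ℝ a b : ℝ)) 1
    (ae_of_all _ fun x => by simpa using nnnorm_inner_le_nnnorm (𝕜 := ℝ) (F x) (G x))
    (p := ENNReal.ofReal p) (q := ENNReal.ofReal q)
  rw [ENNReal.coe_one, one_mul, ← ofReal_lpNorm hF, ← ofReal_lpNorm hG,
    ← ENNReal.ofReal_mul lpNorm_nonneg] at h1
  have h2 : |∫ x, inner ℝ (F x) (G x) ∂μ| ≤ (eLpNorm (fun x => (inner ℝ (F x) (G x) : ℝ)) 1 μ).toReal := by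
    rw [eLpNorm_one_eq_lintegral_enorm, ← integral_norm_eq_lintegral_enorm (hF.1.inner hG.1)]
    exact norm_integral_le_integral_norm (fun x => (inner ℝ (F x) (G x) : ℝ))
  exact h2.trans (ENNReal.toReal_le_of_le_ofReal (mul_nonneg lpNorm_nonneg lpNorm_nonneg) h1)

lemma integrable_mul_of_memLp (hpq : p.HolderConjugate q) {f g : Ω → ℝ}
    (hf : MemLp f (ENNReal.ofReal p) μ) (hg : MemLp g (ENNReal.ofReal q) μ) :
    Integrable (fun x => f x * g x) μ := by
  simpa [mul_comm] using integrable_inner_of_memLp hpq hf hg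

/-- A bound for a pairing on a dense class extends to the whole Lebesgue space. -/
lemma abs_integral_inner_le_of_dense (hpq : p.HolderConjugate q) {G : Ω → E}
    (hG : MemLp G (ENNReal.ofReal p) μ) {D : Set (Ω → E)}
    (hD : ∀ Φ ∈ D, MemLp Φ (ENNReal.ofReal q) μ) {M : ℝ} (hM : 0 ≤ M)
    (hb : ∀ Φ ∈ D, |∫ x, inner ℝ (Φ x) (G x) ∂μ| ≤ M * lpNorm Φ (ENNReal.ofReal q) μ)
    {Φ : Ω → E} (hΦ : MemLp Φ (ENNReal.ofReal q) μ)
    (hdense : ∀ ε > 0, ∃ Θ ∈ D, lpNorm (Φ - Θ) (ENNReal.ofReal q) μ ≤ ε) :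
    |∫ x, inner ℝ (Φ x) (G x) ∂μ| ≤ M * lpNorm Φ (ENNReal.ofReal q) μ := by
  have hq : 1 ≤ ENNReal.ofReal q := by simpa using hpq.symm.lt.le
  refine le_of_forall_pos_le_add fun ε hε => ?_
  set N := lpNorm G (ENNReal.ofReal p) μ
  have hN : 0 ≤ N := lpNorm_nonneg
  obtain ⟨Θ, hΘ, hle⟩ := hdense (ε / (M + N + 1)) (by positivity)
  have hΘm := hD Θ hΘ
  have h1 : ∫ x, inner ℝ (Φ x) (G x) ∂μ
      = ∫ x, inner ℝ ((Φ - Θ) x) (G x) ∂μ + ∫ x, inner ℝ (Θ x) (G x) ∂μ := by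
    rw [← integral_add (integrable_inner_of_memLp hpq.symm (hΦ.sub hΘm) hG)
      (integrable_inner_of_memLp hpq.symm hΘm hG)]
    simp [inner_sub_left]
  have h2 := abs_integral_inner_le hpq.symm (hΦ.sub hΘm) hG
  have h3 : lpNorm Θ (ENNReal.ofReal q) μ
      ≤ lpNorm Φ (ENNReal.ofReal q) μ + lpNorm (Φ - Θ) (ENNReal.ofReal q) μ :=
    lpNorm_le_lpNorm_add_lpNorm_sub' hΦ hq |>.trans_eq (by rw [lpNorm_sub_comm])
  have h5 : (M + N) * lpNorm (Φ - Θ) (ENNReal.ofReal q) μ ≤ ε := by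
    calc (M + N) * lpNorm (Φ - Θ) (ENNReal.ofReal q) μ
        ≤ (M + N + 1) * (ε / (M + N + 1)) := by
          refine mul_le_mul (by linarith) hle lpNorm_nonneg (by positivity)
      _ = ε := by field_simp
  rw [h1]
  calc _ ≤ _ := abs_add_le _ _
    _ ≤ lpNorm (Φ - Θ) (ENNReal.ofReal q) μ * N + M * lpNorm Θ (ENNReal.ofReal q) μ :=
        add_le_add h2 (hb Θ hΘ)
    _ ≤ lpNorm (Φ - Θ) (ENNReal.ofReal q) μ * N
        + M * (lpNorm Φ (ENNReal.ofReal q) μ + lpNorm (Φ - Θ) (ENNReal.ofReal q) μ) := by gcongr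
    _ ≤ _ := by linarith

/-- The converse of Hölder's inequality. -/
lemma lpNorm_le_of_forall_abs_integral_inner_le (hpq : p.HolderConjugate q) {G : Ω → E}
    (hG : MemLp G (ENNReal.ofReal p) μ) {M : ℝ} (hM : 0 ≤ M)
    (hb : ∀ Φ : Ω → E, MemLp Φ (ENNReal.ofReal q) μ →
      |∫ x, inner ℝ (Φ x) (G x) ∂μ| ≤ M * lpNorm Φ (ENNReal.ofReal q) μ) :
    lpNorm G (ENNReal.ofReal p) μ ≤ M := by
  have hp0 : 0 < p := hpq.pos
  have hq0 : 0 < q := hpq.symm.pos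
  have hp1 : 0 < p - 1 := hpq.sub_one_pos
  have hqp : p / (p - 1) = q := hpq.conjugate_eq.symm
  have hP0 : ENNReal.ofReal p ≠ 0 := by simpa using hp0
  have hQ0 : ENNReal.ofReal q ≠ 0 := by simpa using hq0
  -- The extremal field in Hölder's inequality. Where G vanishes, the value of the power is
  -- irrelevant since it multiplies the zero vector.
  set Φ : Ω → E := fun x => ‖G x‖ ^ (p - 2) • G x
  have hnorm : ∀ x, ‖Φ x‖ = ‖G x‖ ^ (p - 1) := by
    intro x
    simp only [Φ, norm_smul]
    rw [Real.norm_of_nonneg (by positivity)]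
    rcases (norm_nonneg (G x)).eq_or_lt with h | h
    · rw [← h, Real.zero_rpow hp1.ne', mul_zero]
    · nth_rewrite 2 [← Real.rpow_one ‖G x‖]
      rw [← Real.rpow_add h]
      ring_nf
  have hΦm : AEStronglyMeasurable Φ μ :=
    (((hG.1.norm.aemeasurable).pow_const (p - 2)).aestronglyMeasurable).smul hG.1
  have hΦ : MemLp Φ (ENNReal.ofReal q) μ := by
    have h1 := hG.norm_rpow_div (ENNReal.ofReal (p - 1))
    rw [ENNReal.toReal_ofReal hp1.le, ← ENNReal.ofReal_div_of_pos hp1, hqp] at h1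
    refine (memLp_congr_norm hΦm h1.1 (ae_of_all _ fun x => ?_)).2 h1
    rw [hnorm, Real.norm_of_nonneg (by positivity)]
  set I := ∫ x, ‖G x‖ ^ p ∂μ
  have hI0 : 0 ≤ I := integral_nonneg fun x => by positivity
  have hGI : lpNorm G (ENNReal.ofReal p) μ = I ^ p⁻¹ := by
    rw [lpNorm_eq_integral_norm_rpow_toReal hP0 ENNReal.ofReal_ne_top hG.1,
      ENNReal.toReal_ofReal hp0.le]
  have hΦI : lpNorm Φ (ENNReal.ofReal q) μ = I ^ q⁻¹ := by
    rw [lpNorm_eq_integral_norm_rpow_toReal hQ0 ENNReal.ofReal_ne_top hΦm,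
      ENNReal.toReal_ofReal hq0.le]
    congr 2
    ext x
    rw [hnorm, ← Real.rpow_mul (norm_nonneg _), hpq.sub_one_mul_conj]
  have hin : ∫ x, inner ℝ (Φ x) (G x) ∂μ = I := by
    refine integral_congr_ae (ae_of_all _ fun x => ?_)
    simp only [Φ, real_inner_smul_left, real_inner_self_eq_norm_sq]
    rcases (norm_nonneg (G x)).eq_or_lt with h | h
    · rw [← h, Real.zero_rpow hp0.ne']; simp
    · rw [← Real.rpow_natCast, ← Real.rpow_add h]
      norm_num
  have h1 := hb Φ hΦ
  rw [hin, hΦI, abs_of_nonneg hI0] at h1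
  rw [hGI]
  rcases hI0.eq_or_lt with h | h
  · rw [← h, Real.zero_rpow (by positivity)]
    exact hM
  · have h2 : I = I ^ p⁻¹ * I ^ q⁻¹ := by
      rw [← Real.rpow_add h, hpq.inv_add_inv_eq_one, Real.rpow_one]
    nth_rewrite 1 [h2] at h1
    exact le_of_mul_le_mul_right h1 (by positivity)

end Duality

/-! ### Testing norms on cylindrical functions and fields. -/

section Density

variable {X : Type*} [AddCommGroup X] [Module ℝ X] [TopologicalSpace X]
  [IsTopologicalAddGroup X] [ContinuousSMul ℝ X] [LocallyConvexSpace ℝ X] [T2Space X]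
  [MeasurableSpace X] [BorelSpace X]
  (γ : Measure X) [IsGaussian γ] [IsCenteredMeasure γ] [γ.InnerRegular] {p q : ℝ}

lemma exists_isCylindrical_lpNorm_sub_le {f : X → ℝ} {r : ℝ≥0∞} (hr : r ≠ ⊤) (hf : MemLp f r γ)
    {ε : ℝ} (hε : 0 < ε) : ∃ φ, IsCylindrical φ ∧ lpNorm (f - φ) r γ ≤ ε := by
  obtain ⟨φ, hle, hφ⟩ := exists_isCylindrical_eLpNorm_sub_le γ hr hf (ε := ENNReal.ofReal ε)
    (by simpa using hε)
  refine ⟨φ, hφ, ?_⟩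
  rw [← toReal_eLpNorm (hf.sub (hφ.memLp γ r)).1]
  exact ENNReal.toReal_le_of_le_ofReal hε.le hle

lemma exists_cylField_lpNorm_sub_le {F : X → CameronMartin γ} {r : ℝ≥0∞} (hr : r ≠ ⊤)
    (hF : MemLp F r γ) {ε : ℝ} (hε : 0 < ε) :
    ∃ Φ : CylField γ, Φ.IsBounded ∧ lpNorm (F - Φ.field) r γ ≤ ε := by
  obtain ⟨Φ, hΦ, hle⟩ := exists_cylField_eLpNorm_sub_le γ hr hF (ε := ENNReal.ofReal ε)
    (by simpa using hε)
  refine ⟨Φ, hΦ, ?_⟩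
  rw [← toReal_eLpNorm (hF.sub (hΦ.memLp_field r)).1]
  exact ENNReal.toReal_le_of_le_ofReal hε.le hle

lemma abs_integral_mul_le_of_cylindrical (hpq : p.HolderConjugate q) {u : X → ℝ}
    (hu : MemLp u (ENNReal.ofReal p) γ) {M : ℝ} (hM : 0 ≤ M)
    (hb : ∀ φ, IsCylindrical φ → |∫ x, u x * φ x ∂γ| ≤ M * lpNorm φ (ENNReal.ofReal q) γ)
    {w : X → ℝ} (hw : MemLp w (ENNReal.ofReal q) γ) :
    |∫ x, u x * w x ∂γ| ≤ M * lpNorm w (ENNReal.ofReal q) γ := by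
  have := abs_integral_inner_le_of_dense hpq hu (D := {φ | IsCylindrical φ})
    (fun φ hφ => IsCylindrical.memLp γ hφ _) hM (fun φ hφ => by simpa using hb φ hφ) hw
    (fun ε hε => exists_isCylindrical_lpNorm_sub_le γ ENNReal.ofReal_ne_top hw hε)
  simpa using this

lemma lpNorm_le_of_cylindrical (hpq : p.HolderConjugate q) {u : X → ℝ}
    (hu : MemLp u (ENNReal.ofReal p) γ) {M : ℝ} (hM : 0 ≤ M)
    (hb : ∀ φ, IsCylindrical φ → |∫ x, u x * φ x ∂γ| ≤ M * lpNorm φ (ENNReal.ofReal q) γ) :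
    lpNorm u (ENNReal.ofReal p) γ ≤ M :=
  lpNorm_le_of_forall_abs_integral_inner_le hpq hu hM fun w hw => by
    simpa using abs_integral_mul_le_of_cylindrical γ hpq hu hM hb hw

lemma lpNorm_le_of_cylField (hpq : p.HolderConjugate q) {F : X → CameronMartin γ}
    (hF : MemLp F (ENNReal.ofReal p) γ) {M : ℝ} (hM : 0 ≤ M)
    (hb : ∀ Φ : CylField γ, Φ.IsBounded →
      |∫ x, inner ℝ (Φ.field x) (F x) ∂γ| ≤ M * lpNorm Φ.field (ENNReal.ofReal q) γ) :
    lpNorm F (ENNReal.ofReal p) γ ≤ M :=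
  lpNorm_le_of_forall_abs_integral_inner_le hpq hF hM fun Θ hΘ =>
    abs_integral_inner_le_of_dense hpq hF
      (D := {u | ∃ Φ : CylField γ, Φ.IsBounded ∧ u = Φ.field})
      (by rintro - ⟨Φ, hΦ, rfl⟩; exact hΦ.memLp_field _) hM
      (by rintro - ⟨Φ, hΦ, rfl⟩; exact hb Φ hΦ) hΘ
      (fun ε hε => by
        obtain ⟨Φ, hΦ, hle⟩ := exists_cylField_lpNorm_sub_le γ ENNReal.ofReal_ne_top hΘ hε
        exact ⟨_, ⟨Φ, hΦ, rfl⟩, hle⟩)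

end Density

end GaussianNB

end

open Filter Topology

set_option linter.unusedSectionVars false

noncomputable section

namespace GaussianNB

/-! ### The semigroup on functions of finitely many functionals. -/

section CylMehler

universe u v

variable {X : Type u} [AddCommGroup X] [Module ℝ X] [TopologicalSpace X]
  [MeasurableSpace X] [BorelSpace X]
  {V : Type} [NormedAddCommGroup V] [NormedSpace ℝ V] [FiniteDimensional ℝ V]
  [MeasurableSpace V] [BorelSpace V]
  (γ : Measure X) [IsGaussian γ] [IsCenteredMeasure γ]

/-- Mehler's formula for a function of finitely many functionals. -/
def cylMehler {E : Type v} [NormedAddCommGroup E] [NormedSpace ℝ E] (c s : ℝ) (G : X →L[ℝ] V)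
    (Ψ : V → E) (z : V) : E := ∫ y, Ψ (c • z + s • G y) ∂γ

variable {γ} {c s : ℝ}

lemma mehler_cylindrical {E : Type v} [NormedAddCommGroup E] [NormedSpace ℝ E] (G : X →L[ℝ] V)
    (Ψ : V → E) (x : X) : mehler γ c s (fun x => Ψ (G x)) x = cylMehler γ c s G Ψ (G x) := by
  simp [mehler, cylMehler]

lemma integrable_comp_affine {E : Type v} [NormedAddCommGroup E] [NormedSpace ℝ E] (G : X →L[ℝ] V)
    {Ψ : V → E} (hc : Continuous Ψ) (hb : ∃ C, ∀ y, ‖Ψ y‖ ≤ C) (b : V) (s : ℝ) :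
    Integrable (fun y => Ψ (b + s • G y)) γ := by
  obtain ⟨C, hC⟩ := hb
  exact (memLp_comp_of_bdd γ (G := G) (Ψ := fun w => Ψ (b + s • w)) (by fun_prop)
    ⟨C, fun y => hC _⟩ 1).integrable le_rfl

lemma hasFDerivAt_cylMehler {E : Type v} [NormedAddCommGroup E] [NormedSpace ℝ E] (G : X →L[ℝ] V)
    {Ψ : V → E} (hΨ : BddC1 Ψ) (z : V) :
    HasFDerivAt (cylMehler γ c s G Ψ) (cylMehler γ c s G (fun w => c • fderiv ℝ Ψ w) z) z := by
  obtain ⟨C, hC⟩ := hΨ.bdd_fderiv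
  have hc := hΨ.continuous_fderiv
  refine hasFDerivAt_integral_of_dominated_of_fderiv_le (s := Set.univ)
    (F' := fun z y => c • fderiv ℝ Ψ (c • z + s • G y)) (bound := fun _ => |c| * C)
    univ_mem (Eventually.of_forall fun z => ?_) ?_ ?_ ?_ (integrable_const _) ?_
  · exact (integrable_comp_affine G hΨ.continuous hΨ.bdd (c • z) s).1
  · exact integrable_comp_affine G hΨ.continuous hΨ.bdd (c • z) s
  · exact (integrable_comp_affine G (Ψ := fun w => c • fderiv ℝ Ψ w) (by fun_prop)
      ⟨|c| * C, fun y => by rw [norm_smul]; gcongr; exacts [le_rfl, hC y]⟩ (c • z) s).1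
  · refine ae_of_all _ fun y z _ => ?_
    rw [norm_smul, Real.norm_eq_abs]
    gcongr
    exact hC _
  · refine ae_of_all _ fun y z _ => ?_
    have h1 : HasFDerivAt (fun z : V => c • z + s • G y) (c • ContinuousLinearMap.id ℝ V) z :=
      ((hasFDerivAt_id z).const_smul c).add_const _
    have h2 := (hΨ.differentiable (c • z + s • G y)).hasFDerivAt.comp z h1
    refine h2.congr_fderiv ?_
    ext v
    simp

lemma fderiv_cylMehler {E : Type v} [NormedAddCommGroup E] [NormedSpace ℝ E] (G : X →L[ℝ] V)
    {Ψ : V → E} (hΨ : BddC1 Ψ) :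
    fderiv ℝ (cylMehler γ c s G Ψ) = cylMehler γ c s G (fun w => c • fderiv ℝ Ψ w) :=
  funext fun z => (hasFDerivAt_cylMehler G hΨ z).fderiv

lemma norm_cylMehler_le {E : Type v} [NormedAddCommGroup E] [NormedSpace ℝ E] (G : X →L[ℝ] V)
    {Ψ : V → E} {C : ℝ} (hC : ∀ y, ‖Ψ y‖ ≤ C) (z : V) : ‖cylMehler γ c s G Ψ z‖ ≤ C := by
  refine (norm_integral_le_of_norm_le_const (ae_of_all _ fun y => hC _)).trans_eq ?_
  simp

lemma bddSmooth_cylMehler {E : Type v} [NormedAddCommGroup E] [NormedSpace ℝ E] (G : X →L[ℝ] V)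
    {Ψ : V → E} (hΨ : BddSmooth Ψ) : BddSmooth (cylMehler γ c s G Ψ) := by
  -- The induction runs over all target spaces E, because the derivative is again a Mehler integral,
  -- now with values in V →L[ℝ] E. As V lies in `Type`, this space stays in the universe of E.
  have h1 : ∀ (k : ℕ) {E : Type v} [NormedAddCommGroup E] [NormedSpace ℝ E] {Ψ : V → E},
      BddSmooth Ψ → ContDiff ℝ k (cylMehler γ c s G Ψ) := by
    intro k
    induction k with
    | zero =>
      intro E _ _ Ψ hΨ
      exact contDiff_zero.2 (continuous_iff_continuousAt.2 fun z =>
        (hasFDerivAt_cylMehler G hΨ.bddC1 z).continuousAt)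
    | succ k ih =>
      intro E _ _ Ψ hΨ
      refine contDiff_succ_iff_fderiv.2
        ⟨fun z => (hasFDerivAt_cylMehler G hΨ.bddC1 z).differentiableAt,
          fun h => absurd h (WithTop.coe_ne_top (a := (k : ℕ∞))), ?_⟩
      rw [fderiv_cylMehler G hΨ.bddC1]
      exact ih (hΨ.fderiv.const_smul c)
  have h2 : ∀ (k : ℕ) {E : Type v} [NormedAddCommGroup E] [NormedSpace ℝ E] {Ψ : V → E},
      BddSmooth Ψ → ∃ C, ∀ z, ‖iteratedFDeriv ℝ k (cylMehler γ c s G Ψ) z‖ ≤ C := by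
    intro k
    induction k with
    | zero =>
      intro E _ _ Ψ hΨ
      obtain ⟨C, hC⟩ := hΨ.bddC1.bdd
      exact ⟨C, fun z => by rw [norm_iteratedFDeriv_zero]; exact norm_cylMehler_le G hC z⟩
    | succ k ih =>
      intro E _ _ Ψ hΨ
      obtain ⟨C, hC⟩ := ih (hΨ.fderiv.const_smul c)
      refine ⟨C, fun z => ?_⟩
      rw [← norm_iteratedFDeriv_fderiv, fderiv_cylMehler G hΨ.bddC1]
      exact hC z
  exact ⟨contDiff_infty.2 fun k => h1 k hΨ, fun k => h2 k hΨ⟩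

lemma fderiv_cylMehler_apply (G : X →L[ℝ] V) {Ψ : V → ℝ} (hΨ : BddC1 Ψ) (z v : V) :
    fderiv ℝ (cylMehler γ c s G Ψ) z v = c * ∫ y, fderiv ℝ Ψ (c • z + s • G y) v ∂γ := by
  have hi := integrable_comp_affine (γ := γ) G hΨ.continuous_fderiv hΨ.bdd_fderiv (c • z) s
  rw [fderiv_cylMehler G hΨ, cylMehler, integral_smul, smul_apply, smul_eq_mul,
    ContinuousLinearMap.integral_apply hi]

/-- The derivative of the semigroup along a Cameron-Martin vector. -/
lemma fderiv_cylMehler_incl (G : X →L[ℝ] V) {Ψ : V → ℝ} (hΨ : BddC1 Ψ) (z : V)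
    (h : CameronMartin γ) :
    s * fderiv ℝ (cylMehler γ c s G Ψ) z (G (incl γ h))
      = c * ∫ y, Ψ (c • z + s • G y) * hat γ h y ∂γ := by
  -- Integration by parts in the variable y of Ψ(cz + sy): differentiation in y produces the factor
  -- s, differentiation in z the factor c.
  have h1 := integral_comp_mul_hat γ (hΨ.comp_affine (s • ContinuousLinearMap.id ℝ V) (c • z)) G h
  have h2 : ∀ w : V, fderiv ℝ (fun w => Ψ (c • z + (s • ContinuousLinearMap.id ℝ V) w)) w
      = s • fderiv ℝ Ψ (c • z + s • w) := by
    intro w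
    have h3 : HasFDerivAt (fun w : V => c • z + (s • ContinuousLinearMap.id ℝ V) w)
        (s • ContinuousLinearMap.id ℝ V) w :=
      (s • ContinuousLinearMap.id ℝ V).hasFDerivAt.const_add _
    have h4 := (hΨ.differentiable (c • z + s • w)).hasFDerivAt.comp w h3
    refine (HasFDerivAt.fderiv h4).trans ?_
    ext v
    simp
  simp only [h2] at h1
  simp only [smul_apply, ContinuousLinearMap.id_apply, smul_eq_mul, integral_const_mul] at h1
  rw [h1, fderiv_cylMehler_apply G hΨ]
  ring

/-- Reversibility: the reflection sends the pair (x, cx + sy) to (cx + sy, x), so the two pairs have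
the same law. -/
lemma integral_prod_mix_comm {E : Type*} [NormedAddCommGroup E] [NormedSpace ℝ E]
    {V : Type*} [NormedAddCommGroup V] [NormedSpace ℝ V] [FiniteDimensional ℝ V]
    [MeasurableSpace V] [BorelSpace V] (h : c ^ 2 + s ^ 2 = 1)
    (G : X →L[ℝ] V) {H : V × V → E} (hH : Continuous H) :
    ∫ z, H (G z.1, c • G z.1 + s • G z.2) ∂(γ.prod γ)
      = ∫ z, H (c • G z.1 + s • G z.2, G z.1) ∂(γ.prod γ) := by
  rw [← integral_reflection γ G (F := fun w : V × V => H (w.1, c • w.1 + s • w.2))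
    (by fun_prop) h]
  refine integral_congr_ae (ae_of_all _ fun z => ?_)
  have : c • (c • G z.1 + s • G z.2) + s • (s • G z.1 - c • G z.2) = G z.1 := by
    calc _ = (c ^ 2 + s ^ 2) • G z.1 := by module
      _ = G z.1 := by rw [h, one_smul]
  simp only [this]

/-- The symmetry of the semigroup on bounded functions of finitely many functionals. -/
lemma integral_mix_comm (h : c ^ 2 + s ^ 2 = 1)
    {V : Type*} [NormedAddCommGroup V] [NormedSpace ℝ V] [FiniteDimensional ℝ V]
    [MeasurableSpace V] [BorelSpace V]
    (G : X →L[ℝ] V) {H : V × V → ℝ} (hH : Continuous H) (hb : ∃ C, ∀ w, ‖H w‖ ≤ C) :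
    ∫ x, ∫ y, H (G x, c • G x + s • G y) ∂γ ∂γ = ∫ x, ∫ y, H (c • G x + s • G y, G x) ∂γ ∂γ := by
  obtain ⟨C, hC⟩ := hb
  have hG : Measurable G := G.continuous.measurable
  have hHm := hH.measurable
  have hi1 : Integrable (fun z : X × X => H (G z.1, c • G z.1 + s • G z.2)) (γ.prod γ) :=
    Integrable.of_bound (Measurable.aestronglyMeasurable (by fun_prop)) C
      (ae_of_all _ fun z => hC _)
  have hi2 : Integrable (fun z : X × X => H (c • G z.1 + s • G z.2, G z.1)) (γ.prod γ) :=
    Integrable.of_bound (Measurable.aestronglyMeasurable (by fun_prop)) C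
      (ae_of_all _ fun z => hC _)
  rw [← integral_prod _ hi1, ← integral_prod _ hi2, integral_prod_mix_comm h G hH]

end CylMehler

/-! ### Divergence of cylindrical fields and its commutation with the semigroup. -/

section Divergence

variable {X : Type*} [AddCommGroup X] [Module ℝ X] [TopologicalSpace X]
  [IsTopologicalAddGroup X] [ContinuousSMul ℝ X] [LocallyConvexSpace ℝ X] [T2Space X]
  [MeasurableSpace X] [BorelSpace X]
  {γ : Measure X} [IsGaussian γ] [IsCenteredMeasure γ]
  {V : Type*} [NormedAddCommGroup V] [NormedSpace ℝ V] [FiniteDimensional ℝ V]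
  [MeasurableSpace V] [BorelSpace V]

namespace CylField

lemma IsBounded.memLp_divergence {Φ : CylField γ} (hΦ : Φ.IsBounded) {r : ℝ≥0∞} (hr : r ≠ ⊤) :
    MemLp Φ.divergence r γ := by
  unfold divergence
  refine memLp_finsetSum _ fun i _ => MemLp.sub ?_ ?_
  · have h1 := (hΦ.bddSmooth i).fderiv_apply (Φ.coords (incl γ (Φ.h i)))
    exact memLp_comp_of_bdd γ (G := Φ.coordsL) h1.bddC1.continuous h1.bddC1.bdd r
  · have h1 : MemLp (fun x => Φ.Ψ i (Φ.coordsL x)) ⊤ γ :=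
      memLp_comp_of_bdd γ (hΦ.bddSmooth i).bddC1.continuous (hΦ.bddSmooth i).bddC1.bdd ⊤
    exact (memLp_hat γ (Φ.h i) hr).mul h1

/-- The duality of gradient and divergence on cylindrical functions. -/
lemma IsBounded.integral_mul_divergence {Φ : CylField γ} (hΦ : Φ.IsBounded) (G : X →L[ℝ] V)
    {Θ : V → ℝ} (hΘ : BddC1 Θ) :
    ∫ x, Θ (G x) * Φ.divergence x ∂γ
      = -∫ x, fderiv ℝ Θ (G x) (G (incl γ (Φ.field x))) ∂γ := by
  have hΘb : MemLp (fun x => Θ (G x)) ⊤ γ := memLp_comp_of_bdd γ hΘ.continuous hΘ.bdd ⊤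
  have hΨb : ∀ i, MemLp (fun x => Φ.Ψ i (Φ.coordsL x)) ⊤ γ := fun i =>
    memLp_comp_of_bdd γ (hΦ.bddSmooth i).bddC1.continuous (hΦ.bddSmooth i).bddC1.bdd ⊤
  have hA : ∀ i, Integrable (fun x => fderiv ℝ (Φ.Ψ i) (Φ.coordsL x)
      (Φ.coordsL (incl γ (Φ.h i)))) γ := fun i => by
    have h1 := (hΦ.bddSmooth i).fderiv_apply (Φ.coordsL (incl γ (Φ.h i)))
    exact (memLp_comp_of_bdd γ (G := Φ.coordsL) h1.bddC1.continuous h1.bddC1.bdd 1).integrable le_rfl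
  have hh : ∀ i, Integrable (hat γ (Φ.h i)) γ := fun i =>
    (memLp_hat γ (Φ.h i) (r := 1) (by simp)).integrable le_rfl
  have hD : ∀ i, Integrable (fun x => fderiv ℝ Θ (G x) (G (incl γ (Φ.h i)))) γ := fun i => by
    obtain ⟨C, hC⟩ := hΘ.bdd_fderiv
    have := hΘ.continuous_fderiv
    refine (memLp_comp_of_bdd γ (G := G) (Ψ := fun w => fderiv ℝ Θ w (G (incl γ (Φ.h i))))
      (by fun_prop) ⟨C * ‖G (incl γ (Φ.h i))‖, fun y => ?_⟩ 1).integrable le_rfl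
    exact (ContinuousLinearMap.le_opNorm _ _).trans (by gcongr; exact hC y)
  have hIA : ∀ i, Integrable (fun x => Θ (G x) * fderiv ℝ (Φ.Ψ i) (Φ.coordsL x)
      (Φ.coordsL (incl γ (Φ.h i)))) γ := fun i => by
    obtain ⟨C, hC⟩ := hΘ.bdd
    exact (hA i).bdd_mul hΘb.1 (ae_of_all _ fun x => hC (G x))
  have hIh : ∀ i, Integrable (fun x => Θ (G x) * Φ.Ψ i (Φ.coordsL x) * hat γ (Φ.h i) x) γ :=
    fun i => by
      have h1 : MemLp (fun x => Θ (G x) * Φ.Ψ i (Φ.coordsL x)) ⊤ γ := (hΨb i).mul hΘb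
      exact memLp_one_iff_integrable.1 ((memLp_hat γ (Φ.h i) (r := 1) (by simp)).mul h1)
  have hID : ∀ i, Integrable (fun x => Φ.Ψ i (Φ.coordsL x)
      * fderiv ℝ Θ (G x) (G (incl γ (Φ.h i)))) γ := fun i => by
    obtain ⟨C, hC⟩ := (hΦ.bddSmooth i).bddC1.bdd
    exact (hD i).bdd_mul (hΨb i).1 (ae_of_all _ fun x => hC (Φ.coordsL x))
  have key : ∀ i, ∫ x, Θ (G x) * (fderiv ℝ (Φ.Ψ i) (Φ.coordsL x) (Φ.coordsL (incl γ (Φ.h i)))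
        - Φ.Ψ i (Φ.coordsL x) * hat γ (Φ.h i) x) ∂γ
      = -∫ x, Φ.Ψ i (Φ.coordsL x) * fderiv ℝ Θ (G x) (G (incl γ (Φ.h i))) ∂γ := by
    intro i
    -- The integration by parts formula is applied to the product Θ · Ψ_i as a function on V × ℝⁿ;
    -- the product rule yields the divergence term and the gradient term.
    have hP := (hΘ.comp_linear (ContinuousLinearMap.fst ℝ V (Fin Φ.n → ℝ))).mul
      ((hΦ.bddSmooth i).bddC1.comp_linear (ContinuousLinearMap.snd ℝ V (Fin Φ.n → ℝ)))
    have h1 := integral_comp_mul_hat γ hP (G.prod Φ.coordsL) (Φ.h i)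
    have h2 : ∀ w : V × (Fin Φ.n → ℝ), fderiv ℝ (fun w : V × (Fin Φ.n → ℝ) =>
        Θ (ContinuousLinearMap.fst ℝ V (Fin Φ.n → ℝ) w)
          * Φ.Ψ i (ContinuousLinearMap.snd ℝ V (Fin Φ.n → ℝ) w)) w
        = Θ w.1 • (fderiv ℝ (Φ.Ψ i) w.2).comp (ContinuousLinearMap.snd ℝ V (Fin Φ.n → ℝ))
          + Φ.Ψ i w.2 • (fderiv ℝ Θ w.1).comp (ContinuousLinearMap.fst ℝ V (Fin Φ.n → ℝ)) := by
      intro w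
      refine HasFDerivAt.fderiv ?_
      exact ((hΘ.differentiable w.1).hasFDerivAt.comp w
          (ContinuousLinearMap.fst ℝ V (Fin Φ.n → ℝ)).hasFDerivAt).mul
        (((hΦ.bddSmooth i).bddC1.differentiable w.2).hasFDerivAt.comp w
          (ContinuousLinearMap.snd ℝ V (Fin Φ.n → ℝ)).hasFDerivAt)
    simp only [h2] at h1
    simp only [ContinuousLinearMap.prod_apply, ContinuousLinearMap.coe_fst',
      ContinuousLinearMap.coe_snd', add_apply, smul_apply, ContinuousLinearMap.comp_apply,
      smul_eq_mul] at h1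
    rw [integral_add (hIA i) (hID i)] at h1
    simp_rw [mul_sub, ← mul_assoc]
    rw [integral_sub (hIA i) (hIh i), h1]
    ring
  have e1 : ∀ x, Θ (G x) * Φ.divergence x = ∑ i, Θ (G x) * (fderiv ℝ (Φ.Ψ i) (Φ.coordsL x)
      (Φ.coordsL (incl γ (Φ.h i))) - Φ.Ψ i (Φ.coordsL x) * hat γ (Φ.h i) x) := fun x => by
    rw [divergence, Finset.mul_sum]
    rfl
  have e2 : ∀ x, fderiv ℝ Θ (G x) (G (incl γ (Φ.field x)))
      = ∑ i, Φ.Ψ i (Φ.coordsL x) * fderiv ℝ Θ (G x) (G (incl γ (Φ.h i))) := fun x => by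
    rw [field, map_sum, map_sum, map_sum]
    refine Finset.sum_congr rfl fun i _ => ?_
    rw [map_smul, map_smul, map_smul, smul_eq_mul]
    rfl
  simp_rw [e1, e2]
  rw [integral_finsetSum _ fun i _ => ?_, integral_finsetSum _ fun i _ => hID i,
    ← Finset.sum_neg_distrib]
  · exact Finset.sum_congr rfl fun i _ => key i
  · simp_rw [mul_sub, ← mul_assoc]
    exact (hIA i).sub (hIh i)

/-- The semigroup acting on the coefficients of a cylindrical field. -/
def mehlerField (Φ : CylField γ) (hΦ : Φ.IsBounded) (c s : ℝ) : CylField γ where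
  n := Φ.n
  Ψ i := cylMehler γ c s Φ.coordsL (Φ.Ψ i)
  g := Φ.g
  h := Φ.h
  smooth i := (bddSmooth_cylMehler _ (hΦ.bddSmooth i)).contDiff

lemma isBounded_mehlerField {Φ : CylField γ} (hΦ : Φ.IsBounded) (c s : ℝ) :
    (Φ.mehlerField hΦ c s).IsBounded :=
  fun i => (bddSmooth_cylMehler _ (hΦ.bddSmooth i)).bdd

variable {c s : ℝ}

lemma field_eq_comp (Φ : CylField γ) :
    Φ.field = fun x => (fun z => ∑ i, Φ.Ψ i z • Φ.h i) (Φ.coordsL x) := rfl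

lemma IsBounded.mixRegular {Φ : CylField γ} (hΦ : Φ.IsBounded) (h : c ^ 2 + s ^ 2 = 1) :
    MixRegular γ c s Φ.field := by
  rw [field_eq_comp]
  have : ∀ i, Continuous (Φ.Ψ i) := fun i => (hΦ.bddSmooth i).bddC1.continuous
  exact mixRegular_cylindrical h Φ.coordsL (Ψ := fun z => ∑ i, Φ.Ψ i z • Φ.h i) (by fun_prop)

variable [γ.InnerRegular]

lemma field_mehlerField {Φ : CylField γ} (hΦ : Φ.IsBounded) :
    (Φ.mehlerField hΦ c s).field = mehler γ c s Φ.field := by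
  ext x
  have hi : ∀ i, Integrable (fun y => Φ.Ψ i (c • Φ.coordsL x + s • Φ.coordsL y)) γ := fun i =>
    integrable_comp_affine Φ.coordsL (hΦ.bddSmooth i).bddC1.continuous (hΦ.bddSmooth i).bddC1.bdd _ _
  have h1 : ∀ y, Φ.field (c • x + s • y)
      = ∑ i, Φ.Ψ i (c • Φ.coordsL x + s • Φ.coordsL y) • Φ.h i := fun y => by
    rw [field_eq_comp]
    simp
  simp only [mehler, h1]
  rw [integral_finsetSum _ fun i _ => (hi i).smul_const _]
  simp only [integral_smul_const]
  rfl

lemma lpNorm_mehlerField_le {Φ : CylField γ} (hΦ : Φ.IsBounded) (h : c ^ 2 + s ^ 2 = 1) {r : ℝ}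
    (hr : 1 ≤ r) : lpNorm (Φ.mehlerField hΦ c s).field (ENNReal.ofReal r) γ
      ≤ lpNorm Φ.field (ENNReal.ofReal r) γ := by
  have h1 := (hΦ.mixRegular h).eLpNorm_mehler_le hr
  rw [← field_mehlerField hΦ] at h1
  rw [← toReal_eLpNorm ((isBounded_mehlerField hΦ c s).memLp_field 1).1,
    ← toReal_eLpNorm (hΦ.memLp_field 1).1]
  exact ENNReal.toReal_mono (hΦ.memLp_field _).2.ne h1

/-- The semigroup and the divergence commute up to the factor `c`, tested on cylindrical functions. -/
lemma integral_cylMehler_mul_divergence {Φ : CylField γ} (hΦ : Φ.IsBounded)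
    (h : c ^ 2 + s ^ 2 = 1) {V : Type} [NormedAddCommGroup V] [NormedSpace ℝ V]
    [FiniteDimensional ℝ V] [MeasurableSpace V] [BorelSpace V] (G : X →L[ℝ] V) {Θ : V → ℝ}
    (hΘ : BddSmooth Θ) :
    ∫ x, cylMehler γ c s G Θ (G x) * Φ.divergence x ∂γ
      = c * ∫ x, Θ (G x) * (Φ.mehlerField hΦ c s).divergence x ∂γ := by
  rw [hΦ.integral_mul_divergence G (bddSmooth_cylMehler G hΘ).bddC1,
    (isBounded_mehlerField hΦ c s).integral_mul_divergence G hΘ.bddC1, mul_neg,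
    ← integral_const_mul]
  congr 1
  have hA : Continuous fun z => ∑ i, Φ.Ψ i z • G (incl γ (Φ.h i)) := by
    have : ∀ i, Continuous (Φ.Ψ i) := fun i => (hΦ.bddSmooth i).bddC1.continuous
    fun_prop
  have hAx : ∀ x, G (incl γ (Φ.field x)) = ∑ i, Φ.Ψ i (Φ.coordsL x) • G (incl γ (Φ.h i)) :=
    fun x => by
      rw [field, map_sum, map_sum]
      refine Finset.sum_congr rfl fun i _ => ?_
      rw [map_smul, map_smul]
      rfl
  have hAb : ∃ C, ∀ z, ‖∑ i, Φ.Ψ i z • G (incl γ (Φ.h i))‖ ≤ C := by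
    choose C hC using fun i => (hΦ.bddSmooth i).bddC1.bdd
    refine ⟨∑ i, C i * ‖G (incl γ (Φ.h i))‖, fun z => (norm_sum_le _ _).trans ?_⟩
    refine Finset.sum_le_sum fun i _ => ?_
    rw [norm_smul]
    gcongr
    exact hC i z
  obtain ⟨C, hC⟩ := hAb
  obtain ⟨D, hD⟩ := hΘ.bddC1.bdd_fderiv
  have hD0 : 0 ≤ D := (norm_nonneg _).trans (hD 0)
  have hΘc := hΘ.bddC1.continuous_fderiv
  -- After passing to gradients, both sides are c times a double integral of DΘ applied to Φ, with Θ
  -- and Φ evaluated at x and cx + sy in the two orders; reversibility identifies them.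
  have key := integral_mix_comm (γ := γ) h (G.prod Φ.coordsL)
    (H := fun w : (V × (Fin Φ.n → ℝ)) × (V × (Fin Φ.n → ℝ)) =>
      c * fderiv ℝ Θ w.2.1 (∑ i, Φ.Ψ i w.1.2 • G (incl γ (Φ.h i))))
    (by
      have h1 : Continuous fun w : (V × (Fin Φ.n → ℝ)) × (V × (Fin Φ.n → ℝ)) =>
        ∑ i, Φ.Ψ i w.1.2 • G (incl γ (Φ.h i)) :=
        hA.comp (f := fun w : (V × (Fin Φ.n → ℝ)) × (V × (Fin Φ.n → ℝ)) => w.1.2) (by fun_prop)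
      fun_prop)
    ⟨|c| * (D * C), fun w => by
      rw [norm_mul, Real.norm_eq_abs]
      gcongr
      exact (ContinuousLinearMap.le_opNorm _ _).trans
        (mul_le_mul (hD _) (hC _) (norm_nonneg _) hD0)⟩
  simp only [ContinuousLinearMap.prod_apply, Prod.smul_mk, Prod.mk_add_mk,
    integral_const_mul] at key
  have hl : ∀ x, fderiv ℝ (cylMehler γ c s G Θ) (G x) (G (incl γ (Φ.field x)))
      = c * ∫ y, fderiv ℝ Θ (c • G x + s • G y) (∑ i, Φ.Ψ i (Φ.coordsL x) • G (incl γ (Φ.h i))) ∂γ :=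
    fun x => by rw [fderiv_cylMehler_apply G hΘ.bddC1, hAx]
  have hr : ∀ x, fderiv ℝ Θ (G x) (G (incl γ ((Φ.mehlerField hΦ c s).field x)))
      = ∫ y, fderiv ℝ Θ (G x)
        (∑ i, Φ.Ψ i (c • Φ.coordsL x + s • Φ.coordsL y) • G (incl γ (Φ.h i))) ∂γ := fun x => by
    have hi : Integrable (fun y => ∑ i, Φ.Ψ i (c • Φ.coordsL x + s • Φ.coordsL y)
        • G (incl γ (Φ.h i))) γ :=
      integrable_comp_affine Φ.coordsL hA ⟨C, hC⟩ _ _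
    rw [ContinuousLinearMap.integral_comp_comm _ hi]
    congr 1
    rw [integral_finsetSum _ fun i _ => ?_, field, map_sum, map_sum]
    · refine Finset.sum_congr rfl fun i _ => ?_
      rw [map_smul, map_smul, integral_smul_const]
      rfl
    · exact (integrable_comp_affine Φ.coordsL (hΦ.bddSmooth i).bddC1.continuous
        (hΦ.bddSmooth i).bddC1.bdd _ _).smul_const _
  simp only [hl, hr]
  rw [integral_const_mul, integral_const_mul]
  exact key

end CylField

end Divergence

end GaussianNB

end

open Filter Topology

set_option linter.unusedSectionVars false

noncomputable section

namespace GaussianNB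

/-! ### Limits of pairings. -/

section Limits

variable {Ω : Type*} [MeasurableSpace Ω] {μ : Measure Ω}
  {E : Type*} [NormedAddCommGroup E] [InnerProductSpace ℝ E] {p q : ℝ}

lemma tendsto_integral_inner_of_lpNorm (hpq : p.HolderConjugate q) {G F : Ω → E} {Fk : ℕ → Ω → E}
    (hG : MemLp G (ENNReal.ofReal q) μ) (hF : MemLp F (ENNReal.ofReal p) μ)
    (hFk : ∀ k, MemLp (Fk k) (ENNReal.ofReal p) μ)
    (hlim : Tendsto (fun k => lpNorm (F - Fk k) (ENNReal.ofReal p) μ) atTop (𝓝 0)) :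
    Tendsto (fun k => ∫ x, inner ℝ (G x) (Fk k x) ∂μ) atTop (𝓝 (∫ x, inner ℝ (G x) (F x) ∂μ)) := by
  rw [tendsto_iff_norm_sub_tendsto_zero]
  have h0 : Tendsto (fun k => lpNorm G (ENNReal.ofReal q) μ * lpNorm (F - Fk k) (ENNReal.ofReal p) μ)
      atTop (𝓝 0) := by simpa using hlim.const_mul (lpNorm G (ENNReal.ofReal q) μ)
  refine squeeze_zero (fun k => norm_nonneg _) (fun k => ?_) h0
  have h1 := abs_integral_inner_le hpq.symm hG (hF.sub (hFk k))
  simp only [Pi.sub_apply, inner_sub_right] at h1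
  rw [integral_sub (integrable_inner_of_memLp hpq.symm hG hF)
    (integrable_inner_of_memLp hpq.symm hG (hFk k))] at h1
  rwa [norm_sub_rev, Real.norm_eq_abs]

lemma tendsto_integral_mul_of_lpNorm (hpq : p.HolderConjugate q) {g f : Ω → ℝ} {fk : ℕ → Ω → ℝ}
    (hg : MemLp g (ENNReal.ofReal q) μ) (hf : MemLp f (ENNReal.ofReal p) μ)
    (hfk : ∀ k, MemLp (fk k) (ENNReal.ofReal p) μ)
    (hlim : Tendsto (fun k => lpNorm (f - fk k) (ENNReal.ofReal p) μ) atTop (𝓝 0)) :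
    Tendsto (fun k => ∫ x, fk k x * g x ∂μ) atTop (𝓝 (∫ x, f x * g x ∂μ)) := by
  simpa using tendsto_integral_inner_of_lpNorm hpq hg hf hfk hlim

end Limits

/-! ### Gradients of smoothed cylindrical functions. -/

section Gradient

variable {X : Type*} [AddCommGroup X] [Module ℝ X] [TopologicalSpace X]
  [IsTopologicalAddGroup X] [ContinuousSMul ℝ X] [LocallyConvexSpace ℝ X] [T2Space X]
  [MeasurableSpace X] [BorelSpace X]
  {γ : Measure X} [IsGaussian γ] [IsCenteredMeasure γ] {c s : ℝ}

/-- A field given by Mehler's formula and the functionals `ĥ` is controlled by the function. -/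
lemma MixRegular.eLpNorm_le_of_inner_eq {u : X → ℝ} (hu : MixRegular γ c s u)
    {F : X → CameronMartin γ} (hc : 0 ≤ c) (hs : 0 < s)
    (hF : ∀ x h, s * inner ℝ h (F x) = c * ∫ y, u (c • x + s • y) * hat γ h y ∂γ)
    {r r' : ℝ} (hr : r.HolderConjugate r') :
    eLpNorm F (ENNReal.ofReal r) γ
      ≤ ENNReal.ofReal (c / s * gaussianMomentConst r') * eLpNorm u (ENNReal.ofReal r) γ := by
  have := hr.ennrealOfReal
  refine hu.eLpNorm_le_of_le_section (C := ENNReal.ofReal (c / s * gaussianMomentConst r')) hr.pos ?_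
  have hm : ∀ᵐ x ∂γ, AEStronglyMeasurable (fun y => u (c • x + s • y)) γ :=
    hu.aestronglyMeasurable.prodMk_left
  filter_upwards [hm] with x hx
  set S := eLpNorm (fun y => u (c • x + s • y)) (ENNReal.ofReal r) γ
  by_cases h0 : F x = 0
  · simp [h0]
  have hn : ‖F x‖ₑ ≠ 0 := by simpa using h0
  -- The formula is tested with h = F x. Hölder bounds the integral by S · C(r') ‖F x‖, and one
  -- factor ‖F x‖ cancels against the square on the left.
  have h1 : ‖∫ y, u (c • x + s • y) * hat γ (F x) y ∂γ‖ₑ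
      ≤ S * (ENNReal.ofReal (gaussianMomentConst r') * ‖F x‖ₑ) := by
    refine (enorm_integral_le_lintegral_enorm _).trans ?_
    rw [← eLpNorm_one_eq_lintegral_enorm]
    have h2 := eLpNorm_smul_le_mul_eLpNorm (p := ENNReal.ofReal r) (q := ENNReal.ofReal r') (r := 1)
      (Lp.aestronglyMeasurable (hat γ (F x))) hx
    refine h2.trans ?_
    gcongr
    have h3 := eLpNorm_le_of_mem_dualClosure γ (hat_mem γ (F x)) hr.symm.pos
    rwa [show ‖hat γ (F x)‖ = ‖F x‖ from rfl, ofReal_norm] at h3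
  have h2 : ‖F x‖ ^ 2 = c / s * ∫ y, u (c • x + s • y) * hat γ (F x) y ∂γ := by
    rw [← real_inner_self_eq_norm_sq]
    have := hF x (F x)
    field_simp
    linarith
  have h3 : ‖F x‖ₑ * ‖F x‖ₑ
      ≤ ‖F x‖ₑ * (ENNReal.ofReal (c / s * gaussianMomentConst r') * S) := by
    calc ‖F x‖ₑ * ‖F x‖ₑ = ‖(‖F x‖ ^ 2 : ℝ)‖ₑ := by rw [enorm_pow, enorm_norm, sq]
      _ = ENNReal.ofReal (c / s) * ‖∫ y, u (c • x + s • y) * hat γ (F x) y ∂γ‖ₑ := by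
          rw [h2, enorm_mul, Real.enorm_eq_ofReal (by positivity)]
      _ ≤ ENNReal.ofReal (c / s) * (S * (ENNReal.ofReal (gaussianMomentConst r') * ‖F x‖ₑ)) := by
          gcongr
      _ = _ := by
          rw [ENNReal.ofReal_mul (by positivity)]
          ring
  exact (ENNReal.mul_le_mul_iff_right hn enorm_ne_top).1 h3

/-- The gradient of a smooth cylindrical function, as a cylindrical field. -/
def gradField [γ.InnerRegular] {n : ℕ} (G : X →L[ℝ] (Fin n → ℝ)) {Ψ : (Fin n → ℝ) → ℝ}
    (hΨ : BddSmooth Ψ) : CylField γ where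
  n := n
  Ψ j := fun z => fderiv ℝ Ψ z (Pi.single j 1)
  g j := (ContinuousLinearMap.proj j).comp G
  h j := ofDual γ ((ContinuousLinearMap.proj j).comp G)
  smooth _ := (hΨ.fderiv_apply _).contDiff

variable [γ.InnerRegular] {n : ℕ}

lemma isBounded_gradField (G : X →L[ℝ] (Fin n → ℝ)) {Ψ : (Fin n → ℝ) → ℝ} (hΨ : BddSmooth Ψ) :
    (gradField (γ := γ) G hΨ).IsBounded := fun _ => (hΨ.fderiv_apply _).bdd

lemma inner_gradField (G : X →L[ℝ] (Fin n → ℝ)) {Ψ : (Fin n → ℝ) → ℝ} (hΨ : BddSmooth Ψ) (x : X)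
    (h : CameronMartin γ) :
    inner ℝ h ((gradField (γ := γ) G hΨ).field x) = fderiv ℝ Ψ (G x) (G (incl γ h)) := by
  have h1 : (gradField (γ := γ) G hΨ).field x = ∑ j : Fin n, fderiv ℝ Ψ (G x) (Pi.single j 1)
    • ofDual γ ((ContinuousLinearMap.proj j).comp G) := rfl
  rw [h1, inner_sum]
  simp only [inner_smul_right, inner_ofDual]
  have h2 : G (incl γ h) = ∑ j, G (incl γ h) j • Pi.single j (1 : ℝ) := by
    ext i
    simp [Finset.sum_apply, Pi.single_apply]
  conv_rhs => rw [h2, map_sum]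
  refine Finset.sum_congr rfl fun j _ => ?_
  simp [mul_comm]

lemma integral_inner_gradField (G : X →L[ℝ] (Fin n → ℝ)) {Ψ : (Fin n → ℝ) → ℝ} (hΨ : BddSmooth Ψ)
    {Φ : CylField γ} (hΦ : Φ.IsBounded) :
    ∫ x, inner ℝ (Φ.field x) ((gradField (γ := γ) G hΨ).field x) ∂γ
      = -∫ x, Ψ (G x) * Φ.divergence x ∂γ := by
  rw [hΦ.integral_mul_divergence G hΨ.bddC1, neg_neg]
  simp only [inner_gradField]

/-- The two descriptions of the gradient of the smoothed function: by duality with the divergence,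
which passes to limits, and by the integrated formula, which gives the norm bound. -/
lemma exists_gradField_mehler {φ : X → ℝ} (hφ : IsCylindrical φ) (c s : ℝ) :
    ∃ Θ : CylField γ, Θ.IsBounded ∧ (∀ Φ : CylField γ, Φ.IsBounded →
        ∫ x, inner ℝ (Φ.field x) (Θ.field x) ∂γ = -∫ x, mehler γ c s φ x * Φ.divergence x ∂γ) ∧
      ∀ x h, s * inner ℝ h (Θ.field x) = c * ∫ y, φ (c • x + s • y) * hat γ h y ∂γ := by
  obtain ⟨n, G, Ψ, hΨ, rfl⟩ := hφ
  refine ⟨gradField G (bddSmooth_cylMehler (γ := γ) (c := c) (s := s) G hΨ),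
    isBounded_gradField _ _, fun Φ hΦ => ?_, fun x h => ?_⟩
  · simp only [integral_inner_gradField _ _ hΦ, mehler_cylindrical]
  · rw [inner_gradField, fderiv_cylMehler_incl G hΨ.bddC1]
    simp

lemma IsCylindrical.mixRegular {φ : X → ℝ} (hφ : IsCylindrical φ) (h : c ^ 2 + s ^ 2 = 1) :
    MixRegular γ c s φ := by
  obtain ⟨n, G, Ψ, hΨ, rfl⟩ := hφ
  exact mixRegular_cylindrical h G hΨ.bddC1.continuous

lemma IsCylindrical.neg {φ : X → ℝ} (hφ : IsCylindrical φ) : IsCylindrical fun x => -φ x := by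
  obtain ⟨n, G, Ψ, hΨ, rfl⟩ := hφ
  exact ⟨n, G, _, hΨ.neg, rfl⟩

lemma IsCylindrical.sub {φ ψ : X → ℝ} (hφ : IsCylindrical φ) (hψ : IsCylindrical ψ) :
    IsCylindrical (φ - ψ) := by
  rw [sub_eq_add_neg]
  exact hφ.add hψ.neg

lemma IsCylindrical.mehler {φ : X → ℝ} (hφ : IsCylindrical φ) (c s : ℝ) :
    IsCylindrical (mehler γ c s φ) := by
  obtain ⟨n, G, Ψ, hΨ, rfl⟩ := hφ
  exact ⟨n, G, _, bddSmooth_cylMehler (γ := γ) (c := c) (s := s) G hΨ,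
    funext fun x => mehler_cylindrical G Ψ x⟩

lemma IsCylindrical.integrable_section_mul_hat {φ : X → ℝ} (hφ : IsCylindrical φ) (x : X)
    (h : CameronMartin γ) : Integrable (fun y => φ (c • x + s • y) * hat γ h y) γ := by
  obtain ⟨n, G, Ψ, hΨ, rfl⟩ := hφ
  obtain ⟨C, hC⟩ := hΨ.bddC1.bdd
  have hm : AEStronglyMeasurable (fun y => Ψ (G (c • x + s • y))) γ := by
    have := (integrable_comp_affine (γ := γ) G hΨ.bddC1.continuous hΨ.bddC1.bdd (c • G x) s).1
    simpa using this
  exact ((memLp_hat γ h (r := 1) (by simp)).integrable le_rfl).bdd_mul hm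
    (ae_of_all _ fun y => hC (G (c • x + s • y)))

end Gradient

/-! ### Smoothing of L^p functions and of divergences. -/

section Sobolev

variable {X : Type*} [AddCommGroup X] [Module ℝ X] [TopologicalSpace X]
  [IsTopologicalAddGroup X] [ContinuousSMul ℝ X] [LocallyConvexSpace ℝ X] [T2Space X]
  [MeasurableSpace X] [BorelSpace X]
  {γ : Measure X} [IsGaussian γ] [IsCenteredMeasure γ] [γ.InnerRegular] {c s p q : ℝ}

lemma exists_seq_isCylindrical {f : X → ℝ} (hf : MemLp f (ENNReal.ofReal p) γ) :
    ∃ φ : ℕ → X → ℝ, (∀ k, IsCylindrical (φ k)) ∧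
      Tendsto (fun k => lpNorm (f - φ k) (ENNReal.ofReal p) γ) atTop (𝓝 0) := by
  choose φ hφ hle using fun k : ℕ => exists_isCylindrical_lpNorm_sub_le γ ENNReal.ofReal_ne_top hf
    (ε := 1 / ((k : ℝ) + 1)) (by positivity)
  exact ⟨φ, hφ, squeeze_zero (fun k => lpNorm_nonneg) hle tendsto_one_div_add_atTop_nhds_zero_nat⟩

lemma lpNorm_mehler_le (h : c ^ 2 + s ^ 2 = 1) {f : X → ℝ} (hp : 1 ≤ p)
    (hf : MemLp f (ENNReal.ofReal p) γ) :
    lpNorm (mehler γ c s f) (ENNReal.ofReal p) γ ≤ lpNorm f (ENNReal.ofReal p) γ := by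
  obtain ⟨h1, h2⟩ := memLp_mehler h hp hf
  rw [← toReal_eLpNorm h1.1, ← toReal_eLpNorm hf.1]
  exact ENNReal.toReal_mono hf.2.ne h2

lemma tendsto_lpNorm_mehler (h : c ^ 2 + s ^ 2 = 1) (hp : 1 ≤ p) {f : X → ℝ} {φ : ℕ → X → ℝ}
    (hf : MemLp f (ENNReal.ofReal p) γ) (hφ : ∀ k, MemLp (φ k) (ENNReal.ofReal p) γ)
    (hlim : Tendsto (fun k => lpNorm (f - φ k) (ENNReal.ofReal p) γ) atTop (𝓝 0)) :
    Tendsto (fun k => lpNorm (mehler γ c s f - mehler γ c s (φ k)) (ENNReal.ofReal p) γ)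
      atTop (𝓝 0) := by
  refine squeeze_zero (fun k => lpNorm_nonneg) (fun k => ?_) hlim
  refine le_trans (le_of_eq ?_) (lpNorm_mehler_le h hp (hf.sub (hφ k)))
  have h1 := mehler_sub h (by simpa using hp) ENNReal.ofReal_ne_top hf (hφ k)
  have hm := (memLp_mehler h hp hf).1.sub (memLp_mehler h hp (hφ k)).1
  rw [← toReal_eLpNorm hm.1, ← toReal_eLpNorm (hm.1.congr h1.symm), eLpNorm_congr_ae h1]

/-- Adjoints of the semigroup are determined on cylindrical functions. -/
lemma integral_mehler_mul_of_cylindrical (hpq : p.HolderConjugate q) (h : c ^ 2 + s ^ 2 = 1)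
    {w w' : X → ℝ} (hw : MemLp w (ENNReal.ofReal q) γ) (hw' : MemLp w' (ENNReal.ofReal q) γ)
    (hb : ∀ φ, IsCylindrical φ → ∫ x, mehler γ c s φ x * w x ∂γ = ∫ x, φ x * w' x ∂γ)
    {f : X → ℝ} (hf : MemLp f (ENNReal.ofReal p) γ) :
    ∫ x, mehler γ c s f x * w x ∂γ = ∫ x, f x * w' x ∂γ := by
  obtain ⟨φ, hφ, hlim⟩ := exists_seq_isCylindrical hf
  have hφm := fun k => (hφ k).memLp γ (ENNReal.ofReal p)
  have h1 := tendsto_integral_mul_of_lpNorm hpq hw (memLp_mehler h hpq.lt.le hf).1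
    (fun k => (memLp_mehler h hpq.lt.le (hφm k)).1) (tendsto_lpNorm_mehler h hpq.lt.le hf hφm hlim)
  have h2 := tendsto_integral_mul_of_lpNorm hpq hw' hf hφm hlim
  simp only [fun k => hb (φ k) (hφ k)] at h1
  exact tendsto_nhds_unique h1 h2

/-- The semigroup and the divergence commute up to the factor `c`. -/
lemma integral_mehler_mul_divergence (hpq : p.HolderConjugate q) (h : c ^ 2 + s ^ 2 = 1)
    {f : X → ℝ} (hf : MemLp f (ENNReal.ofReal p) γ) {Φ : CylField γ} (hΦ : Φ.IsBounded) :
    ∫ x, mehler γ c s f x * Φ.divergence x ∂γ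
      = c * ∫ x, f x * (Φ.mehlerField hΦ c s).divergence x ∂γ := by
  rw [integral_mehler_mul_of_cylindrical hpq h (hΦ.memLp_divergence ENNReal.ofReal_ne_top)
    (((CylField.isBounded_mehlerField hΦ c s).memLp_divergence ENNReal.ofReal_ne_top).const_mul c)
    (fun φ hφ => ?_) hf]
  · rw [← integral_const_mul]
    congr 1 with x
    ring
  · obtain ⟨n, G, Ψ, hΨ, rfl⟩ := hφ
    simp only [mehler_cylindrical]
    rw [CylField.integral_cylMehler_mul_divergence hΦ h G hΨ, ← integral_const_mul]
    congr 1 with x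
    ring

/-- The symmetry of the semigroup. -/
lemma integral_mehler_mul_comm (hpq : p.HolderConjugate q) (h : c ^ 2 + s ^ 2 = 1)
    {f : X → ℝ} (hf : MemLp f (ENNReal.ofReal p) γ) {φ : X → ℝ} (hφ : IsCylindrical φ) :
    ∫ x, mehler γ c s f x * φ x ∂γ = ∫ x, f x * mehler γ c s φ x ∂γ := by
  refine integral_mehler_mul_of_cylindrical hpq h (hφ.memLp γ _) ((hφ.mehler c s).memLp γ _)
    (fun ψ hψ => ?_) hf
  obtain ⟨n, G, Ψ, hΨ, rfl⟩ := hφ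
  obtain ⟨m, G', Ψ', hΨ', rfl⟩ := hψ
  obtain ⟨C, hC⟩ := hΨ.bddC1.bdd
  obtain ⟨C', hC'⟩ := hΨ'.bddC1.bdd
  have hc := hΨ.bddC1.continuous
  have hc' := hΨ'.bddC1.continuous
  have key := integral_mix_comm (γ := γ) h (G.prod G')
    (H := fun w : ((Fin n → ℝ) × (Fin m → ℝ)) × ((Fin n → ℝ) × (Fin m → ℝ)) =>
      Ψ' w.2.2 * Ψ w.1.1) (by fun_prop) ⟨C' * C, fun w => by
        rw [norm_mul]
        exact mul_le_mul (hC' _) (hC _) (norm_nonneg _) ((norm_nonneg _).trans (hC' 0))⟩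
  simp only [ContinuousLinearMap.prod_apply, Prod.smul_mk, Prod.mk_add_mk,
    integral_mul_const, integral_const_mul] at key
  simpa only [mehler, map_add, map_smul] using key

/-- The semigroup maps `L^p` to the Sobolev class. -/
lemma exists_isSobolevGradient_mehler (hpq : p.HolderConjugate q) (h : c ^ 2 + s ^ 2 = 1)
    (hc : 0 ≤ c) (hs : 0 < s) {f : X → ℝ} (hf : MemLp f (ENNReal.ofReal p) γ) :
    ∃ F, IsSobolevGradient γ (ENNReal.ofReal p) (mehler γ c s f) F := by
  obtain ⟨φ, hφ, hlim⟩ := exists_seq_isCylindrical hf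
  have hφm := fun k => (hφ k).memLp γ (ENNReal.ofReal p)
  choose Θ hΘ hΘint hΘin using fun k => exists_gradField_mehler (γ := γ) (hφ k) c s
  have hΘm := fun k => (hΘ k).memLp_field (ENNReal.ofReal p)
  set M := c / s * gaussianMomentConst q with hM
  have hM0 : 0 ≤ M := mul_nonneg (by positivity) (gaussianMomentConst_nonneg q)
  -- The integrated formula is linear in φ, so differences of gradients are controlled by
  -- differences of the approximants. The gradients are thus Cauchy in L^p(γ, H), and their limit
  -- inherits the duality relation.
  have hdiff : ∀ k l, eLpNorm ((Θ k).field - (Θ l).field) (ENNReal.ofReal p) γ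
      ≤ ENNReal.ofReal M * eLpNorm (φ k - φ l) (ENNReal.ofReal p) γ := fun k l => by
    refine (((hφ k).sub (hφ l)).mixRegular h).eLpNorm_le_of_inner_eq hc hs (fun x v => ?_) hpq
    simp only [Pi.sub_apply, inner_sub_right, sub_mul]
    rw [integral_sub ((hφ k).integrable_section_mul_hat x v)
      ((hφ l).integrable_section_mul_hat x v), mul_sub, mul_sub, hΘin, hΘin]
  have : Fact (1 ≤ ENNReal.ofReal p) := ⟨by simpa using hpq.lt.le⟩
  have hcau : CauchySeq fun k => (hφm k).toLp (φ k) := by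
    refine Tendsto.cauchySeq (x := hf.toLp f) ?_
    rw [tendsto_iff_norm_sub_tendsto_zero]
    refine hlim.congr fun k => ?_
    rw [norm_sub_rev, ← MemLp.toLp_sub, Lp.norm_toLp, toReal_eLpNorm (hf.sub (hφm k)).1]
  have hcau' : CauchySeq fun k => (hΘm k).toLp (Θ k).field := by
    rw [cauchySeq_iff_tendsto_dist_atTop_0] at hcau ⊢
    have h0 := hcau.const_mul M
    rw [mul_zero] at h0
    refine squeeze_zero (fun _ => dist_nonneg) (fun k => ?_) h0
    rw [dist_eq_norm, dist_eq_norm, ← MemLp.toLp_sub, ← MemLp.toLp_sub, Lp.norm_toLp, Lp.norm_toLp,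
      ← ENNReal.toReal_ofReal hM0, ← ENNReal.toReal_mul]
    exact ENNReal.toReal_mono (ENNReal.mul_ne_top ENNReal.ofReal_ne_top
      ((hφm _).sub (hφm _)).2.ne) (hdiff _ _)
  obtain ⟨F, hF⟩ := cauchySeq_tendsto_of_complete hcau'
  refine ⟨F, (memLp_mehler h hpq.lt.le hf).1, Lp.memLp F, fun Φ hΦ => ?_⟩
  have hFlim : Tendsto (fun k => lpNorm ((F : X → CameronMartin γ) - (Θ k).field) (ENNReal.ofReal p) γ) atTop (𝓝 0) := by
    rw [tendsto_iff_norm_sub_tendsto_zero] at hF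
    refine hF.congr fun k => ?_
    rw [norm_sub_rev, Lp.norm_def, toReal_eLpNorm (Lp.aestronglyMeasurable _)]
    have h1 : ⇑(F - (hΘm k).toLp (Θ k).field) =ᵐ[γ] ⇑F - (Θ k).field :=
      (Lp.coeFn_sub _ _).trans (EventuallyEq.rfl.sub (hΘm k).coeFn_toLp)
    rw [← toReal_eLpNorm (Lp.aestronglyMeasurable _), eLpNorm_congr_ae h1,
      toReal_eLpNorm ((Lp.memLp F).sub (hΘm k)).1]
  have h1 := tendsto_integral_inner_of_lpNorm hpq (hΦ.memLp_field (ENNReal.ofReal q)) (Lp.memLp F)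
    hΘm hFlim
  have h2 := (tendsto_integral_mul_of_lpNorm hpq (hΦ.memLp_divergence ENNReal.ofReal_ne_top)
    (memLp_mehler h hpq.lt.le hf).1 (fun k => (memLp_mehler h hpq.lt.le (hφm k)).1)
    (tendsto_lpNorm_mehler h hpq.lt.le hf hφm hlim)).neg
  simp only [hΘint _ Φ hΦ] at h1
  exact tendsto_nhds_unique h1 h2

/-- The divergence of a field smoothed by the semigroup. -/
lemma lpNorm_divergence_mehlerField_le (hpq : p.HolderConjugate q) (h : c ^ 2 + s ^ 2 = 1)
    (hc : 0 < c) (hs : 0 < s) {Φ : CylField γ} (hΦ : Φ.IsBounded) :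
    lpNorm (Φ.mehlerField hΦ c s).divergence (ENNReal.ofReal q) γ
      ≤ 1 / s * gaussianMomentConst q * lpNorm Φ.field (ENNReal.ofReal q) γ := by
  have hC := gaussianMomentConst_nonneg q
  refine lpNorm_le_of_cylindrical γ hpq.symm
    ((CylField.isBounded_mehlerField hΦ c s).memLp_divergence ENNReal.ofReal_ne_top)
    (mul_nonneg (by positivity) lpNorm_nonneg) fun φ hφ => ?_
  -- Pair with φ: c ∫ φ div(TΦ) = ∫ Tφ div Φ = -∫⟨Φ, ∇Tφ⟩. The gradient bound carries c/s, so the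
  -- factor c, which is positive, cancels.
  obtain ⟨Θ, hΘ, hΘint, hΘin⟩ := exists_gradField_mehler (γ := γ) hφ c s
  have h1 := integral_mehler_mul_divergence hpq h (hφ.memLp γ _) hΦ
  have h2 := hΘint Φ hΦ
  have h3 := abs_integral_inner_le hpq.symm (hΦ.memLp_field _) (hΘ.memLp_field _)
  have hφm := hφ.memLp γ (ENNReal.ofReal p)
  have h4 : lpNorm Θ.field (ENNReal.ofReal p) γ
      ≤ c / s * gaussianMomentConst q * lpNorm φ (ENNReal.ofReal p) γ := by
    rw [← toReal_eLpNorm (hΘ.memLp_field (ENNReal.ofReal p)).1, ← toReal_eLpNorm hφm.1,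
      ← ENNReal.toReal_ofReal (show 0 ≤ c / s * gaussianMomentConst q by positivity),
      ← ENNReal.toReal_mul]
    exact ENNReal.toReal_mono (ENNReal.mul_ne_top ENNReal.ofReal_ne_top hφm.2.ne)
      ((hφ.mixRegular h).eLpNorm_le_of_inner_eq hc.le hs hΘin hpq)
  rw [h2, h1, abs_neg, abs_mul, abs_of_pos hc] at h3
  have h5 : c * |∫ x, φ x * (Φ.mehlerField hΦ c s).divergence x ∂γ|
      ≤ c * (1 / s * gaussianMomentConst q * lpNorm Φ.field (ENNReal.ofReal q) γ
        * lpNorm φ (ENNReal.ofReal p) γ) := by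
    refine h3.trans ((mul_le_mul_of_nonneg_left h4 lpNorm_nonneg).trans_eq ?_)
    ring
  simp only [mul_comm _ (φ _)]
  exact le_of_mul_le_mul_left h5 hc

end Sobolev

end GaussianNB

end

open Filter Topology

set_option linter.unusedSectionVars false

noncomputable section

namespace GaussianNB

lemma tendsto_lpNorm_of_dominated {Ω E : Type*} [MeasurableSpace Ω] {μ : Measure Ω}
    [NormedAddCommGroup E] {r : ℝ} (hr : 0 < r) {u : Ω → E} {uk : ℕ → Ω → E} {b : Ω → ℝ}
    (hb : MemLp b (ENNReal.ofReal r) μ) (hu : AEStronglyMeasurable u μ)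
    (huk : ∀ k, AEStronglyMeasurable (uk k) μ) (hle : ∀ k x, ‖uk k x‖ ≤ b x)
    (hlim : ∀ x, Tendsto (fun k => uk k x) atTop (𝓝 (u x))) :
    Tendsto (fun k => lpNorm (uk k) (ENNReal.ofReal r) μ) atTop
      (𝓝 (lpNorm u (ENNReal.ofReal r) μ)) := by
  have h0 : ENNReal.ofReal r ≠ 0 := by simpa using hr
  simp only [lpNorm_eq_integral_norm_rpow_toReal h0 ENNReal.ofReal_ne_top hu,
    fun k => lpNorm_eq_integral_norm_rpow_toReal h0 ENNReal.ofReal_ne_top (huk k),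
    ENNReal.toReal_ofReal hr.le]
  have hint := hb.integrable_norm_rpow h0 ENNReal.ofReal_ne_top
  rw [ENNReal.toReal_ofReal hr.le] at hint
  refine ((Real.continuous_rpow_const (inv_nonneg.2 hr.le)).tendsto _).comp ?_
  refine tendsto_integral_of_dominated_convergence _ (fun k => ?_) hint (fun k => ?_) ?_
  · exact ((huk k).norm.aemeasurable.pow_const r).aestronglyMeasurable
  · refine ae_of_all _ fun x => ?_
    rw [Real.norm_of_nonneg (by positivity)]
    exact Real.rpow_le_rpow (norm_nonneg _) ((hle k x).trans (le_abs_self _)) hr.le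
  · exact ae_of_all _ fun x =>
      ((Real.continuous_rpow_const hr.le).tendsto _).comp (hlim x).norm

/-! ### From compactly supported to bounded coefficients, and the gradient bound. -/

section Cutoff

variable {X : Type*} [AddCommGroup X] [Module ℝ X] [TopologicalSpace X]
  [IsTopologicalAddGroup X] [ContinuousSMul ℝ X] [LocallyConvexSpace ℝ X] [T2Space X]
  [MeasurableSpace X] [BorelSpace X]
  {γ : Measure X} [IsGaussian γ] [IsCenteredMeasure γ] {p q α : ℝ}

namespace CylField

/-- The field with the opposite sign. -/
def neg (Φ : CylField γ) : CylField γ where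
  n := Φ.n
  Ψ i := fun z => -Φ.Ψ i z
  g := Φ.g
  h := Φ.h
  smooth i := (Φ.smooth i).neg

lemma field_neg (Φ : CylField γ) : Φ.neg.field = -Φ.field := by
  ext x
  change ∑ i, (-Φ.Ψ i (Φ.coords x)) • Φ.h i = -∑ i, Φ.Ψ i (Φ.coords x) • Φ.h i
  simp

lemma divergence_neg (Φ : CylField γ) : Φ.neg.divergence = -Φ.divergence := by
  ext x
  change ∑ i, (fderiv ℝ (fun z => -Φ.Ψ i z) (Φ.coords x) (Φ.coords (incl γ (Φ.h i)))
    - -Φ.Ψ i (Φ.coords x) * hat γ (Φ.h i) x) = -∑ i, (_ - _)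
  rw [← Finset.sum_neg_distrib]
  refine Finset.sum_congr rfl fun i _ => ?_
  rw [fderiv_fun_neg, neg_apply]
  ring

lemma IsBounded.neg {Φ : CylField γ} (h : Φ.IsBounded) : Φ.neg.IsBounded :=
  fun i => (h.bddSmooth i).neg.bdd

/-- Multiplication of the coefficients by `χ (ε z)`. -/
def cutoff (Φ : CylField γ) {χ : (Fin Φ.n → ℝ) → ℝ} (hχ : ContDiff ℝ ∞ χ) (ε : ℝ) : CylField γ where
  n := Φ.n
  Ψ i := fun z => χ (ε • z) * Φ.Ψ i z
  g := Φ.g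
  h := Φ.h
  smooth i := (hχ.comp (contDiff_const_smul ε)).mul (Φ.smooth i)

variable (Φ : CylField γ) {χ : (Fin Φ.n → ℝ) → ℝ} (hχ : ContDiff ℝ ∞ χ) (ε : ℝ)

lemma isCompactlySupported_cutoff (hs : HasCompactSupport χ) (hε : ε ≠ 0) :
    (Φ.cutoff hχ ε).IsCompactlySupported := fun _ => (hs.comp_smul hε).mul_right

lemma field_cutoff (x : X) :
    (Φ.cutoff hχ ε).field x = χ (ε • Φ.coordsL x) • Φ.field x := by
  change ∑ i, (χ (ε • Φ.coordsL x) * Φ.Ψ i (Φ.coords x)) • Φ.h i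
    = χ (ε • Φ.coordsL x) • ∑ i, Φ.Ψ i (Φ.coords x) • Φ.h i
  rw [Finset.smul_sum]
  simp only [mul_smul]

lemma divergence_cutoff (x : X) :
    (Φ.cutoff hχ ε).divergence x = χ (ε • Φ.coordsL x) * Φ.divergence x
      + ε * ∑ i, Φ.Ψ i (Φ.coordsL x)
        * fderiv ℝ χ (ε • Φ.coordsL x) (Φ.coordsL (incl γ (Φ.h i))) := by
  change ∑ i, (fderiv ℝ (fun z => χ (ε • z) * Φ.Ψ i z) (Φ.coordsL x) (Φ.coordsL (incl γ (Φ.h i)))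
    - χ (ε • Φ.coordsL x) * Φ.Ψ i (Φ.coordsL x) * hat γ (Φ.h i) x) = _
  rw [divergence, Finset.mul_sum, Finset.mul_sum, ← Finset.sum_add_distrib]
  refine Finset.sum_congr rfl fun i _ => ?_
  simp only [coords_eq]
  have h1 : HasFDerivAt (fun z : Fin Φ.n → ℝ => ε • z) (ε • ContinuousLinearMap.id ℝ _)
      (Φ.coordsL x) := (hasFDerivAt_id _).const_smul ε
  have h2 := ((hχ.differentiable (by simp) (ε • Φ.coordsL x)).hasFDerivAt.comp _ h1).mul
    ((Φ.smooth i).differentiable (by simp) (Φ.coordsL x)).hasFDerivAt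
  have h3 := h2.fderiv
  simp only [Function.comp_def] at h3
  refine (congrArg (fun L : (Fin Φ.n → ℝ) →L[ℝ] ℝ => L (Φ.coordsL (incl γ (Φ.h i)))
    - χ (ε • Φ.coordsL x) * Φ.Ψ i (Φ.coordsL x) * hat γ (Φ.h i) x) h3).trans ?_
  simp
  ring

end CylField

/-- The divergence inequality extends to bounded fields. -/
lemma DivergenceBound.le_of_isBounded (hpq : p.HolderConjugate q) (hα₀ : 0 ≤ α) (hα₁ : α ≤ 1)
    {f : X → ℝ} (hf : MemLp f (ENNReal.ofReal p) γ) {C : ℝ} (hC : DivergenceBound γ q α f C)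
    {Φ : CylField γ} (hΦ : Φ.IsBounded) :
    ∫ x, f x * Φ.divergence x ∂γ
      ≤ C * lpNorm Φ.field (ENNReal.ofReal q) γ ^ α
        * lpNorm Φ.divergence (ENNReal.ofReal q) γ ^ (1 - α) := by
  -- Multiplying the coefficients by χ(εz) with χ(0) = 1 gives compactly supported fields. Their
  -- divergences differ from χ(εz) div Φ by ε times a bounded term, so dominated convergence applies
  -- as ε tends to 0.
  obtain ⟨χ, hχ, hχs, hχ01, hχ1, -⟩ := exists_bump (V := Fin Φ.n → ℝ) (K := {0}) (T := ∅)
    isCompact_singleton isClosed_empty (by simp)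
  have hχ0 : χ 0 = 1 := hχ1 0 rfl
  have hχb := (BddSmooth.of_hasCompactSupport hχ hχs).bddC1
  obtain ⟨D, hD⟩ := hχb.bdd_fderiv
  have hD0 : 0 ≤ D := (norm_nonneg _).trans (hD 0)
  choose B hB using fun i => (hΦ.bddSmooth i).bddC1.bdd
  have hB0 : ∀ i, 0 ≤ B i := fun i => (norm_nonneg _).trans (hB i 0)
  let ε : ℕ → ℝ := fun k => 1 / ((k : ℝ) + 1)
  have hε : Tendsto ε atTop (𝓝 0) := tendsto_one_div_add_atTop_nhds_zero_nat
  have hεpos : ∀ k, 0 < ε k := fun k => by positivity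
  have hε1 : ∀ k, ε k ≤ 1 := fun k => by
    rw [div_le_one (by positivity)]
    linarith [(Nat.cast_nonneg k : (0 : ℝ) ≤ k)]
  let Θ : ℕ → CylField γ := fun k => Φ.cutoff hχ (ε k)
  have hΘs : ∀ k, (Θ k).IsCompactlySupported := fun k =>
    Φ.isCompactlySupported_cutoff hχ (ε k) hχs (hεpos k).ne'
  have hΘb : ∀ k, (Θ k).IsBounded := fun k => (hΘs k).isBounded
  set K : ℝ := ∑ i, B i * (D * ‖Φ.coordsL (incl γ (Φ.h i))‖) with hK
  let R : ℕ → X → ℝ := fun k x => ∑ i, Φ.Ψ i (Φ.coordsL x)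
        * fderiv ℝ χ (ε k • Φ.coordsL x) (Φ.coordsL (incl γ (Φ.h i)))
  have hR : ∀ k x, |R k x| ≤ K := fun k x => by
    refine (Finset.abs_sum_le_sum_abs _ _).trans (Finset.sum_le_sum fun i _ => ?_)
    rw [abs_mul]
    refine mul_le_mul (hB i _) ?_ (abs_nonneg _) (hB0 i)
    exact (ContinuousLinearMap.le_opNorm _ _).trans (mul_le_mul_of_nonneg_right (hD _) (norm_nonneg _))
  have hχlim : ∀ x, Tendsto (fun k => χ (ε k • Φ.coordsL x)) atTop (𝓝 1) := fun x => by
    have h1 : Tendsto (fun k => ε k • Φ.coordsL x) atTop (𝓝 0) := by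
      simpa using hε.smul_const (Φ.coordsL x)
    rw [← hχ0]
    exact (hχb.continuous.tendsto 0).comp h1
  have hχle : ∀ z, |χ z| ≤ 1 := fun z => abs_le.2 ⟨by linarith [(hχ01 z).1], (hχ01 z).2⟩
  have hdivm := hΦ.memLp_divergence (γ := γ) (r := ENNReal.ofReal q) ENNReal.ofReal_ne_top
  have hb : MemLp (fun x => |Φ.divergence x| + K) (ENNReal.ofReal q) γ :=
    hdivm.abs.add (memLp_const K)
  have hdivle : ∀ k x, |(Θ k).divergence x| ≤ |Φ.divergence x| + K := fun k x => by
    rw [Φ.divergence_cutoff hχ (ε k) x]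
    refine (abs_add_le _ _).trans (add_le_add ?_ ?_)
    · rw [abs_mul]
      exact mul_le_of_le_one_left (abs_nonneg _) (hχle _)
    · rw [abs_mul, abs_of_pos (hεpos k)]
      exact (mul_le_of_le_one_left (abs_nonneg _) (hε1 k)).trans (hR k x)
  have hdivlim : ∀ x, Tendsto (fun k => (Θ k).divergence x) atTop (𝓝 (Φ.divergence x)) := fun x => by
    have h1 : Tendsto (fun k => ε k * R k x) atTop (𝓝 0) := by
      have h2 := hε.mul_const K
      rw [zero_mul] at h2
      refine squeeze_zero_norm (fun k => ?_) h2
      rw [Real.norm_eq_abs, abs_mul, abs_of_pos (hεpos k)]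
      exact mul_le_mul_of_nonneg_left (hR k x) (hεpos k).le
    have h3 := ((hχlim x).mul_const (Φ.divergence x)).add h1
    rw [one_mul, add_zero] at h3
    exact h3.congr fun k => (Φ.divergence_cutoff hχ (ε k) x).symm
  have hq := hpq.symm.pos
  have l1 : Tendsto (fun k => ∫ x, f x * (Θ k).divergence x ∂γ) atTop
      (𝓝 (∫ x, f x * Φ.divergence x ∂γ)) := by
    refine tendsto_integral_of_dominated_convergence (fun x => |f x| * (|Φ.divergence x| + K))
      (fun k => hf.1.mul ((hΘb k).memLp_divergence (r := 1) (by simp)).1)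
      (integrable_mul_of_memLp hpq hf.abs hb) (fun k => ae_of_all _ fun x => ?_)
      (ae_of_all _ fun x => (hdivlim x).const_mul (f x))
    rw [Real.norm_eq_abs, abs_mul]
    exact mul_le_mul_of_nonneg_left (hdivle k x) (abs_nonneg _)
  have l2 : Tendsto (fun k => lpNorm (Θ k).field (ENNReal.ofReal q) γ) atTop
      (𝓝 (lpNorm Φ.field (ENNReal.ofReal q) γ)) := by
    refine tendsto_lpNorm_of_dominated hq (hΦ.memLp_field (ENNReal.ofReal q)).norm
      (hΦ.memLp_field 1).1 (fun k => ((hΘb k).memLp_field 1).1) (fun k x => ?_) fun x => ?_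
    · rw [Φ.field_cutoff hχ (ε k) x, norm_smul]
      exact mul_le_of_le_one_left (norm_nonneg _) (hχle _)
    · have h1 := (hχlim x).smul_const (Φ.field x)
      rw [one_smul] at h1
      exact h1.congr fun k => (Φ.field_cutoff hχ (ε k) x).symm
  have l3 : Tendsto (fun k => lpNorm (Θ k).divergence (ENNReal.ofReal q) γ) atTop
      (𝓝 (lpNorm Φ.divergence (ENNReal.ofReal q) γ)) :=
    tendsto_lpNorm_of_dominated hq hb hdivm.1
      (fun k => ((hΘb k).memLp_divergence (r := 1) (by simp)).1) hdivle hdivlim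
  -- Powers with nonnegative exponent are continuous up to base 0; with exponent 0 they are
  -- constantly 1, in accordance with 0⁰ = 1.
  refine le_of_tendsto_of_tendsto' l1 (Tendsto.mul (Tendsto.const_mul C ?_) ?_)
    fun k => hC (Θ k) (hΘs k)
  · exact ((Real.continuous_rpow_const hα₀).tendsto _).comp l2
  · exact ((Real.continuous_rpow_const (sub_nonneg.2 hα₁)).tendsto _).comp l3

lemma DivergenceBound.abs_le_of_isBounded (hpq : p.HolderConjugate q) (hα₀ : 0 ≤ α) (hα₁ : α ≤ 1)
    {f : X → ℝ} (hf : MemLp f (ENNReal.ofReal p) γ) {C : ℝ} (hC : DivergenceBound γ q α f C)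
    {Φ : CylField γ} (hΦ : Φ.IsBounded) :
    |∫ x, f x * Φ.divergence x ∂γ|
      ≤ C * lpNorm Φ.field (ENNReal.ofReal q) γ ^ α
        * lpNorm Φ.divergence (ENNReal.ofReal q) γ ^ (1 - α) := by
  refine abs_le'.2 ⟨hC.le_of_isBounded hpq hα₀ hα₁ hf hΦ, ?_⟩
  have h1 := hC.le_of_isBounded hpq hα₀ hα₁ hf hΦ.neg
  rw [CylField.field_neg, CylField.divergence_neg, lpNorm_neg, lpNorm_neg] at h1
  simpa [integral_neg] using h1

variable [γ.InnerRegular]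

/-- The gradient of the smoothed function under the divergence inequality. -/
lemma DivergenceBound.lpNorm_gradient_le (hpq : p.HolderConjugate q) (hα₀ : 0 < α) (hα₁ : α ≤ 1)
    {f : X → ℝ} (hf : MemLp f (ENNReal.ofReal p) γ) {C : ℝ} (hC0 : 0 ≤ C)
    (hC : DivergenceBound γ q α f C) {c s : ℝ} (h : c ^ 2 + s ^ 2 = 1) (hc : 0 < c) (hs : 0 < s)
    {F : X → CameronMartin γ} (hF : IsSobolevGradient γ (ENNReal.ofReal p) (mehler γ c s f) F) :
    lpNorm F (ENNReal.ofReal p) γ ≤ c * C * (1 / s * gaussianMomentConst q) ^ (1 - α) := by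
  have hG := gaussianMomentConst_nonneg q
  have hα' : 0 ≤ 1 - α := by linarith
  refine lpNorm_le_of_cylField γ hpq hF.2.1 (by positivity) fun Φ hΦ => ?_
  have hb := CylField.isBounded_mehlerField hΦ c s
  rw [hF.2.2 Φ hΦ, abs_neg, integral_mehler_mul_divergence hpq h hf hΦ, abs_mul, abs_of_pos hc]
  set N := lpNorm Φ.field (ENNReal.ofReal q) γ
  have hN : 0 ≤ N := lpNorm_nonneg
  calc c * |∫ x, f x * (Φ.mehlerField hΦ c s).divergence x ∂γ|
      ≤ c * (C * lpNorm (Φ.mehlerField hΦ c s).field (ENNReal.ofReal q) γ ^ α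
        * lpNorm (Φ.mehlerField hΦ c s).divergence (ENNReal.ofReal q) γ ^ (1 - α)) := by
        gcongr
        exact hC.abs_le_of_isBounded hpq hα₀.le hα₁ hf hb
    _ ≤ c * (C * N ^ α * (1 / s * gaussianMomentConst q * N) ^ (1 - α)) := by
        have h1 := CylField.lpNorm_mehlerField_le hΦ h hpq.symm.lt.le
        have h2 := lpNorm_divergence_mehlerField_le hpq h hc hs hΦ
        have h3 : 0 ≤ lpNorm (Φ.mehlerField hΦ c s).field (ENNReal.ofReal q) γ := lpNorm_nonneg
        have h4 : 0 ≤ lpNorm (Φ.mehlerField hΦ c s).divergence (ENNReal.ofReal q) γ := lpNorm_nonneg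
        gcongr
    _ = c * C * (1 / s * gaussianMomentConst q) ^ (1 - α) * N := by
        rw [Real.mul_rpow (by positivity) hN]
        have : N ^ α * N ^ (1 - α) = N := by
          rw [← Real.rpow_add_of_nonneg hN hα₀.le hα', add_sub_cancel, Real.rpow_one]
        linear_combination c * C * (1 / s * gaussianMomentConst q) ^ (1 - α) * this

end Cutoff

/-! ### The bound of U by V. -/

section FirstInequality

lemma exp_sq_add_sqrt_sq {t : ℝ} (ht : 0 ≤ t) :
    Real.exp (-t) ^ 2 + √(1 - Real.exp (-2 * t)) ^ 2 = 1 := by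
  have h1 : Real.exp (-2 * t) = Real.exp (-t) ^ 2 := by
    rw [← Real.exp_nat_mul]; congr 1; push_cast; ring
  rw [Real.sq_sqrt, h1]
  · ring
  · rw [sub_nonneg]
    exact Real.exp_le_one_iff.2 (by linarith)

lemma sqrt_one_sub_exp_pos {t : ℝ} (ht : 0 < t) : 0 < √(1 - Real.exp (-2 * t)) :=
  Real.sqrt_pos.2 (by rw [sub_pos]; exact Real.exp_lt_one_iff.2 (by linarith))

/-- After squaring and multiplying by e^{2t} this is t + 1 ≤ e^{2t}. -/
lemma sqrt_mul_exp_le {t : ℝ} (ht : 0 ≤ t) : √t * Real.exp (-t) ≤ √(1 - Real.exp (-2 * t)) := by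
  have h1 : Real.exp (-2 * t) = Real.exp (-t) ^ 2 := by
    rw [← Real.exp_nat_mul]; congr 1; push_cast; ring
  refine Real.le_sqrt_of_sq_le ?_
  rw [mul_pow, Real.sq_sqrt ht, ← h1]
  have h2 : t + 1 ≤ Real.exp (2 * t) := by
    linarith [Real.add_one_le_exp (2 * t)]
  have h3 : Real.exp (2 * t) * Real.exp (-2 * t) = 1 := by
    rw [← Real.exp_add]; simp
  nlinarith [Real.exp_pos (-2 * t)]

/-- Since e^{-t} ≤ 1, it is at most its power of exponent 1 - α, and everything becomes the (1 -
α)-th power of √t e^{-t}/s ≤ 1. Hence the weight contributes no constant beyond C(q)^{1-α}. -/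
lemma rpow_mul_exp_mul_le {α t : ℝ} (hα₀ : 0 ≤ α) (hα₁ : α ≤ 1) (ht : 0 < t) :
    t ^ ((1 - α) / 2) * (Real.exp (-t) * (1 / √(1 - Real.exp (-2 * t))) ^ (1 - α)) ≤ 1 := by
  have hs := sqrt_one_sub_exp_pos ht
  have hα' : 0 ≤ 1 - α := by linarith
  have h1 : t ^ ((1 - α) / 2) = √t ^ (1 - α) := by
    rw [Real.sqrt_eq_rpow, ← Real.rpow_mul ht.le]; congr 1; ring
  have h2 : Real.exp (-t) ≤ Real.exp (-t) ^ (1 - α) :=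
    Real.self_le_rpow_of_le_one (Real.exp_pos _).le (Real.exp_le_one_iff.2 (by linarith))
      (by linarith)
  calc _ ≤ √t ^ (1 - α) * (Real.exp (-t) ^ (1 - α) * (1 / √(1 - Real.exp (-2 * t))) ^ (1 - α)) := by
        rw [h1]; gcongr
    _ = (√t * Real.exp (-t) * (1 / √(1 - Real.exp (-2 * t)))) ^ (1 - α) := by
        rw [Real.mul_rpow (by positivity) (by positivity), Real.mul_rpow (by positivity)
          (by positivity), mul_assoc]
    _ ≤ 1 := by
        refine Real.rpow_le_one (by positivity) ?_ hα'
        rw [mul_one_div, div_le_one hs]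
        exact sqrt_mul_exp_le ht.le

variable {X : Type*} [AddCommGroup X] [Module ℝ X] [TopologicalSpace X]
  [IsTopologicalAddGroup X] [ContinuousSMul ℝ X] [LocallyConvexSpace ℝ X] [T2Space X]
  [MeasurableSpace X] [BorelSpace X]
  {γ : Measure X} [IsGaussian γ] [IsCenteredMeasure γ] [γ.InnerRegular] {p q α : ℝ}

lemma DivergenceBound.semigroupVariation_le (hpq : p.HolderConjugate q) (hα₀ : 0 < α) (hα₁ : α ≤ 1)
    {f : X → ℝ} (hf : MemLp f (ENNReal.ofReal p) γ) {C : ℝ≥0}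
    (hC : DivergenceBound γ q α f C) :
    semigroupVariation γ p α f ≤ ENNReal.ofReal (gaussianMomentConst q ^ (1 - α)) * C := by
  refine iSup₂_le fun t ht => ?_
  have hcs := exp_sq_add_sqrt_sq ht.le
  have hs := sqrt_one_sub_exp_pos ht
  have hc := Real.exp_pos (-t)
  set c := Real.exp (-t) with hcdef
  set s := √(1 - Real.exp (-2 * t)) with hsdef
  obtain ⟨F, hF⟩ := exists_isSobolevGradient_mehler hpq hcs hc.le hs hf
  have hb := hC.lpNorm_gradient_le hpq hα₀ hα₁ hf C.coe_nonneg hcs hc hs hF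
  have hG := gaussianMomentConst_nonneg q
  calc ENNReal.ofReal (t ^ ((1 - α) / 2)) * gradNorm γ (ENNReal.ofReal p) (ouSemigroup γ t f)
      ≤ ENNReal.ofReal (t ^ ((1 - α) / 2)) * eLpNorm F (ENNReal.ofReal p) γ := by
        gcongr
        exact iInf₂_le F hF
    _ ≤ ENNReal.ofReal (gaussianMomentConst q ^ (1 - α)) * ENNReal.ofReal C := by
        rw [← ofReal_lpNorm hF.2.1, ← ENNReal.ofReal_mul (by positivity),
          ← ENNReal.ofReal_mul (by positivity)]
        refine ENNReal.ofReal_le_ofReal ((mul_le_mul_of_nonneg_left hb (by positivity)).trans ?_)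
        rw [Real.mul_rpow (by positivity) hG]
        have h1 := mul_le_mul_of_nonneg_left (rpow_mul_exp_mul_le hα₀.le hα₁ ht)
          (show 0 ≤ gaussianMomentConst q ^ (1 - α) * C by positivity)
        rw [← hcdef, ← hsdef] at h1
        linear_combination h1
    _ = _ := by rw [ENNReal.ofReal_coe_nnreal]

/-- The gradient of the semigroup is controlled by the divergence inequality. -/
theorem semigroupVariation_le (hpq : p.HolderConjugate q) (hα₀ : 0 < α) (hα₁ : α ≤ 1)
    {f : X → ℝ} (hf : MemLp f (ENNReal.ofReal p) γ) :
    semigroupVariation γ p α f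
      ≤ ENNReal.ofReal (gaussianMomentConst q ^ (1 - α)) * divergenceVariation γ q α f := by
  -- Strict positivity matters: multiplication by 0 does not commute with the infimum when there is
  -- no admissible constant, because 0 · ∞ = 0.
  have hG := gaussianMomentConst_pos hpq.symm.pos
  have h0 : ENNReal.ofReal (gaussianMomentConst q ^ (1 - α)) ≠ 0 := by
    simpa using Real.rpow_pos_of_pos hG _
  rw [divergenceVariation, ENNReal.mul_iInf_of_ne h0 ENNReal.ofReal_ne_top]
  refine le_iInf fun C => ?_
  rw [ENNReal.mul_iInf_of_ne h0 ENNReal.ofReal_ne_top]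
  exact le_iInf fun hC => hC.semigroupVariation_le hpq hα₀ hα₁ hf

lemma DivergenceBound.mono {f : X → ℝ} {C D : ℝ} (hC : DivergenceBound γ q α f C) (hCD : C ≤ D) :
    DivergenceBound γ q α f D := fun Φ hΦ => by
  refine (hC Φ hΦ).trans ?_
  have h1 : 0 ≤ lpNorm Φ.field (ENNReal.ofReal q) γ := lpNorm_nonneg
  have h2 : 0 ≤ lpNorm Φ.divergence (ENNReal.ofReal q) γ := lpNorm_nonneg
  gcongr

end FirstInequality

end GaussianNB

end

open Filter Topology

set_option linter.unusedSectionVars false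

noncomputable section

namespace GaussianNB

/-! ### The semigroup law on cylindrical functions. -/

section Semigroup

variable {X : Type*} [AddCommGroup X] [Module ℝ X] [TopologicalSpace X]
  [MeasurableSpace X] [BorelSpace X]
  {V : Type} [NormedAddCommGroup V] [NormedSpace ℝ V] [FiniteDimensional ℝ V]
  [MeasurableSpace V] [BorelSpace V]
  {γ : Measure X} [IsGaussian γ] [IsCenteredMeasure γ]

lemma integral_integral_comp_mix {a b : ℝ} (h : a ^ 2 + b ^ 2 = 1) (G : X →L[ℝ] V)
    {H : V → ℝ} (hH : Continuous H) (hb : ∃ C, ∀ y, ‖H y‖ ≤ C) :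
    ∫ y, ∫ y', H (a • G y + b • G y') ∂γ ∂γ = ∫ y, H (G y) ∂γ := by
  obtain ⟨C, hC⟩ := hb
  have hG : Measurable G := G.continuous.measurable
  have hm : Measurable fun z : X × X => G (a • z.1 + b • z.2) := by
    simp only [map_add, map_smul]
    fun_prop
  have hi : Integrable (fun z : X × X => H (a • G z.1 + b • G z.2)) (γ.prod γ) :=
    Integrable.of_bound (hH.measurable.comp (by fun_prop)).aestronglyMeasurable C
      (ae_of_all _ fun z => hC _)
  rw [← integral_prod _ hi, ← integral_map hG.aemeasurable hH.aestronglyMeasurable,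
    ← map_mix γ G h, integral_map hm.aemeasurable hH.aestronglyMeasurable]
  simp only [map_add, map_smul]

/-- The composition of two Mehler operators. -/
lemma cylMehler_cylMehler {c s c' s' : ℝ} (hc : c' = c ^ 2) (hs : (c * s) ^ 2 + s ^ 2 = s' ^ 2)
    (hs' : s' ≠ 0) (G : X →L[ℝ] V) {Ψ : V → ℝ} (hΨ : Continuous Ψ) (hb : ∃ C, ∀ y, ‖Ψ y‖ ≤ C) :
    cylMehler γ c s G (cylMehler γ c s G Ψ) = cylMehler γ c' s' G Ψ := by
  ext z
  obtain ⟨C, hC⟩ := hb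
  -- Composition produces the noise csy + sy' with independent y and y'. Its coefficients have sum
  -- of squares s'², so after division by s' rotation invariance makes it one copy of s'y.
  have h1 := integral_integral_comp_mix (γ := γ) (a := c * s / s') (b := s / s')
    (by field_simp; linarith) G (H := fun w => Ψ (c' • z + s' • w)) (by fun_prop)
    ⟨C, fun y => hC _⟩
  refine Eq.trans ?_ h1
  simp only [cylMehler]
  congr 1 with y
  congr 1 with y'
  congr 1
  have e1 : s' * (c * s / s') = c * s := by field_simp
  have e2 : s' * (s / s') = s := by field_simp
  rw [hc, smul_add, smul_add, smul_smul, smul_smul, smul_smul, smul_smul, e1, e2, sq, ← add_assoc]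

end Semigroup

/-! ### The generator as the divergence of the gradient. -/

section Generator

variable {X : Type*} [AddCommGroup X] [Module ℝ X] [TopologicalSpace X]
  [IsTopologicalAddGroup X] [ContinuousSMul ℝ X] [LocallyConvexSpace ℝ X] [T2Space X]
  [MeasurableSpace X] [BorelSpace X]
  {γ : Measure X} [IsGaussian γ] [IsCenteredMeasure γ] [γ.InnerRegular] {c s p q : ℝ}
  {n : ℕ} (G : X →L[ℝ] (Fin n → ℝ)) {Ψ : (Fin n → ℝ) → ℝ} (hΨ : BddSmooth Ψ)

lemma divergence_gradField (x : X) : (gradField (γ := γ) G hΨ).divergence x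
    = ∑ j, (fderiv ℝ (fun z => fderiv ℝ Ψ z (Pi.single j 1)) (G x)
        (G (incl γ (ofDual γ ((ContinuousLinearMap.proj j).comp G))))
      - fderiv ℝ Ψ (G x) (Pi.single j 1)
        * hat γ (ofDual γ ((ContinuousLinearMap.proj j).comp G)) x) := rfl

lemma divergence_mehlerField_gradField (x : X) :
    ((gradField (γ := γ) G hΨ).mehlerField (isBounded_gradField G hΨ) c s).divergence x
    = ∑ j, (fderiv ℝ (cylMehler γ c s G (fun z => fderiv ℝ Ψ z (Pi.single j 1))) (G x)
        (G (incl γ (ofDual γ ((ContinuousLinearMap.proj j).comp G))))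
      - cylMehler γ c s G (fun z => fderiv ℝ Ψ z (Pi.single j 1)) (G x)
        * hat γ (ofDual γ ((ContinuousLinearMap.proj j).comp G)) x) := rfl

lemma fderiv_cylMehler_single (hΨ : BddSmooth Ψ) (j : Fin n) :
    (fun z => fderiv ℝ (cylMehler γ c s G Ψ) z (Pi.single j 1))
      = fun z => c * cylMehler γ c s G (fun z => fderiv ℝ Ψ z (Pi.single j 1)) z := by
  ext z
  rw [fderiv_cylMehler_apply G hΨ.bddC1]
  rfl

/-- The semigroup commutes with the gradient up to the factor `c`. -/
lemma mul_divergence_mehlerField_gradField (x : X) :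
    c * ((gradField (γ := γ) G hΨ).mehlerField (isBounded_gradField G hΨ) c s).divergence x
      = (gradField (γ := γ) G
        (bddSmooth_cylMehler (γ := γ) (c := c) (s := s) G hΨ)).divergence x := by
  rw [divergence_mehlerField_gradField, divergence_gradField, Finset.mul_sum]
  refine Finset.sum_congr rfl fun j _ => ?_
  have h1 := congrFun (fderiv_cylMehler_single (γ := γ) (c := c) (s := s) G hΨ j) (G x)
  have hd := (bddSmooth_cylMehler (γ := γ) (c := c) (s := s) G
    (hΨ.fderiv_apply (Pi.single j 1))).bddC1.differentiable (G x)
  rw [fderiv_cylMehler_single G hΨ j, h1, fderiv_const_mul hd, smul_apply, smul_eq_mul]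
  ring

/-- The generator applied to the smoothed function. -/
lemma divergence_gradField_cylMehler (hs : s ≠ 0) :
    ∀ᵐ x ∂γ, (gradField (γ := γ) G
        (bddSmooth_cylMehler (γ := γ) (c := c) (s := s) G hΨ)).divergence x
      = ∫ y, fderiv ℝ Ψ (c • G x + s • G y) ((c ^ 2 / s) • G y - c • G x) ∂γ := by
  -- The element of L²(γ) attached to a coordinate functional equals this functional only almost
  -- everywhere, hence the exceptional null set. The right-hand side to be reached is the time
  -- derivative of Ψ(cGx + sGy), as c' = -c and s' = c²/s.
  have hae : ∀ᵐ x ∂γ, ∀ j : Fin n,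
      hat γ (ofDual γ ((ContinuousLinearMap.proj j).comp G)) x = G x j :=
    ae_all_iff.2 fun j => hat_ofDual_ae γ ((ContinuousLinearMap.proj j).comp G)
  filter_upwards [hae] with x hx
  have hsum : ∀ v : Fin n → ℝ, v = ∑ j, v j • Pi.single j (1 : ℝ) := fun v => by
    ext i
    simp [Finset.sum_apply, Pi.single_apply]
  have hbi : ∀ (j : Fin n), Integrable (fun y => fderiv ℝ Ψ (c • G x + s • G y) (Pi.single j 1)) γ :=
    fun j => integrable_comp_affine (γ := γ) G (hΨ.fderiv_apply (Pi.single j 1)).bddC1.continuous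
      (hΨ.fderiv_apply (Pi.single j 1)).bddC1.bdd (c • G x) s
  have hii : ∀ (j : Fin n), Integrable (fun y => fderiv ℝ Ψ (c • G x + s • G y) (Pi.single j 1)
      * hat γ (ofDual γ ((ContinuousLinearMap.proj j).comp G)) y) γ := fun j => by
    obtain ⟨C, hC⟩ := (hΨ.fderiv_apply (Pi.single j 1)).bddC1.bdd
    exact ((memLp_hat γ _ (r := 1) (by simp)).integrable le_rfl).bdd_mul (hbi j).1
      (ae_of_all _ fun y => hC (c • G x + s • G y))
  have hR : ∫ y, fderiv ℝ Ψ (c • G x + s • G y) ((c ^ 2 / s) • G y - c • G x) ∂γ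
      = ∑ j, (c ^ 2 / s * ∫ y, fderiv ℝ Ψ (c • G x + s • G y) (Pi.single j 1)
          * hat γ (ofDual γ ((ContinuousLinearMap.proj j).comp G)) y ∂γ
        - c * G x j * ∫ y, fderiv ℝ Ψ (c • G x + s • G y) (Pi.single j 1) ∂γ) := by
    have h1 : ∀ᵐ y ∂γ, fderiv ℝ Ψ (c • G x + s • G y) ((c ^ 2 / s) • G y - c • G x)
        = ∑ j, (c ^ 2 / s * (fderiv ℝ Ψ (c • G x + s • G y) (Pi.single j 1)
          * hat γ (ofDual γ ((ContinuousLinearMap.proj j).comp G)) y)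
        - c * G x j * fderiv ℝ Ψ (c • G x + s • G y) (Pi.single j 1)) := by
      filter_upwards [hae] with y hy
      conv_lhs => rw [hsum ((c ^ 2 / s) • G y - c • G x), map_sum]
      refine Finset.sum_congr rfl fun j _ => ?_
      rw [hy j, map_smul]
      simp only [Pi.sub_apply, Pi.smul_apply, smul_eq_mul]
      ring
    have h2 : ∀ j, Integrable (fun y => c ^ 2 / s * (fderiv ℝ Ψ (c • G x + s • G y) (Pi.single j 1)
          * hat γ (ofDual γ ((ContinuousLinearMap.proj j).comp G)) y)
        - c * G x j * fderiv ℝ Ψ (c • G x + s • G y) (Pi.single j 1)) γ := fun j =>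
      ((hii j).const_mul _).sub ((hbi j).const_mul _)
    rw [integral_congr_ae h1, integral_finsetSum _ fun j _ => h2 j]
    refine Finset.sum_congr rfl fun j _ => ?_
    rw [integral_sub ((hii j).const_mul _) ((hbi j).const_mul _), integral_const_mul,
      integral_const_mul]
  rw [hR, ← mul_divergence_mehlerField_gradField G hΨ, divergence_mehlerField_gradField, Finset.mul_sum]
  refine Finset.sum_congr rfl fun j _ => ?_
  -- Integration by parts in y trades the second derivative of Ψ for the factor y_j/s, which
  -- produces the coefficient c²/s.
  have h2 := fderiv_cylMehler_incl (γ := γ) (c := c) (s := s) G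
    (hΨ.fderiv_apply (Pi.single j 1)).bddC1 (G x)
    (ofDual γ ((ContinuousLinearMap.proj j).comp G))
  rw [hx j, cylMehler]
  field_simp
  linear_combination c * h2

/-- The generator of the semigroup at the sum of two equal times. -/
lemma integral_mul_divergence_gradField_split {c' s' : ℝ} (hpq : p.HolderConjugate q)
    (h : c ^ 2 + s ^ 2 = 1) (hc : c' = c ^ 2) (hs : (c * s) ^ 2 + s ^ 2 = s' ^ 2) (hs' : s' ≠ 0)
    {f : X → ℝ} (hf : MemLp f (ENNReal.ofReal p) γ) :
    ∫ x, f x * (gradField (γ := γ) G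
        (bddSmooth_cylMehler (γ := γ) (c := c') (s := s') G hΨ)).divergence x ∂γ
      = ∫ x, mehler γ c s f x * (gradField (γ := γ) G
        (bddSmooth_cylMehler (γ := γ) (c := c) (s := s) G hΨ)).divergence x ∂γ := by
  have hM := bddSmooth_cylMehler (γ := γ) (c := c) (s := s) G hΨ
  -- One half of the evolution is moved from f to the field. There it combines with the other half,
  -- because c div(T∇u) = div ∇(Tu) and two Mehler operators compose.
  rw [integral_mehler_mul_divergence hpq h hf (isBounded_gradField G hM), ← integral_const_mul]
  congr 1 with x
  have h1 := mul_divergence_mehlerField_gradField (γ := γ) (c := c) (s := s) G hM x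
  have h2 := cylMehler_cylMehler (γ := γ) hc hs hs' G hΨ.bddC1.continuous hΨ.bddC1.bdd
  rw [mul_left_comm, h1]
  simp only [h2]

lemma lpNorm_gradField_cylMehler_le (hpq : p.HolderConjugate q) (h : c ^ 2 + s ^ 2 = 1)
    (hc : 0 ≤ c) (hs : 0 < s) :
    lpNorm (gradField (γ := γ) G
        (bddSmooth_cylMehler (γ := γ) (c := c) (s := s) G hΨ)).field (ENNReal.ofReal p) γ
      ≤ c / s * gaussianMomentConst q * lpNorm (fun x => Ψ (G x)) (ENNReal.ofReal p) γ := by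
  have hM := bddSmooth_cylMehler (γ := γ) (c := c) (s := s) G hΨ
  have hφ : IsCylindrical fun x => Ψ (G x) := ⟨n, G, Ψ, hΨ, rfl⟩
  have hφm := hφ.memLp γ (ENNReal.ofReal p)
  have hFm := (isBounded_gradField (γ := γ) G hM).memLp_field (ENNReal.ofReal p)
  have hC := gaussianMomentConst_nonneg q
  rw [← toReal_eLpNorm hFm.1, ← toReal_eLpNorm hφm.1,
    ← ENNReal.toReal_ofReal (show 0 ≤ c / s * gaussianMomentConst q by positivity),
    ← ENNReal.toReal_mul]
  refine ENNReal.toReal_mono (ENNReal.mul_ne_top ENNReal.ofReal_ne_top hφm.2.ne)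
    ((hφ.mixRegular h).eLpNorm_le_of_inner_eq hc hs (fun x v => ?_) hpq)
  rw [inner_gradField, fderiv_cylMehler_incl G hΨ.bddC1]
  simp

end Generator

/-! ### Time derivative of the pairing with the semigroup. -/

section TimeDerivative

variable {X : Type*} [AddCommGroup X] [Module ℝ X] [TopologicalSpace X]
  [IsTopologicalAddGroup X] [ContinuousSMul ℝ X] [LocallyConvexSpace ℝ X] [T2Space X]
  [MeasurableSpace X] [BorelSpace X]
  {γ : Measure X} [IsGaussian γ] [IsCenteredMeasure γ] [γ.InnerRegular] {p q : ℝ}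
  {n : ℕ} (G : X →L[ℝ] (Fin n → ℝ)) {Ψ : (Fin n → ℝ) → ℝ} (hΨ : BddSmooth Ψ)

lemma hasDerivAt_sqrt_one_sub_exp {t : ℝ} (ht : 0 < t) :
    HasDerivAt (fun t => √(1 - Real.exp (-2 * t)))
      (Real.exp (-t) ^ 2 / √(1 - Real.exp (-2 * t))) t := by
  have h1 : Real.exp (-2 * t) = Real.exp (-t) ^ 2 := by
    rw [← Real.exp_nat_mul]; congr 1; push_cast; ring
  have hs := sqrt_one_sub_exp_pos ht
  have h2 : HasDerivAt (fun t => 1 - Real.exp (-2 * t)) (-(Real.exp (-2 * t) * (-2 * 1))) t :=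
    (((hasDerivAt_id t).const_mul (-2)).exp).const_sub 1
  have h3 := h2.sqrt (Real.sqrt_pos.1 hs).ne'
  refine h3.congr_deriv ?_
  rw [← h1]
  field_simp

lemma integrable_mul_comp_mix (hΨ : BddSmooth Ψ) {f : X → ℝ} (hf : Integrable f γ) (c s : ℝ) :
    Integrable (fun z : X × X => f z.1 * Ψ (c • G z.1 + s • G z.2)) (γ.prod γ) := by
  obtain ⟨C, hC⟩ := hΨ.bddC1.bdd
  have hGm : Measurable G := G.continuous.measurable
  exact (hf.comp_fst γ).mul_bdd (hΨ.bddC1.continuous.measurable.comp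
    (by fun_prop)).aestronglyMeasurable (ae_of_all _ fun z => hC _)

/-- The pairing of a function with the evolution of a cylindrical function. -/
lemma integral_mul_cylMehler_eq_prod (hΨ : BddSmooth Ψ) {f : X → ℝ} (hf : Integrable f γ) (c s : ℝ) :
    ∫ x, f x * cylMehler γ c s G Ψ (G x) ∂γ
      = ∫ z : X × X, f z.1 * Ψ (c • G z.1 + s • G z.2) ∂(γ.prod γ) := by
  have hi := integrable_mul_comp_mix G hΨ hf c s
  rw [integral_prod _ hi]
  simp only [integral_const_mul]
  rfl

/-- The generator is the time derivative of the semigroup. -/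
lemma hasDerivAt_integral_mul_cylMehler (hpq : p.HolderConjugate q) {f : X → ℝ}
    (hf : MemLp f (ENNReal.ofReal p) γ) {t : ℝ} (ht : 0 < t) :
    HasDerivAt (fun t => ∫ x, f x
        * cylMehler γ (Real.exp (-t)) √(1 - Real.exp (-2 * t)) G Ψ (G x) ∂γ)
      (∫ x, f x * (gradField (γ := γ) G (bddSmooth_cylMehler (γ := γ) (c := Real.exp (-t))
        (s := √(1 - Real.exp (-2 * t))) G hΨ)).divergence x ∂γ) t := by
  have hf1 : Integrable f γ := hf.integrable (by simpa using hpq.lt.le)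
  have hGm : Measurable G := G.continuous.measurable
  have hΨc := hΨ.bddC1.continuous_fderiv
  obtain ⟨D, hD⟩ := hΨ.bddC1.bdd_fderiv
  have hD0 : 0 ≤ D := (norm_nonneg _).trans (hD 0)
  -- A bound for c²/s at all times τ > t/2: c/s ≤ 1/√τ and c ≤ 1. The neighbourhood stays away from
  -- time 0, where this coefficient is unbounded.
  set K := 1 / √(t / 2) with hK
  have hG := memLp_continuousLinearMap γ G (r := ENNReal.ofReal q) ENNReal.ofReal_ne_top
  have hfG : Integrable (fun x => |f x| * ‖G x‖) γ := integrable_mul_of_memLp hpq hf.abs hG.norm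
  have hG1 : Integrable (fun x => ‖G x‖) γ :=
    ((memLp_continuousLinearMap γ G (r := 1) (by simp)).integrable le_rfl).norm
  have hbd : Integrable (fun z : X × X => D * (K * (|f z.1| * ‖G z.2‖) + |f z.1| * ‖G z.1‖))
      (γ.prod γ) := (((hf1.abs.mul_prod hG1).const_mul K).add (hfG.comp_fst γ)).const_mul D
  have key := hasDerivAt_integral_of_dominated_loc_of_deriv_le (μ := γ.prod γ) (s := Set.Ioi (t / 2))
    (x₀ := t) (F := fun (t : ℝ) (z : X × X) =>
      f z.1 * Ψ (Real.exp (-t) • G z.1 + √(1 - Real.exp (-2 * t)) • G z.2))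
    (F' := fun (t : ℝ) (z : X × X) =>
      f z.1 * fderiv ℝ Ψ (Real.exp (-t) • G z.1 + √(1 - Real.exp (-2 * t)) • G z.2)
        ((Real.exp (-t) ^ 2 / √(1 - Real.exp (-2 * t))) • G z.2 - Real.exp (-t) • G z.1))
    (Ioi_mem_nhds (by linarith))
    (Eventually.of_forall fun t => (integrable_mul_comp_mix G hΨ hf1 _ _).1)
    (integrable_mul_comp_mix G hΨ hf1 _ _) ?_ (ae_of_all _ fun z τ hτ => ?_) hbd
    (ae_of_all _ fun z τ hτ => ?_)
  · simp only [integral_mul_cylMehler_eq_prod G hΨ hf1]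
    refine key.2.congr_deriv ?_
    rw [integral_prod _ key.1]
    refine integral_congr_ae ?_
    filter_upwards [divergence_gradField_cylMehler (γ := γ) (c := Real.exp (-t)) G hΨ
      (sqrt_one_sub_exp_pos ht).ne'] with x hx
    rw [hx, integral_const_mul]
  · refine hf1.1.comp_fst.mul (Measurable.aestronglyMeasurable ?_)
    have h1 : Continuous fun w : (Fin n → ℝ) × (Fin n → ℝ) =>
        fderiv ℝ Ψ (Real.exp (-t) • w.1 + √(1 - Real.exp (-2 * t)) • w.2)
        ((Real.exp (-t) ^ 2 / √(1 - Real.exp (-2 * t))) • w.2 - Real.exp (-t) • w.1) := by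
      fun_prop
    exact h1.measurable.comp (g := fun w : (Fin n → ℝ) × (Fin n → ℝ) =>
        fderiv ℝ Ψ (Real.exp (-t) • w.1 + √(1 - Real.exp (-2 * t)) • w.2)
        ((Real.exp (-t) ^ 2 / √(1 - Real.exp (-2 * t))) • w.2 - Real.exp (-t) • w.1))
      (f := fun z : X × X => (G z.1, G z.2)) (by fun_prop)
  · have hτ0 : 0 < τ := lt_trans (by positivity) hτ
    have hs := sqrt_one_sub_exp_pos hτ0
    have hc1 : Real.exp (-τ) ≤ 1 := Real.exp_le_one_iff.2 (by linarith)
    have hc0 := Real.exp_pos (-τ)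
    have h1 : Real.exp (-τ) ^ 2 / √(1 - Real.exp (-2 * τ)) ≤ K := by
      have h2 := sqrt_mul_exp_le hτ0.le
      have h3 : √(t / 2) ≤ √τ := Real.sqrt_le_sqrt hτ.le
      have h4 : 0 < √(t / 2) := Real.sqrt_pos.2 (by positivity)
      rw [hK, div_le_div_iff₀ hs h4]
      nlinarith [mul_le_mul_of_nonneg_right h3 hc0.le]
    rw [norm_mul, Real.norm_eq_abs]
    calc |f z.1| * ‖fderiv ℝ Ψ (Real.exp (-τ) • G z.1 + √(1 - Real.exp (-2 * τ)) • G z.2)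
            ((Real.exp (-τ) ^ 2 / √(1 - Real.exp (-2 * τ))) • G z.2 - Real.exp (-τ) • G z.1)‖
        ≤ |f z.1| * (D * (K * ‖G z.2‖ + 1 * ‖G z.1‖)) := by
          refine mul_le_mul_of_nonneg_left ?_ (abs_nonneg _)
          refine (ContinuousLinearMap.le_opNorm _ _).trans
            (mul_le_mul (hD _) ((norm_sub_le _ _).trans (add_le_add ?_ ?_)) (norm_nonneg _) hD0)
          · rw [norm_smul, Real.norm_of_nonneg (by positivity)]
            gcongr
          · rw [norm_smul, Real.norm_of_nonneg (by positivity)]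
            gcongr
      _ = D * (K * (|f z.1| * ‖G z.2‖) + |f z.1| * ‖G z.1‖) := by ring
  · have hτ0 : 0 < τ := lt_trans (by positivity) hτ
    have h1 : HasDerivAt (fun t => Real.exp (-t)) (-Real.exp (-τ)) τ := by
      simpa using (hasDerivAt_neg τ).exp
    have h2 := (h1.smul_const (G z.1)).add ((hasDerivAt_sqrt_one_sub_exp hτ0).smul_const (G z.2))
    have h3 := ((hΨ.bddC1.differentiable _).hasFDerivAt.comp_hasDerivAt τ h2).const_mul (f z.1)
    refine h3.congr_deriv ?_
    congr 2
    rw [neg_smul]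
    abel

/-- Continuity at time 0 replaces differentiability, which is available at positive times only, and
allows integration from 0. At negative times the square root is 0 by convention. -/
lemma continuous_integral_mul_cylMehler (hΨ : BddSmooth Ψ) {f : X → ℝ} (hf : Integrable f γ) :
    Continuous fun t => ∫ x, f x
        * cylMehler γ (Real.exp (-t)) √(1 - Real.exp (-2 * t)) G Ψ (G x) ∂γ := by
  obtain ⟨C, hC⟩ := hΨ.bddC1.bdd
  have hΨc := hΨ.bddC1.continuous
  simp only [integral_mul_cylMehler_eq_prod G hΨ hf]
  refine continuous_of_dominated (bound := fun z : X × X => |f z.1| * C)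
    (fun t => (integrable_mul_comp_mix G hΨ hf _ _).1) (fun t => ae_of_all _ fun z => ?_)
    ((hf.abs.comp_fst γ).mul_const C) (ae_of_all _ fun z => by fun_prop)
  rw [norm_mul, Real.norm_eq_abs]
  exact mul_le_mul_of_nonneg_left (hC _) (abs_nonneg _)

end TimeDerivative

end GaussianNB

end

open Filter Topology

set_option linter.unusedSectionVars false

noncomputable section

namespace GaussianNB

/-! ### Elementary inequalities in the time variable. -/

section RealInequalities

/-- The left side is (t/2)^{α/2-1}. The exponent is at least -1, so halving the time costs at most a
factor 2. -/
lemma rpow_half_mul_le {α t : ℝ} (hα : 0 ≤ α) (ht : 0 < t) :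
    (t / 2) ^ (-((1 - α) / 2)) * (1 / √(t / 2)) ≤ 2 * t ^ (α / 2 - 1) := by
  have h1 : 1 / √(t / 2) = (t / 2) ^ (-(1 / 2) : ℝ) := by
    rw [Real.sqrt_eq_rpow, Real.rpow_neg (by positivity), one_div]
  have h2 : (1 / 2 : ℝ) ^ (α / 2 - 1) ≤ 2 := by
    calc (1 / 2 : ℝ) ^ (α / 2 - 1) ≤ (1 / 2 : ℝ) ^ (-1 : ℝ) :=
          Real.rpow_le_rpow_of_exponent_ge (by norm_num) (by norm_num) (by linarith)
      _ = 2 := by rw [Real.rpow_neg_one]; norm_num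
  rw [h1, ← Real.rpow_add (by positivity), show t / 2 = t * (1 / 2) by ring,
    Real.mul_rpow ht.le (by norm_num),
    show -((1 - α) / 2) + -(1 / 2) = α / 2 - 1 by ring, mul_comm]
  gcongr

/-- A function whose derivative is dominated by a negative power of time. -/
lemma abs_sub_le_of_hasDerivAt_rpow {ψ ψ' : ℝ → ℝ} (hψ : Continuous ψ)
    (hd : ∀ t, 0 < t → HasDerivAt ψ (ψ' t) t) {K β : ℝ} (hβ : 0 < β)
    (hb : ∀ t, 0 < t → |ψ' t| ≤ K * t ^ (β - 1)) {t : ℝ} (ht : 0 ≤ t) :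
    |ψ t - ψ 0| ≤ K / β * t ^ β := by
  -- For each sign ε the function (K/β) r^β - ε ψ(r) is nondecreasing on [0, ∞), which gives both
  -- one-sided bounds without integrating ψ'.
  have key : ∀ ε : ℝ, |ε| = 1 → ε * (ψ t - ψ 0) ≤ K / β * t ^ β := by
    intro ε hε
    have hB : ∀ r, 0 < r → HasDerivAt (fun r => K / β * r ^ β - ε * ψ r)
        (K * r ^ (β - 1) - ε * ψ' r) r := fun r hr => by
      have h1 := ((Real.hasDerivAt_rpow_const (p := β) (Or.inl hr.ne')).const_mul (K / β)).sub
        ((hd r hr).const_mul ε)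
      refine h1.congr_deriv ?_
      field_simp
    have hmono : MonotoneOn (fun r => K / β * r ^ β - ε * ψ r) (Set.Ici 0) := by
      refine monotoneOn_of_deriv_nonneg (convex_Ici 0) ?_ ?_ ?_
      · exact (((Real.continuous_rpow_const hβ.le).const_mul _).sub
          (hψ.const_mul ε)).continuousOn
      · rw [interior_Ici]
        exact fun r hr => (hB r hr).differentiableAt.differentiableWithinAt
      · rw [interior_Ici]
        intro r hr
        rw [(hB r hr).deriv, sub_nonneg]
        refine (le_abs_self _).trans ?_
        rw [abs_mul, hε, one_mul]
        exact hb r hr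
    have := hmono (Set.mem_Ici.2 le_rfl) (Set.mem_Ici.2 ht) ht
    simp only [Real.zero_rpow hβ.ne'] at this
    linarith
  refine abs_le'.2 ⟨by simpa using key 1 (by simp), by simpa using key (-1) (by simp)⟩

/-- Optimization over time of the two-term bound. -/
lemma le_of_forall_time {I K u A B α : ℝ} (hK : 0 ≤ K) (hA : 0 ≤ A) (hB : 0 ≤ B)
    (hα₀ : 0 < α) (hα₁ : α ≤ 1)
    (h : ∀ t, 0 < t → I ≤ K * t ^ (α / 2) * B + u * t ^ (-((1 - α) / 2)) * A) :
    I ≤ (K + u) * A ^ α * B ^ (1 - α) := by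
  -- The optimal time degenerates when A or B vanishes: for A = 0 let t tend to 0, for B = 0 and α <
  -- 1 let t tend to infinity.
  rcases hA.eq_or_lt with rfl | hA
  · rw [Real.zero_rpow hα₀.ne', mul_zero, zero_mul]
    have h1 : Tendsto (fun t : ℝ => K * t ^ (α / 2) * B) (𝓝[>] 0) (𝓝 0) := by
      have h2 := (((Real.continuous_rpow_const (q := α / 2) (by linarith)).tendsto 0).const_mul
        K).mul_const B
      rw [Real.zero_rpow (by positivity), mul_zero, zero_mul] at h2
      exact h2.mono_left nhdsWithin_le_nhds
    refine ge_of_tendsto h1 ?_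
    filter_upwards [self_mem_nhdsWithin] with t ht
    simpa using h t ht
  rcases hB.eq_or_lt with rfl | hB
  -- For α = 1 the factor 0⁰ is 1 and the claim is I ≤ (K + u)A, which follows from any single time.
  · rcases hα₁.eq_or_lt with rfl | hα₁
    · have := h 1 one_pos
      simp only [sub_self, Real.rpow_zero, Real.rpow_one]
      norm_num at this
      nlinarith [mul_nonneg hK hA.le]
    · rw [Real.zero_rpow (by linarith), mul_zero]
      have h1 : Tendsto (fun t : ℝ => u * t ^ (-((1 - α) / 2)) * A) atTop (𝓝 0) := by
        simpa using ((tendsto_rpow_neg_atTop (show 0 < (1 - α) / 2 by linarith)).const_mul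
          u).mul_const A
      refine ge_of_tendsto h1 ?_
      filter_upwards [eventually_gt_atTop 0] with t ht
      simpa using h t ht
  -- At t = (A/B)² both terms become multiples of A^α B^{1-α}.
  · have h1 := h ((A / B) ^ 2) (by positivity)
    have e : ∀ x : ℝ, ((A / B) ^ 2) ^ x = (A / B) ^ (2 * x) := fun x => by
      rw [← Real.rpow_natCast, ← Real.rpow_mul (by positivity)]
      norm_num
    have e1 : ((A / B) ^ 2) ^ (α / 2) * B = A ^ α * B ^ (1 - α) := by
      rw [e, show 2 * (α / 2) = α by ring, Real.div_rpow hA.le hB.le, Real.rpow_sub hB,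
        Real.rpow_one]
      field_simp
    have e2 : ((A / B) ^ 2) ^ (-((1 - α) / 2)) * A = A ^ α * B ^ (1 - α) := by
      rw [e, show 2 * -((1 - α) / 2) = -(1 - α) by ring, Real.div_rpow hA.le hB.le,
        Real.rpow_neg hA.le, Real.rpow_neg hB.le, Real.rpow_sub hA, Real.rpow_one]
      field_simp
    rw [mul_assoc, e1, mul_assoc, e2] at h1
    linarith

end RealInequalities

/-! ### The bound of V by U and the equivalence. -/

section SecondInequality

variable {X : Type*} [AddCommGroup X] [Module ℝ X] [TopologicalSpace X]
  [IsTopologicalAddGroup X] [ContinuousSMul ℝ X] [LocallyConvexSpace ℝ X] [T2Space X]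
  [MeasurableSpace X] [BorelSpace X]
  {γ : Measure X} [IsGaussian γ] {p q α : ℝ}

/-- Hölder's inequality for the Sobolev norm of the gradient. -/
lemma ofReal_abs_integral_mul_divergence_le [IsCenteredMeasure γ] (hpq : p.HolderConjugate q)
    {u : X → ℝ} {F₀ : X → CameronMartin γ}
    (hu : IsSobolevGradient γ (ENNReal.ofReal p) u F₀) {Φ : CylField γ} (hΦ : Φ.IsBounded) :
    ENNReal.ofReal |∫ x, u x * Φ.divergence x ∂γ|
      ≤ ENNReal.ofReal (lpNorm Φ.field (ENNReal.ofReal q) γ) * gradNorm γ (ENNReal.ofReal p) u := by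
  have h1 : ∀ F, IsSobolevGradient γ (ENNReal.ofReal p) u F →
      |∫ x, u x * Φ.divergence x ∂γ|
        ≤ lpNorm Φ.field (ENNReal.ofReal q) γ * lpNorm F (ENNReal.ofReal p) γ := fun F hF => by
    have := abs_integral_inner_le hpq.symm (hΦ.memLp_field _) hF.2.1
    rwa [hF.2.2 Φ hΦ, abs_neg] at this
  -- If the field has norm 0, the factor cannot be moved inside the infimum; the known gradient F₀
  -- shows directly that the left side vanishes.
  by_cases h0 : lpNorm Φ.field (ENNReal.ofReal q) γ = 0
  · have := h1 F₀ hu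
    rw [h0, zero_mul] at this
    rw [ENNReal.ofReal_of_nonpos this]
    exact zero_le
  · have h0' : ENNReal.ofReal (lpNorm Φ.field (ENNReal.ofReal q) γ) ≠ 0 := by
      have : 0 < lpNorm Φ.field (ENNReal.ofReal q) γ := lt_of_le_of_ne lpNorm_nonneg (Ne.symm h0)
      simpa using this
    rw [gradNorm, ENNReal.mul_iInf_of_ne h0' ENNReal.ofReal_ne_top]
    refine le_iInf fun F => ?_
    rw [ENNReal.mul_iInf_of_ne h0' ENNReal.ofReal_ne_top]
    refine le_iInf fun hF => ?_
    rw [← ofReal_lpNorm hF.2.1, ← ENNReal.ofReal_mul lpNorm_nonneg]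
    exact ENNReal.ofReal_le_ofReal (h1 F hF)

lemma gradNorm_ouSemigroup_le {f : X → ℝ} (hU : semigroupVariation γ p α f ≠ ⊤) {t : ℝ}
    (ht : 0 < t) : gradNorm γ (ENNReal.ofReal p) (ouSemigroup γ t f)
      ≤ ENNReal.ofReal ((semigroupVariation γ p α f).toReal * t ^ (-((1 - α) / 2))) := by
  have h1 : ENNReal.ofReal (t ^ ((1 - α) / 2)) * gradNorm γ (ENNReal.ofReal p) (ouSemigroup γ t f)
      ≤ semigroupVariation γ p α f := le_iSup₂_of_le t ht le_rfl
  have hpos : 0 < t ^ ((1 - α) / 2) := Real.rpow_pos_of_pos ht _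
  have h2 : ENNReal.ofReal (t ^ ((1 - α) / 2)) ≠ 0 := by simpa using hpos
  rw [← ENNReal.mul_le_mul_iff_right h2 ENNReal.ofReal_ne_top]
  refine h1.trans_eq ?_
  rw [← ENNReal.ofReal_mul hpos.le, Real.rpow_neg ht.le, mul_comm _ (t ^ ((1 - α) / 2))⁻¹,
    mul_inv_cancel_left₀ hpos.ne', ENNReal.ofReal_toReal hU]

variable [IsCenteredMeasure γ] [γ.InnerRegular]

lemma abs_integral_ouSemigroup_mul_divergence_le (hpq : p.HolderConjugate q) {f : X → ℝ}
    (hf : MemLp f (ENNReal.ofReal p) γ) (hU : semigroupVariation γ p α f ≠ ⊤) {t : ℝ} (ht : 0 < t)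
    {Φ : CylField γ} (hΦ : Φ.IsBounded) :
    |∫ x, ouSemigroup γ t f x * Φ.divergence x ∂γ|
      ≤ (semigroupVariation γ p α f).toReal * t ^ (-((1 - α) / 2))
        * lpNorm Φ.field (ENNReal.ofReal q) γ := by
  obtain ⟨F, hF⟩ := exists_isSobolevGradient_mehler hpq (exp_sq_add_sqrt_sq ht.le)
    (Real.exp_pos (-t)).le (sqrt_one_sub_exp_pos ht) hf
  have h1 := (ofReal_abs_integral_mul_divergence_le hpq hF hΦ).trans
    (mul_le_mul_right (gradNorm_ouSemigroup_le hU ht) _)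
  have h2 : 0 ≤ (semigroupVariation γ p α f).toReal * t ^ (-((1 - α) / 2)) := by positivity
  rw [← ENNReal.ofReal_mul lpNorm_nonneg,
    ENNReal.ofReal_le_ofReal_iff (mul_nonneg lpNorm_nonneg h2)] at h1
  exact h1.trans_eq (mul_comm _ _)

/-- Half of the time is spent on f, where ‖∇T_{t/2}f‖_p ≤ U (t/2)^{-(1-α)/2}, and half on the test
function, whose gradient costs C(p)(t/2)^{-1/2}. The product is integrable in time at 0 precisely
because α > 0. -/
lemma abs_integral_mul_generator_le (hpq : p.HolderConjugate q) (hα : 0 ≤ α) {f : X → ℝ}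
    (hf : MemLp f (ENNReal.ofReal p) γ) (hU : semigroupVariation γ p α f ≠ ⊤) {n : ℕ}
    (G : X →L[ℝ] (Fin n → ℝ)) {Ψ : (Fin n → ℝ) → ℝ} (hΨ : BddSmooth Ψ) {t : ℝ} (ht : 0 < t) :
    |∫ x, f x * (gradField (γ := γ) G (bddSmooth_cylMehler (γ := γ) (c := Real.exp (-t))
        (s := √(1 - Real.exp (-2 * t))) G hΨ)).divergence x ∂γ|
      ≤ 2 * (semigroupVariation γ p α f).toReal * gaussianMomentConst p
        * lpNorm (fun x => Ψ (G x)) (ENNReal.ofReal q) γ * t ^ (α / 2 - 1) := by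
  have ha : 0 < t / 2 := by linarith
  have hcs := exp_sq_add_sqrt_sq ha.le
  have hcs' := exp_sq_add_sqrt_sq ht.le
  have hs := sqrt_one_sub_exp_pos ha
  have hs' := sqrt_one_sub_exp_pos ht
  have hc := Real.exp_pos (-(t / 2))
  have hcc : Real.exp (-t) = Real.exp (-(t / 2)) ^ 2 := by
    rw [← Real.exp_nat_mul]; congr 1; push_cast; ring
  have hsc := sqrt_mul_exp_le ha.le
  have hU' := fun Φ hΦ => abs_integral_ouSemigroup_mul_divergence_le hpq hf hU ha (Φ := Φ) hΦ
  have hou : ouSemigroup γ (t / 2) f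
    = mehler γ (Real.exp (-(t / 2))) √(1 - Real.exp (-2 * (t / 2))) f := rfl
  rw [hou] at hU'
  have hsplit := integral_mul_divergence_gradField_split (γ := γ) G hΨ
    (s' := √(1 - Real.exp (-2 * t))) hpq hcs hcc (by
      rw [hcc] at hcs'
      linear_combination (1 + Real.exp (-(t / 2)) ^ 2) * hcs - hcs') hs'.ne' hf
  rw [hsplit]
  refine (hU' _ (isBounded_gradField G _)).trans ?_
  have h1 := lpNorm_gradField_cylMehler_le (γ := γ) G hΨ hpq.symm hcs hc.le hs
  have hC := gaussianMomentConst_nonneg p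
  set N := lpNorm (fun x => Ψ (G x)) (ENNReal.ofReal q) γ
  have hN : 0 ≤ N := lpNorm_nonneg
  have h2 : Real.exp (-(t / 2)) / √(1 - Real.exp (-2 * (t / 2))) ≤ 1 / √(t / 2) := by
    rw [div_le_div_iff₀ hs (Real.sqrt_pos.2 ha)]
    linarith
  set u := (semigroupVariation γ p α f).toReal
  have hu : 0 ≤ u := ENNReal.toReal_nonneg
  calc _ ≤ u * (t / 2) ^ (-((1 - α) / 2)) * (1 / √(t / 2) * gaussianMomentConst p * N) := by
        refine mul_le_mul_of_nonneg_left (h1.trans ?_) (by positivity)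
        gcongr
    _ = u * gaussianMomentConst p * N * ((t / 2) ^ (-((1 - α) / 2)) * (1 / √(t / 2))) := by ring
    _ ≤ u * gaussianMomentConst p * N * (2 * t ^ (α / 2 - 1)) :=
        mul_le_mul_of_nonneg_left (rpow_half_mul_le hα ht) (by positivity)
    _ = _ := by ring

/-- Against cylindrical functions, symmetry moves the semigroup off f, and the generator bound is
integrated in time. Integration of r^{α/2-1} contributes 2/α, which together with the factor 2 of
the generator bound gives 4/α. -/
lemma abs_integral_sub_ouSemigroup_mul_le (hpq : p.HolderConjugate q) (hα : 0 < α) {f : X → ℝ}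
    (hf : MemLp f (ENNReal.ofReal p) γ) (hU : semigroupVariation γ p α f ≠ ⊤) {t : ℝ} (ht : 0 < t)
    {w : X → ℝ} (hw : MemLp w (ENNReal.ofReal q) γ) :
    |∫ x, (f x - ouSemigroup γ t f x) * w x ∂γ|
      ≤ 4 * gaussianMomentConst p / α * (semigroupVariation γ p α f).toReal * t ^ (α / 2)
        * lpNorm w (ENNReal.ofReal q) γ := by
  have hcs := exp_sq_add_sqrt_sq ht.le
  have hTf : MemLp (ouSemigroup γ t f) (ENNReal.ofReal p) γ := (memLp_mehler hcs hpq.lt.le hf).1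
  have hC := gaussianMomentConst_nonneg p
  refine abs_integral_mul_le_of_cylindrical γ hpq (hf.sub hTf) (by positivity) (fun φ hφ => ?_) hw
  have hφm := hφ.memLp γ (ENNReal.ofReal q)
  have hsym : ∫ x, ouSemigroup γ t f x * φ x ∂γ = ∫ x, f x * mehler γ (Real.exp (-t))
      √(1 - Real.exp (-2 * t)) φ x ∂γ := integral_mehler_mul_comm hpq hcs hf hφ
  simp only [Pi.sub_apply, sub_mul]
  rw [integral_sub (integrable_mul_of_memLp hpq hf hφm) (integrable_mul_of_memLp hpq hTf hφm), hsym]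
  obtain ⟨n, G, Ψ, hΨ, rfl⟩ := hφ
  have hf1 : Integrable f γ := hf.integrable (by simpa using hpq.lt.le)
  have h1 := abs_sub_le_of_hasDerivAt_rpow (continuous_integral_mul_cylMehler G hΨ hf1)
    (fun r hr => hasDerivAt_integral_mul_cylMehler G hΨ hpq hf hr) (β := α / 2) (by positivity)
    (fun r hr => abs_integral_mul_generator_le hpq hα.le hf hU G hΨ hr) ht.le
  have h0 : ∀ z, cylMehler γ (Real.exp (-0)) √(1 - Real.exp (-2 * 0)) G Ψ z = Ψ z := fun z => by
    simp [cylMehler]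
  simp only [h0] at h1
  simp only [mehler_cylindrical]
  rw [abs_sub_comm]
  refine h1.trans_eq ?_
  field_simp
  ring

/-- The divergence inequality follows from the bound of the gradient of the semigroup. -/
theorem divergenceBound_of_semigroupVariation_ne_top (hpq : p.HolderConjugate q) (hα₀ : 0 < α)
    (hα₁ : α ≤ 1) {f : X → ℝ} (hf : MemLp f (ENNReal.ofReal p) γ)
    (hU : semigroupVariation γ p α f ≠ ⊤) :
    DivergenceBound γ q α f
      ((4 * gaussianMomentConst p / α + 1) * (semigroupVariation γ p α f).toReal) := by
  intro Φ hΦc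
  have hΦ := hΦc.isBounded
  have hC := gaussianMomentConst_nonneg p
  rw [add_mul, one_mul]
  -- Here A is the norm of the field and B that of its divergence; K = 4C(p)α⁻¹U comes from f - T_t
  -- f and u = U from T_t f.
  refine le_of_forall_time (by positivity) lpNorm_nonneg lpNorm_nonneg hα₀ hα₁ fun t ht => ?_
  have hdm := hΦ.memLp_divergence (γ := γ) (r := ENNReal.ofReal q) ENNReal.ofReal_ne_top
  have hTf : MemLp (ouSemigroup γ t f) (ENNReal.ofReal p) γ :=
    (memLp_mehler (exp_sq_add_sqrt_sq ht.le) hpq.lt.le hf).1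
  have h1 := abs_integral_sub_ouSemigroup_mul_le hpq hα₀ hf hU ht hdm
  have h2 := abs_integral_ouSemigroup_mul_divergence_le hpq hf hU ht hΦ
  simp only [sub_mul] at h1
  rw [integral_sub (integrable_mul_of_memLp hpq hf hdm) (integrable_mul_of_memLp hpq hTf hdm)] at h1
  linarith [(abs_le.1 h1).2, (abs_le.1 h2).2]

/-- The divergence inequality is controlled by the gradient of the semigroup. -/
theorem divergenceVariation_le (hpq : p.HolderConjugate q) (hα₀ : 0 < α) (hα₁ : α ≤ 1)
    {f : X → ℝ} (hf : MemLp f (ENNReal.ofReal p) γ) :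
    divergenceVariation γ q α f
      ≤ ENNReal.ofReal (4 * gaussianMomentConst p / α + 1) * semigroupVariation γ p α f := by
  have hC := gaussianMomentConst_nonneg p
  have hpos : 0 < 4 * gaussianMomentConst p / α + 1 := by positivity
  by_cases hU : semigroupVariation γ p α f = ⊤
  · rw [hU, ENNReal.mul_top (by simpa using hpos)]
    exact le_top
  · have h1 := divergenceBound_of_semigroupVariation_ne_top hpq hα₀ hα₁ hf hU
    refine (iInf₂_le (⟨_, mul_nonneg hpos.le ENNReal.toReal_nonneg⟩ : ℝ≥0) h1).trans_eq ?_
    rw [← ENNReal.ofReal_toReal hU, ← ENNReal.ofReal_mul hpos.le, ENNReal.ofReal_toReal hU]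
    exact (ENNReal.ofReal_eq_coe_nnreal _).symm

theorem memNikolskiiBesov_iff (hpq : p.HolderConjugate q) (hα₀ : 0 < α) (hα₁ : α ≤ 1)
    {f : X → ℝ} (hf : MemLp f (ENNReal.ofReal p) γ) :
    MemNikolskiiBesov γ p q α f ↔ semigroupVariation γ p α f < ⊤ := by
  refine ⟨fun ⟨_, C, hC⟩ => ?_, fun h =>
    ⟨hf, _, divergenceBound_of_semigroupVariation_ne_top hpq hα₀ hα₁ hf h.ne⟩⟩
  -- Membership allows a negative constant, which may be enlarged to its positive part.
  have h1 : DivergenceBound γ q α f (C.toNNReal : ℝ) := hC.mono (Real.le_coe_toNNReal C)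
  exact (h1.semigroupVariation_le hpq hα₀ hα₁ hf).trans_lt (by finiteness)

end SecondInequality

end GaussianNB

end

theorem theorem3p2 {X : Type*} [AddCommGroup X] [Module ℝ X] [TopologicalSpace X]
    [IsTopologicalAddGroup X] [ContinuousSMul ℝ X] [LocallyConvexSpace ℝ X] [T2Space X]
    [MeasurableSpace X] [BorelSpace X]
    (γ : Measure X) [IsGaussian γ] [γ.InnerRegular]
    (hcentered : ∀ l : X →L[ℝ] ℝ, ∫ x, l x ∂γ = 0)
    (p q α : ℝ) (hp : 1 < p) (hpq : 1 / p + 1 / q = 1) (hα₀ : 0 < α) (hα₁ : α ≤ 1)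
    (f : X → ℝ) (hf : MemLp f (ENNReal.ofReal p) γ) :
    (GaussianNB.MemNikolskiiBesov γ p q α f ↔ GaussianNB.semigroupVariation γ p α f < ⊤) ∧
    GaussianNB.semigroupVariation γ p α f
      ≤ ENNReal.ofReal (GaussianNB.gaussianMomentConst q ^ (1 - α)) * GaussianNB.divergenceVariation γ q α f ∧
    GaussianNB.divergenceVariation γ q α f
      ≤ ENNReal.ofReal (4 * GaussianNB.gaussianMomentConst p / α + 1) * GaussianNB.semigroupVariation γ p α f := by
  have : GaussianNB.IsCenteredMeasure γ := ⟨hcentered⟩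
  have hpq' : p.HolderConjugate q := Real.holderConjugate_iff.2 ⟨hp, by simpa using hpq⟩
  exact ⟨GaussianNB.memNikolskiiBesov_iff hpq' hα₀ hα₁ hf,
    GaussianNB.semigroupVariation_le hpq' hα₀ hα₁ hf,
    GaussianNB.divergenceVariation_le hpq' hα₀ hα₁ hf⟩
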